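/- Let $\nu\ge 3$ be an integer, $X=\mathbb{R}^\nu$, $\mathcal{H}=L^2(X)$ (complex valued functions), $\mathcal{H}^1$ the Sobolev space with norm $\|f\|_1^2=\int(|f|^2+|\nabla f|^2)\,dx$, $\mathcal{H}^{-1}$ its adjoint space, $q$ multiplication by $x$ and $p=-i\nabla$. For a $C^\infty$ vector field $u:X\to X$ with all derivatives of order $\ge 1$ bounded, let $A_u=\frac12\sum_{j}(u_j(p)q_j+q_ju_j(p))$, a self-adjoint operator in $\mathcal{H}$ (the closure of its restriction to $C_c^\infty(X)$), whose unitary group $e^{i\tau A_u}$ leaves $\mathcal{H}^1$ invariant and extends to $\mathcal{H}^{-1}$; let $A_D=\frac12(p\cdot q+q\cdot p)$, which is $A_u$ for $u(x)=x$. Let $\mathcal{U}$ be the set of bounded $C^\infty$ vector fields $u$ with all derivatives bounded and $x\cdot u(x)>0$ for all $x\ne0$. For a bounded operator $T:\mathcal{H}^1\to\mathcal{H}^{-1}$ put $T_\tau=e^{i\tau A_u}Te^{-i\tau A_u}$; $T$ is of class $C^1(A_u,\mathcal{H}^1,\mathcal{H}^{-1})$ if $\tau\mapsto T_\tau f\in\mathcal{H}^{-1}$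 is $C^1$ for every $f\in\mathcal{H}^1$, and of class $C^{1,1}(A_u,\mathcal{H}^1,\mathcal{H}^{-1})$ if $\int_0^1\|T_\tau+T_{-\tau}-2T\|_{B(\mathcal{H}^1,\mathcal{H}^{-1})}\,\tau^{-2}\,d\tau<\infty$. Let $\chi:\mathbb{R}\to\mathbb{R}$ be of class $C^3$ with $\chi(t)=0$ for $|t|>1$ and $\chi'(0)=\chi''(0)=1$, and let $$V(x)=\sum_{n=2}^{\infty} n^{(3\nu-1)/2}\,\chi'\bigl(n^{3\nu/2}(|x|-n)\bigr),$$ a sum with finitely many nonzero terms for each $x$. Then: 1. multiplication by $V$, that is the form $(g,Vf)=\int V f\bar g\,dx$ on $C_c^\infty(X)$, extends to a compact operator $V:\mathcal{H}^1\to\mathcal{H}^{-1}$; 2. there is $u\in\mathcal{U}$ such that $V$ is of class $C^{1,1}(A_u,\mathcal{H}^1,\mathcal{H}^{-1})$; 3. $V$ is not $\Delta$-bounded, that is, there are no constants $a,b$ such that $Vf\in L^2(X)$ and $\|Vf\|\le a\|\Delta f\|+b\|f\|$ for all $f$ in the domain $\mathcal{H}^2$ of $\Delta$; 4. $V$ is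 not of class $C^1(A_D,\mathcal{H}^1,\mathcal{H}^{-1})$. -/

import Mathlib

open MeasureTheory SchwartzMap TemperedDistribution LineDeriv Laplacian FourierTransform
open scoped ContDiff ComplexConjugate

noncomputable section

namespace LAP

/-- The configuration space `X = ℝ^ν` with its Euclidean structure. -/
abbrev X (ν : ℕ) := EuclideanSpace ℝ (Fin ν)

/-- The Hilbert space `L²(X)` of complex valued functions. -/
abbrev L2 (ν : ℕ) := Lp ℂ 2 (volume : Measure (X ν))

/-- The `j`-th vector of the canonical basis of `ℝ^ν`. -/
def basisVec {ν : ℕ} (j : Fin ν) : X ν := EuclideanSpace.single j 1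

/-- The graph of the distributional gradient in `L²`: the pairs `(f, F)` with `f ∈ L²` and
`F j = ∂_j f ∈ L²` for every `j`, inside the Hilbert space direct sum of `L²` and `(L²)^ν`. -/
def gradGraph (ν : ℕ) : Submodule ℂ (WithLp 2 (L2 ν × PiLp 2 (fun _ : Fin ν => L2 ν))) where
  carrier := {h | ∀ j : Fin ν, ∂_{basisVec j} (h.fst : 𝓢'(X ν, ℂ)) = (h.snd j : 𝓢'(X ν, ℂ))}
  add_mem' := by
    intro a b ha hb j
    have ha' : ∂_{basisVec j} (a.fst : 𝓢'(X ν, ℂ)) = (a.snd j : 𝓢'(X ν, ℂ)) := ha j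
    have hb' : ∂_{basisVec j} (b.fst : 𝓢'(X ν, ℂ)) = (b.snd j : 𝓢'(X ν, ℂ)) := hb j
    simp only [← Lp.toTemperedDistributionCLM_apply] at ha' hb' ⊢
    rw [WithLp.add_fst, WithLp.add_snd, PiLp.add_apply, map_add, map_add, lineDerivOp_add,
      ha', hb']
  zero_mem' := by
    intro j
    simp only [← Lp.toTemperedDistributionCLM_apply]
    rw [WithLp.zero_fst, WithLp.zero_snd, PiLp.zero_apply, map_zero, lineDerivOp_zero]
  smul_mem' := by
    intro c a ha j
    have ha' : ∂_{basisVec j} (a.fst : 𝓢'(X ν, ℂ)) = (a.snd j : 𝓢'(X ν, ℂ)) := ha j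
    simp only [← Lp.toTemperedDistributionCLM_apply] at ha' ⊢
    rw [WithLp.smul_fst, WithLp.smul_snd, PiLp.smul_apply, map_smul, map_smul, lineDerivOp_smul,
      ha']

/-- The Sobolev space `H¹(X)`, identified with the graph of the gradient, so that its Hilbert
norm is `‖f‖₁² = ‖f‖² + ∑ j, ‖∂_j f‖²`. -/
def H1 (ν : ℕ) : Type := gradGraph ν

instance instNormedAddCommGroupH1 (ν : ℕ) : NormedAddCommGroup (H1 ν) :=
  inferInstanceAs (NormedAddCommGroup (gradGraph ν))

instance instInnerProductSpaceH1 (ν : ℕ) : InnerProductSpace ℂ (H1 ν) :=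
  inferInstanceAs (InnerProductSpace ℂ (gradGraph ν))

/-- The embedding `H¹ ⊂ L²`. -/
def H1.toL2 {ν : ℕ} (h : H1 ν) : L2 ν := h.1.fst

/-- A Schwartz function belongs to `H¹`, with its classical gradient. -/
theorem mem_gradGraph {ν : ℕ} (φ : 𝓢(X ν, ℂ)) (j : Fin ν) :
    ∂_{basisVec j} ((φ.toLp 2 : L2 ν) : 𝓢'(X ν, ℂ)) = (((∂_{basisVec j} φ).toLp 2 : L2 ν) : 𝓢'(X ν, ℂ)) := by
  have h1 := Lp.toTemperedDistribution_toLp_eq (μ := (volume : Measure (X ν))) (p := 2) φ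
  have h2 := Lp.toTemperedDistribution_toLp_eq (μ := (volume : Measure (X ν))) (p := 2)
    (∂_{basisVec j} φ)
  have h3 := lineDerivOp_toTemperedDistributionCLM_eq (μ := (volume : Measure (X ν))) φ (basisVec j)
  exact (congrArg (fun w : 𝓢'(X ν, ℂ) => ∂_{basisVec j} w) h1).trans (h3.trans h2.symm)

/-- The pair `(φ, ∇φ)` of a Schwartz function and its gradient. -/
def gradPair {ν : ℕ} (φ : 𝓢(X ν, ℂ)) : WithLp 2 (L2 ν × PiLp 2 (fun _ : Fin ν => L2 ν)) :=
  WithLp.toLp 2 ((φ.toLp 2 : L2 ν), WithLp.toLp 2 (fun j : Fin ν => ((∂_{basisVec j} φ).toLp 2 : L2 ν)))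

/-- A Schwartz function as an element of `H¹`. -/
def toH1 {ν : ℕ} (φ : 𝓢(X ν, ℂ)) : H1 ν :=
  (⟨gradPair φ, fun j => mem_gradGraph φ j⟩ : gradGraph ν)

/-- The adjoint space `H⁻¹` of `H¹`: the bounded antilinear functionals on `H¹`, with the
dual norm. For `T : H¹ → H⁻¹`, the number `T f g` is the pairing `(g, T f)`. -/
abbrev Hneg1 (ν : ℕ) := H1 ν →L⋆[ℂ] ℂ

/-- `T ∈ B(H¹, H⁻¹)` is the operator of multiplication by the real function `V`:
`(ψ, T φ) = ∫ V φ ψ̄` for all `φ, ψ ∈ C_c^∞(X)` (which determines `T`, by density). -/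
def IsMultiplicationBy {ν : ℕ} (V : X ν → ℝ) (T : H1 ν →L[ℂ] Hneg1 ν) : Prop :=
  ∀ φ ψ : 𝓢(X ν, ℂ), HasCompactSupport φ → HasCompactSupport ψ →
    T (toH1 φ) (toH1 ψ) = ∫ x, (V x : ℂ) * φ x * conj (ψ x)

/-- `V` is `Δ`-bounded: every `f` in the domain `{f ∈ L² | Δ f ∈ L²}` of the Laplacian is mapped
into `L²` by multiplication by `V`, with `‖V f‖ ≤ a ‖Δ f‖ + b ‖f‖`. -/
def IsLaplacianBounded {ν : ℕ} (V : X ν → ℝ) : Prop :=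
  ∃ a b : ℝ, ∀ f g : L2 ν, Δ (f : 𝓢'(X ν, ℂ)) = (g : 𝓢'(X ν, ℂ)) →
    ∃ h : L2 ν, (h =ᵐ[volume] fun x => (V x : ℂ) * f x) ∧ ‖h‖ ≤ a * ‖g‖ + b * ‖f‖

/-- The class `𝒰` of bounded smooth vector fields with bounded derivatives of every order such
that `x · u(x) > 0` for all `x ≠ 0`. -/
def VectorFieldClass (ν : ℕ) : Set (X ν → X ν) :=
  {u | ContDiff ℝ ∞ u ∧ (∀ n : ℕ, ∃ C : ℝ, ∀ x, ‖iteratedFDeriv ℝ n u x‖ ≤ C) ∧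
    ∀ x, x ≠ 0 → 0 < inner ℝ x (u x)}

/-- The operator `q_j` of multiplication by the `j`-th coordinate, on Schwartz functions. -/
def qOp {ν : ℕ} (j : Fin ν) : 𝓢(X ν, ℂ) →L[ℂ] 𝓢(X ν, ℂ) :=
  smulLeftCLM ℂ (fun x : X ν => ((x j : ℝ) : ℂ))

/-- The operator `m(p)`, `p = -i∇`, on Schwartz functions. The factor `2π` is there because the
Fourier transform of Mathlib has kernel `exp (-2πi x·ξ)`, for which `p` becomes multiplication by
`2π ξ`. -/
def pFun {ν : ℕ} (m : X ν → ℝ) : 𝓢(X ν, ℂ) →L[ℂ] 𝓢(X ν, ℂ) :=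
  SchwartzMap.fourierMultiplierCLM ℂ (fun ξ : X ν => ((m ((2 * Real.pi) • ξ) : ℝ) : ℂ))

/-- `A_u = ½ ∑_j (u_j(p) q_j + q_j u_j(p))` on Schwartz functions. -/
def conjOp {ν : ℕ} (u : X ν → X ν) (φ : 𝓢(X ν, ℂ)) : 𝓢(X ν, ℂ) :=
  (1 / 2 : ℂ) • ∑ j : Fin ν,
    (pFun (fun k => u k j) (qOp j φ) + qOp j (pFun (fun k => u k j) φ))

/-- `U` is the unitary group `t ↦ exp (i t A_u)` on `L²`: a strongly continuous one-parameter
unitary group whose generator is the closure of `A_u` on `C_c^∞(X)` (an equality of graphs). -/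
structure IsUnitaryGroup {ν : ℕ} (u : X ν → X ν) (U : ℝ → (L2 ν ≃ₗᵢ[ℂ] L2 ν)) : Prop where
  map_zero : U 0 = 1
  map_add : ∀ s t, U (s + t) = U s * U t
  continuous : ∀ f, Continuous fun t => U t f
  generator : {p : L2 ν × L2 ν | HasDerivAt (fun t : ℝ => U t p.1) (Complex.I • p.2) 0} =
    closure {p | ∃ φ : 𝓢(X ν, ℂ), HasCompactSupport φ ∧ p = (φ.toLp 2, (conjOp u φ).toLp 2)}

/-- `S` is the group `t ↦ exp (i t A_u)` on `H¹`, that is, the restriction to `H¹` of the unitary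
group on `L²`. There is at most one such `S`. -/
def IsSobolevGroup {ν : ℕ} (u : X ν → X ν) (S : ℝ → (H1 ν →L[ℂ] H1 ν)) : Prop :=
  ∃ U : ℝ → (L2 ν ≃ₗᵢ[ℂ] L2 ν), IsUnitaryGroup u U ∧ ∀ t f, (S t f).toL2 = U t f.toL2

/-- The adjoint `H⁻¹ → H⁻¹` of a bounded operator `H¹ → H¹`. -/
def dualMap {ν : ℕ} (B : H1 ν →L[ℂ] H1 ν) : Hneg1 ν →L[ℂ] Hneg1 ν :=
  ContinuousLinearMap.precomp ℂ B

/-- `T_τ = exp (iτA) T exp (-iτA)` in `B(H¹, H⁻¹)`, where `S` is the group on `H¹`, and where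
`exp (iτA)` on `H⁻¹` is the adjoint of `exp (-iτA)` on `H¹`. -/
def evolve {ν : ℕ} (S : ℝ → (H1 ν →L[ℂ] H1 ν)) (T : H1 ν →L[ℂ] Hneg1 ν) (τ : ℝ) :
    H1 ν →L[ℂ] Hneg1 ν :=
  dualMap (S (-τ)) ∘L T ∘L S (-τ)

/-- `T` is of class `C¹(A_u, H¹, H⁻¹)`: `τ ↦ T_τ f` is `C¹` for every `f ∈ H¹`. -/
def IsClassC1 {ν : ℕ} (u : X ν → X ν) (T : H1 ν →L[ℂ] Hneg1 ν) : Prop :=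
  ∃ S, IsSobolevGroup u S ∧ ∀ f : H1 ν, ContDiff ℝ 1 (fun τ : ℝ => evolve S T τ f)

/-- `T` is of class `C^{1,1}(A_u, H¹, H⁻¹)`: `∫_0^1 ‖T_τ + T_{-τ} - 2 T‖ dτ / τ² < ∞`. -/
def IsClassC11 {ν : ℕ} (u : X ν → X ν) (T : H1 ν →L[ℂ] Hneg1 ν) : Prop :=
  ∃ S, IsSobolevGroup u S ∧
    ∫⁻ τ in Set.Ioc (0 : ℝ) 1,
      ENNReal.ofReal (‖evolve S T τ + evolve S T (-τ) - (2 : ℂ) • T‖ / τ ^ 2) < ⊤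

/-- The term of index `n` of the series defining the potential. -/
def potentialTerm (ν : ℕ) (χ : ℝ → ℝ) (n : ℕ) (x : X ν) : ℝ :=
  (n : ℝ) ^ ((3 * (ν : ℝ) - 1) / 2) * deriv χ ((n : ℝ) ^ (3 * (ν : ℝ) / 2) * (‖x‖ - n))

/-- The potential `V(x) = ∑_{n ≥ 2} n^{(3ν-1)/2} χ'(n^{3ν/2} (|x| - n))`. -/
def potential (ν : ℕ) (χ : ℝ → ℝ) (x : X ν) : ℝ :=
  ∑' n : Set.Ici (2 : ℕ), potentialTerm ν χ n x

end LAP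

end

/-! Write `P = n^{(3ν-1)/2}` for the height and `1/N`, with `N = n^{3ν/2}`, for the width of the
term `V_n` on its shell around `|x| = n`. The terms are very high and live on very thin shells, but
they oscillate: `χ'(N(r-n))` is `N⁻¹` times the radial derivative of `χ(N(r-n))`.

Positive part. Integrating by parts along the radial field (`integral_radial`) moves this derivative
onto `F Ḡ` and gains `N⁻¹`. What remains is supported on a shell of width of order `1/N`, where the
mass of a function is at most a constant times `N⁻¹` times its `H¹` energy on the surrounding shell
of width 2 (`exists_shell_estimate`). Cauchy–Schwarz then bounds the form of `V_n` by `P N^{-3/2} ≤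
n^{-11/4}` times the square roots of the two local energies (`exists_form_estimate`,
`exists_potentialTerm_estimate`). Hence the series converges in norm from `H¹` to `H⁻¹`. Each term
is compact by a Rellich argument, so the sum is compact.

Class `C^{1,1}`. Take `u_j(k) = tanh k_j`. As `u` is bounded together with its derivatives, `A_u`
contains one position and only bounded functions of momentum, so on the shell of radius `n` it costs
one factor `n` and no derivative (`HasOrder.exists_shellEnergy_le`). The second derivative of the
form of `V_n` along the group contains `A_u` twice, so the second difference of `V_n` is at most `C
n^{-3/4} τ²`; it is also at most `C n^{-11/4}`. Interpolation with weights 3/4 and 1/4 gives `C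
n^{-5/4} τ^{3/2}`, which is summable in `n`, and `τ^{3/2} τ^{-2}` is integrable at zero.

Negative part. On functions equal to 1 on a large ball, multiplication by `V` sees the height `P`
without cancellation, and the `L²` norm of `V f` is too large for `Δ`-boundedness
(`not_isLaplacianBounded`). For dilations, the velocity grows with `|x|`, so the derivative of `V`
along the group has size `P N n` on the `n`-th shell. Bumps of radius of order `1/N` placed there
show that `‖T_τ - T‖ / τ` would be at least of order `√n` for small `τ`, while the class `C¹` makes
it bounded (`not_isClassC1`).

The groups. In momentum space `A_u` is a symmetrised vector field, so `exp(itA_u)` is transport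
along a flow with the square root of the Jacobian. Both fields used here act coordinatewise and have
explicit one-dimensional flows, `dilationFlow` and `tanhFlow`. Schwartz functions whose Fourier
transform has compact support are preserved by the group and form a core of the generator. The flow
distorts each coordinate by at most `exp |t|`, which gives the action on `H¹`. -/

noncomputable section

namespace LAP

/-! ### One-parameter unitary groups: uniqueness, closed generators and invariant cores. -/

section UnitaryGroup

open Filter Topology

variable {H : Type*} [NormedAddCommGroup H] [InnerProductSpace ℂ H]

/-- A strongly continuous one-parameter unitary group. -/
structure IsOneParamGroup (U : ℝ → (H ≃ₗᵢ[ℂ] H)) : Prop where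
  map_zero : U 0 = 1
  map_add : ∀ s t, U (s + t) = U s * U t
  continuous : ∀ f, Continuous fun t => U t f

/-- The graph of the generator `A` of `U t = exp (i t A)`. -/
def genGraph (U : ℝ → (H ≃ₗᵢ[ℂ] H)) : Set (H × H) :=
  {p | HasDerivAt (fun t : ℝ => U t p.1) (Complex.I • p.2) 0}

namespace IsOneParamGroup

variable {U U' : ℝ → (H ≃ₗᵢ[ℂ] H)}

theorem apply_add (hU : IsOneParamGroup U) (s t : ℝ) (f : H) : U (s + t) f = U s (U t f) := by
  rw [hU.map_add]; rfl

theorem apply_zero (hU : IsOneParamGroup U) (f : H) : U 0 f = f := by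
  rw [hU.map_zero]; rfl

theorem hasDerivAt_orbit (hU : IsOneParamGroup U) {p : H × H} (hp : p ∈ genGraph U) (t : ℝ) :
    HasDerivAt (fun t : ℝ => U t p.1) (Complex.I • U t p.2) t := by
  have h0 : HasDerivAt (fun t : ℝ => U t p.1) (Complex.I • p.2) (t - t) := by
    rw [sub_self]; exact hp
  have h1 : HasDerivAt (fun s : ℝ => U (s - t) p.1) (Complex.I • p.2) t := by
    simpa using h0.comp_sub_const t t
  have h2 := ((U t).toContinuousLinearEquiv.toContinuousLinearMap.restrictScalars
    ℝ).hasFDerivAt.comp_hasDerivAt t h1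
  have h3 : (fun s : ℝ => U s p.1) = fun s => U t (U (s - t) p.1) := by
    funext s
    rw [← hU.apply_add, add_sub_cancel]
  rw [h3, ← (U t).map_smul]
  exact h2

theorem orbit_mem (hU : IsOneParamGroup U) {p : H × H} (hp : p ∈ genGraph U) (t : ℝ) :
    (U t p.1, U t p.2) ∈ genGraph U := by
  have h1 := hU.hasDerivAt_orbit hp (0 + t)
  have h2 := h1.comp_add_const 0 t
  simp only [hU.apply_add, hU.apply_zero] at h2
  exact h2

theorem snd_unique {f g g' : H} (h : (f, g) ∈ genGraph U) (h' : (f, g') ∈ genGraph U) :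
    g = g' := by
  have := HasDerivAt.unique (show HasDerivAt _ _ _ from h) h'
  exact smul_right_injective H Complex.I_ne_zero this

theorem sub_mem {p q : H × H} (hp : p ∈ genGraph U) (hq : q ∈ genGraph U) :
    p - q ∈ genGraph U := by
  have := HasDerivAt.sub (show HasDerivAt _ _ _ from hp) (show HasDerivAt _ _ _ from hq)
  simp only [genGraph, Set.mem_ofPred_eq, Prod.fst_sub, Prod.snd_sub, map_sub, smul_sub]
  exact this

theorem hasDerivAt_norm_sq {H : Type*} [NormedAddCommGroup H] [InnerProductSpace ℂ H]
    {c : ℝ → H} {c' : H} {t : ℝ} (h : HasDerivAt c c' t) :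
    HasDerivAt (fun s => ‖c s‖ ^ 2) (2 * (inner ℂ (c t) c').re) t := by
  let _ : InnerProductSpace ℝ H := InnerProductSpace.rclikeToReal ℂ H
  have := h.norm_sq
  simpa [real_inner_eq_re_inner ℂ] using this

/-- The norm is constant along an orbit, so its derivative at time zero vanishes. This is the
symmetry of the generator in the form in which it is used. -/
theorem re_inner_I_eq_zero {p : H × H} (hp : p ∈ genGraph U) :
    (inner ℂ (U 0 p.1) (Complex.I • p.2)).re = 0 := by
  have h1 := hasDerivAt_norm_sq (show HasDerivAt _ _ _ from hp)
  simp only [LinearIsometryEquiv.norm_map] at h1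
  have h2 := h1.unique (hasDerivAt_const (0 : ℝ) (‖p.1‖ ^ 2))
  linarith

/-- Symmetry kills the cross term, so the norm of `(A + i) f` is the graph norm of `f`.
Approximation in the graph thus reduces to approximation in the range of `A + i`. -/
theorem norm_sq_add (hU : IsOneParamGroup U) {p : H × H} (hp : p ∈ genGraph U) :
    ‖p.2 + Complex.I • p.1‖ ^ 2 = ‖p.2‖ ^ 2 + ‖p.1‖ ^ 2 := by
  have h := re_inner_I_eq_zero hp
  rw [hU.apply_zero] at h
  have h2 := norm_add_sq (𝕜 := ℂ) p.2 (Complex.I • p.1)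
  have h3 : RCLike.re (inner ℂ p.2 (Complex.I • p.1)) = 0 := by
    rw [inner_smul_right] at h ⊢
    have h' : (inner ℂ p.1 p.2).im = 0 := by simpa using h
    rw [← inner_conj_symm p.2 p.1]
    change (Complex.I * conj (inner ℂ p.1 p.2)).re = 0
    rw [Complex.I_mul_re, Complex.conj_im, h', neg_zero, neg_zero]
  rw [h2, h3, norm_smul]
  simp

/-- The difference of the two orbits of a vector in the common domain stays in that domain and has
velocity `i A` applied to itself. By symmetry of `A` its norm is constant, and it starts at zero. -/
theorem eq_of_genGraph_eq (hU : IsOneParamGroup U) (hU' : IsOneParamGroup U')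
    (h : genGraph U = genGraph U') (hd : Dense (Prod.fst '' genGraph U)) : U = U' := by
  funext t
  apply LinearIsometryEquiv.ext
  intro f
  have key : ∀ f ∈ Prod.fst '' genGraph U, U t f = U' t f := by
    rintro _ ⟨p, hp, rfl⟩
    have hp' : p ∈ genGraph U' := h ▸ hp
    have hder : ∀ s : ℝ, HasDerivAt (fun s => ‖U s p.1 - U' s p.1‖ ^ 2) 0 s := by
      intro s
      have h1 := (hU.hasDerivAt_orbit hp s).sub (hU'.hasDerivAt_orbit hp' s)
      have h2 := hasDerivAt_norm_sq h1
      have h3 : (U s p.1, U s p.2) - (U' s p.1, U' s p.2) ∈ genGraph U :=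
        sub_mem (hU.orbit_mem hp s) (h ▸ hU'.orbit_mem hp' s)
      have h4 := re_inner_I_eq_zero h3
      rw [hU.apply_zero] at h4
      simp only [Prod.fst_sub, Prod.snd_sub, smul_sub] at h4
      exact h2.congr_deriv (mul_eq_zero_of_right 2 h4)
    have hc := is_const_of_deriv_eq_zero (fun s => (hder s).differentiableAt)
      (fun s => (hder s).deriv) t 0
    simp only [hU.apply_zero, hU'.apply_zero, sub_self, norm_zero] at hc
    have : ‖U t p.1 - U' t p.1‖ = 0 := by
      have := hc.trans (by norm_num : (0 : ℝ) ^ 2 = 0)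
      exact pow_eq_zero_iff (two_ne_zero) |>.1 this
    exact sub_eq_zero.1 (norm_eq_zero.1 this)
  exact congrFun (Continuous.ext_on hd (U t).continuous (U' t).continuous key) f

/-- The maps `U t` are isometries, so convergence of the second components makes the derivatives of
the orbits converge uniformly in time, and the derivative passes to the limit. -/
theorem isClosed_genGraph (hU : IsOneParamGroup U) : IsClosed (genGraph U) := by
  refine isClosed_of_closure_subset fun p hp => ?_
  obtain ⟨q, hq, hlim⟩ := mem_closure_iff_seq_limit.1 hp
  have h1 : Tendsto (fun n => (q n).1) atTop (𝓝 p.1) := (continuous_fst.tendsto p).comp hlim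
  have h2 : Tendsto (fun n => (q n).2) atTop (𝓝 p.2) := (continuous_snd.tendsto p).comp hlim
  have key : TendstoUniformly (fun (n : ℕ) (t : ℝ) => Complex.I • U t (q n).2)
      (fun t => Complex.I • U t p.2) atTop := by
    rw [Metric.tendstoUniformly_iff]
    intro ε hε
    filter_upwards [Metric.tendsto_nhds.1 h2 ε hε] with n hn t
    rw [dist_eq_norm, ← smul_sub, ← map_sub, norm_smul, LinearIsometryEquiv.norm_map]
    rw [dist_comm, dist_eq_norm] at hn
    simpa using hn
  have := hasDerivAt_of_tendstoUniformly (𝕜 := ℝ) key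
    (Eventually.of_forall fun n t => hU.hasDerivAt_orbit (hq n) t)
    (fun t => ((U t).continuous.tendsto p.1).comp h1) 0
  simpa [hU.apply_zero, genGraph] using this

/-- A dense set of vectors invariant under the group is a core of its generator. -/
theorem genGraph_subset_closure [CompleteSpace H] (hU : IsOneParamGroup U)
    (G : Submodule ℂ (H × H)) (hG : (G : Set (H × H)) ⊆ genGraph U)
    (hinv : ∀ p ∈ G, ∀ t, ∃ g, (U t p.1, g) ∈ G)
    (hd : Dense (Prod.fst '' (G : Set (H × H)))) :
    genGraph U ⊆ closure (G : Set (H × H)) := by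
  set L : H × H →ₗ[ℂ] H := LinearMap.snd ℂ H H + Complex.I • LinearMap.fst ℂ H H with hL
  have hLap : ∀ p, L p = p.2 + Complex.I • p.1 := fun p => rfl
  have hRtop : (G.map L).topologicalClosure = ⊤ := by
    rw [Submodule.topologicalClosure_eq_top_iff, Submodule.eq_bot_iff]
    intro h hh
    -- If `h` is orthogonal to the range of `A + i` on `G`, the matrix coefficient `⟨h, U t f⟩`
    -- solves `c' = c`, because `G` is invariant. It grows like `exp t` unless it vanishes, while it
    -- is bounded by `‖h‖ ‖f‖`.
    have hort : ∀ p ∈ G, inner ℂ h p.1 = (0 : ℂ) := by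
      intro p hp
      set c : ℝ → ℂ := fun t => inner ℂ h (U t p.1) with hc
      have hder : ∀ t, HasDerivAt c (c t) t := by
        intro t
        have h1 := hU.hasDerivAt_orbit (hG hp) t
        obtain ⟨g, hg⟩ := hinv p hp t
        have hg' : U t p.2 = g := snd_unique (hU.orbit_mem (hG hp) t) (hG hg)
        have h0 : inner ℂ h (L (U t p.1, g)) = (0 : ℂ) :=
          inner_eq_zero_symm.1 (hh _ (Submodule.mem_map_of_mem hg))
        rw [hLap, inner_add_right, inner_smul_right] at h0
        have h2 := ((innerSL ℂ h).restrictScalars ℝ).hasFDerivAt.comp_hasDerivAt t h1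
        refine h2.congr_deriv ?_
        change inner ℂ h (Complex.I • U t p.2) = inner ℂ h (U t p.1)
        rw [hg', inner_smul_right]
        have h3 : inner ℂ h g = -(Complex.I * inner ℂ h (U t p.1)) := by
          simpa using eq_neg_of_add_eq_zero_left h0
        rw [h3]
        linear_combination (-inner ℂ h (U t p.1)) * Complex.I_sq
      have hder2 : ∀ t : ℝ, HasDerivAt (fun t : ℝ => (Real.exp (-t) : ℂ) * c t) 0 t := by
        intro t
        have h1 : HasDerivAt (fun t : ℝ => (Real.exp (-t) : ℂ)) (-(Real.exp (-t) : ℂ)) t := by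
          have := (HasDerivAt.exp (hasDerivAt_neg t)).ofReal_comp
          simpa using this
        have h2 := h1.mul (hder t)
        rwa [neg_mul, neg_add_cancel] at h2
      have hconst : ∀ t : ℝ, c t = Real.exp t * c 0 := by
        intro t
        have := is_const_of_deriv_eq_zero (fun s => (hder2 s).differentiableAt)
          (fun s => (hder2 s).deriv) t 0
        simp only [neg_zero, Real.exp_zero, Complex.ofReal_one, one_mul] at this
        rw [← this, ← mul_assoc, ← Complex.ofReal_mul, ← Real.exp_add]
        simp
      have hbd : ∀ t : ℝ, Real.exp t * ‖c 0‖ ≤ ‖h‖ * ‖p.1‖ := by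
        intro t
        have h1 : ‖c t‖ ≤ ‖h‖ * ‖p.1‖ := by
          have := norm_inner_le_norm (𝕜 := ℂ) h (U t p.1)
          rwa [LinearIsometryEquiv.norm_map] at this
        rw [hconst t, norm_mul] at h1
        simpa [abs_of_pos (Real.exp_pos t)] using h1
      have hz : ‖c 0‖ = 0 := by
        by_contra hne
        have hpos : 0 < ‖c 0‖ := lt_of_le_of_ne (norm_nonneg _) (Ne.symm hne)
        have h1 := hbd (‖h‖ * ‖p.1‖ / ‖c 0‖)
        have h2 := Real.add_one_le_exp (‖h‖ * ‖p.1‖ / ‖c 0‖)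
        have h3 : (‖h‖ * ‖p.1‖ / ‖c 0‖ + 1) * ‖c 0‖ ≤ ‖h‖ * ‖p.1‖ :=
          (mul_le_mul_of_nonneg_right h2 hpos.le).trans h1
        rw [add_mul, div_mul_cancel₀ _ hne] at h3
        linarith
      have := norm_eq_zero.1 hz
      simpa [hc, hU.apply_zero] using this
    have hzero : ∀ x : H, inner ℂ h x = (0 : ℂ) := by
      have := Continuous.ext_on hd (f := fun x => inner ℂ h x) (g := fun _ => (0 : ℂ))
        (by fun_prop) (by fun_prop) (by rintro _ ⟨p, hp, rfl⟩; exact hort p hp)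
      exact fun x => congrFun this x
    exact inner_self_eq_zero.1 (hzero h)
  intro p hp
  rw [Metric.mem_closure_iff]
  intro ε hε
  -- Density of the range yields `q` in `G` with `(A + i)(p - q)` small, and `norm_sq_add` turns
  -- this into smallness in the graph norm.
  have hmem : L p ∈ closure ((G.map L : Submodule ℂ H) : Set H) := by
    rw [← Submodule.topologicalClosure_coe, hRtop]; trivial
  obtain ⟨_, ⟨q, hq, rfl⟩, hlt⟩ := Metric.mem_closure_iff.1 hmem ε hε
  refine ⟨q, hq, ?_⟩
  have hpq : p - q ∈ genGraph U := sub_mem hp (hG hq)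
  have h1 := hU.norm_sq_add hpq
  have h2 : (p - q).2 + Complex.I • (p - q).1 = L p - L q := by
    rw [← map_sub, hLap]
  rw [h2, ← dist_eq_norm] at h1
  have h3 : ‖(p - q).2‖ ≤ dist (L p) (L q) :=
    le_of_sq_le_sq (by rw [h1]; linarith [sq_nonneg ‖(p - q).1‖]) dist_nonneg
  have h4 : ‖(p - q).1‖ ≤ dist (L p) (L q) :=
    le_of_sq_le_sq (by rw [h1]; linarith [sq_nonneg ‖(p - q).2‖]) dist_nonneg
  rw [dist_eq_norm, Prod.norm_def]
  exact (max_le h4 h3).trans_lt hlt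

end IsOneParamGroup

end UnitaryGroup

/-! ### Coordinatewise flows and the unitary transport of half-densities. -/

section Flow

open Filter Topology

/-- A smooth flow on the line with velocity `s ↦ -v (2πs) / (2π)`, with its Jacobian. -/
structure LineFlow (v : ℝ → ℝ) where
  toFun : ℝ → ℝ → ℝ
  jac : ℝ → ℝ → ℝ
  contDiff : ContDiff ℝ ∞ (fun p : ℝ × ℝ => toFun p.1 p.2)
  contDiff_jac : ContDiff ℝ ∞ (fun p : ℝ × ℝ => jac p.1 p.2)
  map_zero : ∀ s, toFun 0 s = s
  map_add : ∀ t t' s, toFun (t + t') s = toFun t (toFun t' s)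
  hasDerivAt : ∀ t s, HasDerivAt (toFun t) (jac t s) s
  jac_pos : ∀ t s, 0 < jac t s
  hasDerivAt_time : ∀ s, HasDerivAt (fun t => toFun t s)
    (-(v ((2 * Real.pi) * s) / (2 * Real.pi))) 0
  hasDerivAt_jac : ∀ s, HasDerivAt (fun t => jac t s) (-(deriv v ((2 * Real.pi) * s))) 0
  -- Applied to the inverse flow as well, this makes `|s|` and its image comparable. It keeps
  -- compact supports in a fixed ball for bounded times and makes `H¹` invariant.
  abs_le : ∀ t s, |toFun t s| ≤ Real.exp |t| * |s|

namespace LineFlow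

variable {v : ℝ → ℝ} (b : LineFlow v) {ν : ℕ}

theorem jac_zero (s : ℝ) : b.jac 0 s = 1 := by
  have h := b.hasDerivAt 0 s
  have h2 : b.toFun 0 = id := funext b.map_zero
  rw [h2] at h
  exact h.unique (hasDerivAt_id s)

theorem jac_add (t t' s : ℝ) : b.jac (t + t') s = b.jac t (b.toFun t' s) * b.jac t' s := by
  have h1 := b.hasDerivAt (t + t') s
  have h2 := (b.hasDerivAt t (b.toFun t' s)).comp s (b.hasDerivAt t' s)
  have h3 : b.toFun (t + t') = b.toFun t ∘ b.toFun t' := funext (b.map_add t t')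
  rw [h3] at h1
  exact h1.unique h2

theorem apply_neg (t s : ℝ) : b.toFun (-t) (b.toFun t s) = s := by
  rw [← b.map_add, neg_add_cancel, b.map_zero]

theorem abs_ge (t s : ℝ) : |s| ≤ Real.exp |t| * |b.toFun t s| := by
  have := b.abs_le (-t) (b.toFun t s)
  rwa [b.apply_neg, abs_neg] at this

/-- The flow on `X`, acting on each coordinate. -/
def flow (t : ℝ) (x : X ν) : X ν := WithLp.toLp 2 fun j => b.toFun t (x j)

/-- The Jacobian determinant of the flow on `X`. -/
def det (t : ℝ) (x : X ν) : ℝ := ∏ j, b.jac t (x j)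

@[simp] theorem flow_apply (t : ℝ) (x : X ν) (j : Fin ν) : b.flow t x j = b.toFun t (x j) := rfl

theorem flow_zero (x : X ν) : b.flow 0 x = x := by
  ext j; simp [b.map_zero]

theorem flow_add (t t' : ℝ) (x : X ν) : b.flow (t + t') x = b.flow t (b.flow t' x) := by
  ext j; simp [b.map_add]

theorem flow_neg_flow (t : ℝ) (x : X ν) : b.flow (-t) (b.flow t x) = x := by
  rw [← b.flow_add, neg_add_cancel, b.flow_zero]

theorem flow_flow_neg (t : ℝ) (x : X ν) : b.flow t (b.flow (-t) x) = x := by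
  rw [← b.flow_add, add_neg_cancel, b.flow_zero]

theorem det_zero (x : X ν) : b.det 0 x = 1 := by simp [det, b.jac_zero]

theorem det_pos (t : ℝ) (x : X ν) : 0 < b.det t x := Finset.prod_pos fun _ _ => b.jac_pos _ _

theorem det_add (t t' : ℝ) (x : X ν) : b.det (t + t') x = b.det t (b.flow t' x) * b.det t' x := by
  simp [det, b.jac_add, Finset.prod_mul_distrib]

theorem contDiff_flow : ContDiff ℝ ∞ (fun p : ℝ × X ν => b.flow p.1 p.2) := by
  rw [contDiff_euclidean]
  intro j
  exact b.contDiff.comp (contDiff_fst.prodMk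
    ((EuclideanSpace.proj (𝕜 := ℝ) j).contDiff.comp contDiff_snd))

theorem contDiff_det : ContDiff ℝ ∞ (fun p : ℝ × X ν => b.det p.1 p.2) := by
  refine contDiff_prod fun j _ => ?_
  exact b.contDiff_jac.comp (contDiff_fst.prodMk
    ((EuclideanSpace.proj (𝕜 := ℝ) j).contDiff.comp contDiff_snd))

theorem contDiff_flow_right (t : ℝ) : ContDiff ℝ ∞ (b.flow t : X ν → X ν) :=
  b.contDiff_flow.comp (contDiff_const.prodMk contDiff_id)

theorem contDiff_det_right (t : ℝ) : ContDiff ℝ ∞ (b.det t : X ν → ℝ) :=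
  b.contDiff_det.comp (contDiff_const.prodMk contDiff_id)

theorem norm_flow_le (t : ℝ) (x : X ν) : ‖b.flow t x‖ ≤ Real.exp |t| * ‖x‖ := by
  rw [EuclideanSpace.norm_eq, EuclideanSpace.norm_eq]
  rw [← Real.sqrt_sq (Real.exp_pos |t|).le, ← Real.sqrt_mul (sq_nonneg _), Finset.mul_sum]
  refine Real.sqrt_le_sqrt (Finset.sum_le_sum fun j _ => ?_)
  rw [← mul_pow]
  exact pow_le_pow_left₀ (norm_nonneg _) (b.abs_le t (x j)) 2

theorem norm_le_flow (t : ℝ) (x : X ν) : ‖x‖ ≤ Real.exp |t| * ‖b.flow t x‖ := by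
  have := b.norm_flow_le (-t) (b.flow t x)
  rwa [b.flow_neg_flow, abs_neg] at this

/-- The derivative of the flow on `X`. -/
def flowDeriv (t : ℝ) (x : X ν) : X ν →L[ℝ] X ν :=
  ((EuclideanSpace.equiv (Fin ν) ℝ).symm : (Fin ν → ℝ) →L[ℝ] X ν) ∘L
    (ContinuousLinearMap.pi fun j => b.jac t (x j) • ContinuousLinearMap.proj (R := ℝ) j) ∘L
    ((EuclideanSpace.equiv (Fin ν) ℝ) : X ν →L[ℝ] (Fin ν → ℝ))

theorem hasFDerivAt_flow (t : ℝ) (x : X ν) : HasFDerivAt (b.flow t) (b.flowDeriv t x) x := by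
  rw [← hasFDerivWithinAt_univ, hasFDerivWithinAt_euclidean]
  intro j
  have h1 := (b.hasDerivAt t (x j)).hasFDerivAt.comp x
    (EuclideanSpace.proj (𝕜 := ℝ) j : X ν →L[ℝ] ℝ).hasFDerivAt
  refine (h1.congr_fderiv ?_).hasFDerivWithinAt
  ext y
  simp [flowDeriv, mul_comm]

theorem det_flowDeriv (t : ℝ) (x : X ν) : (b.flowDeriv t x).det = b.det t x := by
  have h := LinearMap.det_conj (LinearMap.pi fun j => (b.jac t (x j) •
    (LinearMap.id : ℝ →ₗ[ℝ] ℝ)) ∘ₗ LinearMap.proj (R := ℝ) j)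
    (EuclideanSpace.equiv (Fin ν) ℝ).symm.toLinearEquiv
  rw [LinearMap.det_pi] at h
  simp only [LinearMap.det_smul, Module.finrank_self, pow_one, LinearMap.det_id, mul_one] at h
  rw [det, ← h]
  rfl

theorem lintegral_flow (t : ℝ) (f : X ν → ENNReal) :
    ∫⁻ x, ENNReal.ofReal (b.det t x) * f (b.flow t x) = ∫⁻ x, f x := by
  have h := lintegral_image_eq_lintegral_abs_det_fderiv_mul (volume : Measure (X ν))
    MeasurableSet.univ (fun x _ => (b.hasFDerivAt_flow t x).hasFDerivWithinAt)
    (fun x _ y _ hxy => by rw [← b.flow_neg_flow t x, hxy, b.flow_neg_flow]) f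
  have h2 : b.flow t '' (Set.univ : Set (X ν)) = Set.univ := by
    rw [Set.image_univ, Set.range_eq_univ]
    exact fun y => ⟨_, b.flow_flow_neg t y⟩
  rw [h2, setLIntegral_univ, setLIntegral_univ] at h
  rw [h]
  simp only [det_flowDeriv, abs_of_pos (b.det_pos _ _)]

theorem continuous_flow (t : ℝ) : Continuous (b.flow t : X ν → X ν) :=
  (b.contDiff_flow_right t).continuous

theorem continuous_det (t : ℝ) : Continuous (b.det t : X ν → ℝ) :=
  (b.contDiff_det_right t).continuous

theorem quasiMeasurePreserving_flow (t : ℝ) :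
    Measure.QuasiMeasurePreserving (b.flow t : X ν → X ν) volume volume := by
  refine ⟨(b.continuous_flow t).measurable, ?_⟩
  refine Measure.AbsolutelyContinuous.mk fun s hs h0 => ?_
  rw [Measure.map_apply (b.continuous_flow t).measurable hs]
  have : b.flow t ⁻¹' s = b.flow (-t) '' s := by
    ext x
    constructor
    · exact fun hx => ⟨_, hx, b.flow_neg_flow t x⟩
    · rintro ⟨y, hy, rfl⟩
      rw [Set.mem_preimage, b.flow_flow_neg]
      exact hy
  rw [this]
  exact addHaar_image_eq_zero_of_differentiableOn_of_addHaar_eq_zero volume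
    (fun x _ => ((b.hasFDerivAt_flow (-t) x).differentiableAt).differentiableWithinAt) h0

/-- The transport of a function by the flow, with the half-density factor. -/
def transport (t : ℝ) (g : X ν → ℂ) (x : X ν) : ℂ := (Real.sqrt (b.det t x) : ℂ) * g (b.flow t x)

theorem eLpNorm_transport (t : ℝ) (g : X ν → ℂ) :
    eLpNorm (b.transport t g) 2 volume = eLpNorm g 2 volume := by
  rw [eLpNorm_eq_lintegral_rpow_enorm_toReal two_ne_zero ENNReal.ofNat_ne_top,
    eLpNorm_eq_lintegral_rpow_enorm_toReal two_ne_zero ENNReal.ofNat_ne_top]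
  congr 1
  rw [← b.lintegral_flow t (fun x => ‖g x‖ₑ ^ ENNReal.toReal 2)]
  refine lintegral_congr fun x => ?_
  rw [transport, enorm_mul, ENNReal.mul_rpow_of_nonneg _ _ (by simp)]
  congr 1
  rw [← ofReal_norm, Complex.norm_real, Real.norm_of_nonneg (Real.sqrt_nonneg _)]
  simp only [ENNReal.toReal_ofNat, ENNReal.rpow_ofNat]
  rw [← ENNReal.ofReal_pow (Real.sqrt_nonneg _), Real.sq_sqrt (b.det_pos t x).le]

theorem memLp_transport (t : ℝ) (g : L2 ν) : MemLp (b.transport t g) 2 volume := by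
  refine ⟨?_, ?_⟩
  · refine AEStronglyMeasurable.mul ?_
      ((Lp.aestronglyMeasurable g).comp_quasiMeasurePreserving (b.quasiMeasurePreserving_flow t))
    exact (Complex.continuous_ofReal.comp
      (Real.continuous_sqrt.comp (b.continuous_det t))).aestronglyMeasurable
  · rw [b.eLpNorm_transport]
    exact (Lp.memLp g).2

/-- The transport of an element of `L²`. -/
def transportL2 (t : ℝ) (g : L2 ν) : L2 ν := (b.memLp_transport t g).toLp _

theorem coeFn_transportL2 (t : ℝ) (g : L2 ν) :
    b.transportL2 t g =ᵐ[volume] b.transport t g := MemLp.coeFn_toLp _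

theorem transport_congr (t : ℝ) {f g : X ν → ℂ} (h : f =ᵐ[volume] g) :
    b.transport t f =ᵐ[volume] b.transport t g := by
  filter_upwards [(b.quasiMeasurePreserving_flow t).ae h] with x hx
  rw [transport, transport, hx]

theorem transport_transport (t t' : ℝ) (g : X ν → ℂ) :
    b.transport t (b.transport t' g) = b.transport (t' + t) g := by
  funext x
  rw [transport, transport, transport, b.flow_add, b.det_add, Real.sqrt_mul (b.det_pos _ _).le]
  push_cast
  ring

theorem transport_zero (g : X ν → ℂ) : b.transport 0 g = g := by
  funext x
  simp [transport, b.det_zero, b.flow_zero]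

theorem transportL2_transportL2 (t t' : ℝ) (g : L2 ν) :
    b.transportL2 t (b.transportL2 t' g) = b.transportL2 (t' + t) g := by
  refine Lp.ext ?_
  filter_upwards [b.coeFn_transportL2 t (b.transportL2 t' g), b.coeFn_transportL2 (t' + t) g,
    b.transport_congr t (b.coeFn_transportL2 t' g)] with x h1 h2 h3
  rw [h1, h2, h3, b.transport_transport]

theorem transportL2_zero (g : L2 ν) : b.transportL2 0 g = g := by
  refine Lp.ext ?_
  filter_upwards [b.coeFn_transportL2 0 g] with x h1
  rw [h1, b.transport_zero]

/-- The unitary group of transports. -/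
def transportEquiv (t : ℝ) : L2 ν ≃ₗᵢ[ℂ] L2 ν where
  toFun := b.transportL2 t
  invFun := b.transportL2 (-t)
  map_add' f g := by
    refine Lp.ext ?_
    filter_upwards [b.coeFn_transportL2 t (f + g), b.coeFn_transportL2 t f,
      b.coeFn_transportL2 t g, b.transport_congr t (Lp.coeFn_add f g),
      Lp.coeFn_add (b.transportL2 t f) (b.transportL2 t g)] with x h1 h2 h3 h4 h5
    rw [h1, h4, h5, Pi.add_apply, h2, h3]
    simp [transport, mul_add]
  map_smul' c f := by
    refine Lp.ext ?_
    filter_upwards [b.coeFn_transportL2 t (c • f), b.coeFn_transportL2 t f,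
      b.transport_congr t (Lp.coeFn_smul c f),
      Lp.coeFn_smul c (b.transportL2 t f)] with x h1 h2 h4 h5
    rw [h1, h4, RingHom.id_apply, h5, Pi.smul_apply, h2]
    simp [transport, mul_left_comm]
  left_inv g := by rw [b.transportL2_transportL2, add_neg_cancel, b.transportL2_zero]
  right_inv g := by rw [b.transportL2_transportL2, neg_add_cancel, b.transportL2_zero]
  norm_map' g := by
    change ‖b.transportL2 t g‖ = ‖g‖
    rw [transportL2, Lp.norm_toLp, b.eLpNorm_transport, Lp.norm_def]

theorem transportEquiv_apply (t : ℝ) (g : L2 ν) : b.transportEquiv t g = b.transportL2 t g := rfl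

theorem norm_le_of_bound {h : L2 ν} {K : Set (X ν)} (hK : MeasurableSet K)
    (hKv : volume K ≠ ⊤) {M : ℝ} (hM : 0 ≤ M)
    (hb : ∀ᵐ x, ‖h x‖ ≤ K.indicator (fun _ => M) x) :
    ‖h‖ ≤ M * ((volume K) ^ (1 / 2 : ℝ)).toReal := by
  have h1 : eLpNorm h 2 volume ≤ eLpNorm (K.indicator fun _ => M) 2 volume :=
    eLpNorm_mono_ae_real hb
  rw [eLpNorm_indicator_const hK two_ne_zero ENNReal.ofNat_ne_top] at h1
  rw [Lp.norm_def]
  have h2 : ‖M‖ₑ * volume K ^ (1 / ENNReal.toReal 2) ≠ ⊤ := by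
    refine ENNReal.mul_ne_top (by simp) (ENNReal.rpow_ne_top_of_nonneg (by simp) hKv)
  refine (ENNReal.toReal_mono h2 h1).trans_eq ?_
  rw [ENNReal.toReal_mul, toReal_enorm, Real.norm_of_nonneg hM, ENNReal.toReal_ofNat]

/-- A curve of smooth functions with supports in a fixed ball is differentiable in `L²`. -/
theorem hasDerivAt_L2_of_contDiff {F : ℝ × X ν → ℂ} (hF : ContDiff ℝ ∞ F) {R : ℝ}
    (hR : ∀ t x, |t| ≤ 1 → R < ‖x‖ → F (t, x) = 0) {γ : ℝ → L2 ν}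
    (hγ : ∀ t, γ t =ᵐ[volume] fun x => F (t, x)) {D : L2 ν} {F' : X ν → ℂ}
    (hF' : ∀ x, HasDerivAt (fun t => F (t, x)) (F' x) 0) (hD : D =ᵐ[volume] F') :
    HasDerivAt γ D 0 := by
  set G : ℝ × X ν → ℂ := fun p => fderiv ℝ F p (1, 0) with hG
  have hGc : Continuous G := (hF.continuous_fderiv (by simp)).clm_apply continuous_const
  have hFG : ∀ t x, HasDerivAt (fun t => F (t, x)) (G (t, x)) t := fun t x => by
    have h1 := (hF.differentiable (by simp) (t, x)).hasFDerivAt.comp_hasDerivAt t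
      ((hasDerivAt_id t).prodMk (hasDerivAt_const t x))
    exact h1
  have hF'G : ∀ x, F' x = G (0, x) := fun x => (hF' x).unique (hFG 0 x)
  set K := Metric.closedBall (0 : X ν) R with hKdef
  have hKv : volume K ≠ ⊤ := (isCompact_closedBall _ _).measure_lt_top.ne
  set C := ((volume K) ^ (1 / 2 : ℝ)).toReal with hC
  have hC0 : 0 ≤ C := ENNReal.toReal_nonneg
  rw [hasDerivAt_iff_isLittleO_nhds_zero, Asymptotics.isLittleO_iff]
  intro ε hε
  have hcomp : IsCompact (Set.Icc (-1 : ℝ) 1 ×ˢ K) :=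
    isCompact_Icc.prod (isCompact_closedBall _ _)
  have huc := hcomp.uniformContinuousOn_of_continuous hGc.continuousOn
  rw [Metric.uniformContinuousOn_iff] at huc
  -- `C` is the square root of the volume of the ball, the price for passing from a uniform bound to
  -- an `L²` bound. The `+ 1` avoids dividing by zero.
  obtain ⟨δ, hδ, hδ'⟩ := huc (ε / (C + 1)) (by positivity)
  filter_upwards [Metric.ball_mem_nhds (0 : ℝ) (lt_min hδ one_pos)] with t ht
  rw [Metric.mem_ball, dist_zero_right, Real.norm_eq_abs, lt_min_iff] at ht
  have hpt : ∀ x ∈ K, ‖F (t, x) - F (0, x) - (t : ℂ) * G (0, x)‖ ≤ ε / (C + 1) * |t| := by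
    intro x hx
    have h1 : ∀ s ∈ Set.uIcc 0 t, HasDerivWithinAt
        (fun s : ℝ => F (s, x) - (s : ℂ) * G (0, x)) (G (s, x) - G (0, x)) (Set.uIcc 0 t) s := by
      intro s _
      have h2 : HasDerivAt (fun s : ℝ => (s : ℂ) * G (0, x)) (1 * G (0, x)) s :=
        (Complex.ofRealCLM.hasDerivAt (x := s)).mul_const _
      rw [one_mul] at h2
      exact ((hFG s x).sub h2).hasDerivWithinAt
    have h2 : ∀ s ∈ Set.uIcc 0 t, ‖G (s, x) - G (0, x)‖ ≤ ε / (C + 1) := by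
      intro s hs
      have hs' : |s| ≤ |t| := by
        have := Set.abs_sub_left_of_mem_uIcc hs
        simpa using this
      rw [← dist_eq_norm]
      refine (hδ' (s, x) ⟨_root_.abs_le.1 (hs'.trans ht.2.le), hx⟩ (0, x) ⟨by simp, hx⟩ ?_).le
      rw [Prod.dist_eq, dist_self, Real.dist_eq, sub_zero]
      exact max_lt (hs'.trans_lt ht.1) hδ
    have h3 := (convex_uIcc 0 t).norm_image_sub_le_of_norm_hasDerivWithin_le h1 h2
      Set.left_mem_uIcc Set.right_mem_uIcc
    rw [sub_zero, Real.norm_eq_abs] at h3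
    refine (congrArg norm ?_).trans_le h3
    rw [Complex.ofReal_zero]
    ring
  have hpt0 : ∀ x ∉ K, F (t, x) - F (0, x) - (t : ℂ) * G (0, x) = 0 := by
    intro x hx
    have hx' : R < ‖x‖ := by simpa [hKdef] using hx
    have hG0 : G (0, x) = 0 := by
      refine (hFG 0 x).unique ?_
      refine (hasDerivAt_const (0 : ℝ) (0 : ℂ)).congr_of_eventuallyEq ?_
      filter_upwards [Metric.ball_mem_nhds (0 : ℝ) one_pos] with s hs
      rw [Metric.mem_ball, dist_zero_right, Real.norm_eq_abs] at hs
      exact hR s x hs.le hx'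
    rw [hR t x ht.2.le hx', hR 0 x (by simp) hx', hG0]
    simp
  have hnorm : ‖γ (0 + t) - γ 0 - t • D‖ ≤ (ε / (C + 1) * |t|) * C := by
    refine norm_le_of_bound measurableSet_closedBall hKv (by positivity) ?_
    filter_upwards [Lp.coeFn_sub (γ (0 + t) - γ 0) (t • D), Lp.coeFn_sub (γ (0 + t)) (γ 0),
      Lp.coeFn_smul t D, hγ (0 + t), hγ 0, hD] with x h1 h2 h3 h4 h5 h6
    rw [h1, Pi.sub_apply, h2, Pi.sub_apply, h3, Pi.smul_apply, h4, h5, h6, hF'G, zero_add,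
      Complex.real_smul]
    by_cases hx : x ∈ K
    · rw [Set.indicator_of_mem hx]; exact hpt x hx
    · rw [Set.indicator_of_notMem hx, hpt0 x hx, norm_zero]
  refine hnorm.trans ?_
  rw [Real.norm_eq_abs]
  have : ε / (C + 1) * C ≤ ε := by
    rw [div_mul_eq_mul_div, div_le_iff₀ (by positivity)]
    nlinarith
  nlinarith [abs_nonneg t]

end LineFlow

end Flow

/-! ### Density of compactly supported functions in the Schwartz space. -/

section Cutoff

open Filter Topology

variable {E : Type*} [NormedAddCommGroup E] [NormedSpace ℝ E] [HasContDiffBump E]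
  [FiniteDimensional ℝ E]

/-- A smooth cutoff function, equal to `1` on the unit ball and supported in the ball of
radius `2`. -/
def unitBump (E : Type*) [NormedAddCommGroup E] [NormedSpace ℝ E] [HasContDiffBump E] :
    ContDiffBump (0 : E) := ⟨1, 2, one_pos, one_lt_two⟩

/-- The Schwartz function `x ↦ θ (a x) φ x`. -/
def cutoff (a : ℝ) (ha : a ≠ 0) (φ : 𝓢(E, ℂ)) : 𝓢(E, ℂ) :=
  HasCompactSupport.toSchwartzMap (f := fun x => unitBump E (a • x) • φ x)
    (((unitBump E).hasCompactSupport.comp_smul ha).smul_right)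
    (((unitBump E).contDiff.comp (contDiff_const_smul a)).smul (φ.smooth ⊤))

theorem cutoff_apply (a : ℝ) (ha : a ≠ 0) (φ : 𝓢(E, ℂ)) (x : E) :
    cutoff a ha φ x = unitBump E (a • x) • φ x := rfl

theorem hasCompactSupport_cutoff (a : ℝ) (ha : a ≠ 0) (φ : 𝓢(E, ℂ)) :
    HasCompactSupport (cutoff a ha φ) :=
  ((unitBump E).hasCompactSupport.comp_smul ha).smul_right

theorem exists_bound_iteratedFDeriv_unitBump_sub_one (i : ℕ) :
    ∃ C : ℝ, ∀ x : E, ‖iteratedFDeriv ℝ i (fun y => unitBump E y - 1) x‖ ≤ C := by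
  have hd : ContDiff ℝ ∞ (fun y => unitBump E y) := (unitBump E).contDiff
  have hc : ∃ C : ℝ, ∀ x : E, ‖iteratedFDeriv ℝ i (fun y => unitBump E y) x‖ ≤ C :=
    ((unitBump E).hasCompactSupport.iteratedFDeriv i).exists_bound_of_continuous
      (hd.continuous_iteratedFDeriv (by exact_mod_cast le_top))
  obtain ⟨C, hC⟩ := hc
  refine ⟨C + 1, fun x => ?_⟩
  have hsub : iteratedFDeriv ℝ i (fun y => unitBump E y - 1) x =
      iteratedFDeriv ℝ i (fun y => unitBump E y) x - iteratedFDeriv ℝ i (fun _ : E => (1 : ℝ)) x :=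
    iteratedFDeriv_sub_apply (hd.of_le (by exact_mod_cast le_top)).contDiffAt
      contDiff_const.contDiffAt
  rw [hsub]
  refine (norm_sub_le _ _).trans (add_le_add (hC x) ?_)
  rcases Nat.eq_zero_or_pos i with rfl | hi
  · simp
  · rw [iteratedFDeriv_const_of_ne hi.ne']; simp

/-- The function `θ(ax) - 1` vanishes where `a|x| < 1`. Elsewhere `1 ≤ a|x|`, so a factor `a` is
gained at the price of one more power of `|x|` in the seminorm; derivatives of the cutoff only bring
further factors `a ≤ 1`. -/
theorem seminorm_cutoff_sub_le (k n : ℕ) (φ : 𝓢(E, ℂ)) :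
    ∃ C : ℝ, 0 ≤ C ∧ ∀ (a : ℝ) (ha : a ≠ 0), 0 < a → a ≤ 1 →
      SchwartzMap.seminorm ℂ k n (cutoff a ha φ - φ) ≤ a * C := by
  choose B hB using fun i => exists_bound_iteratedFDeriv_unitBump_sub_one (E := E) i
  have hB0 : ∀ i, 0 ≤ B i := fun i => (norm_nonneg _).trans (hB i 0)
  refine ⟨∑ i ∈ Finset.range (n + 1), (n.choose i : ℝ) * B i *
    SchwartzMap.seminorm ℂ (k + 1) (n - i) φ, ?_, fun a ha ha0 ha1 => ?_⟩
  · exact Finset.sum_nonneg fun i _ => mul_nonneg (mul_nonneg (Nat.cast_nonneg _) (hB0 i))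
      (apply_nonneg _ _)
  refine SchwartzMap.seminorm_le_bound ℂ k n _ (by
    refine mul_nonneg ha0.le (Finset.sum_nonneg fun i _ => mul_nonneg (mul_nonneg
      (Nat.cast_nonneg _) (hB0 i)) (apply_nonneg _ _))) fun x => ?_
  have hd : ContDiff ℝ ∞ (fun y => unitBump E y - 1) := (unitBump E).contDiff.sub contDiff_const
  have hfun : ((cutoff a ha φ - φ : 𝓢(E, ℂ)) : E → ℂ) =
      fun y => (unitBump E (a • y) - 1) • φ y := by
    funext y
    rw [sub_apply, cutoff_apply, sub_smul, one_smul]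
  by_cases hx : 1 ≤ a * ‖x‖
  · rw [hfun]
    have h1 := norm_iteratedFDeriv_smul_le (𝕜 := ℝ) (N := ∞) (n := n)
      (hd.comp (contDiff_const_smul a)) (φ.smooth ⊤) x (by exact_mod_cast le_top)
    calc ‖x‖ ^ k * ‖iteratedFDeriv ℝ n (fun y => (unitBump E (a • y) - 1) • φ y) x‖
        ≤ ‖x‖ ^ k * ∑ i ∈ Finset.range (n + 1), (n.choose i : ℝ) * B i *
          ‖iteratedFDeriv ℝ (n - i) φ x‖ := by
          refine mul_le_mul_of_nonneg_left (h1.trans (Finset.sum_le_sum fun i _ => ?_))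
            (by positivity)
          refine mul_le_mul_of_nonneg_right (mul_le_mul_of_nonneg_left ?_ (Nat.cast_nonneg _))
            (norm_nonneg _)
          have h2 := congrFun (iteratedFDeriv_comp_const_smul (𝕜 := ℝ) (i := i) a
            (hd.of_le (by exact_mod_cast le_top))) x
          have h3 : iteratedFDeriv ℝ i ((fun y => unitBump E y - 1) ∘ fun x => a • x) x =
            a ^ i • iteratedFDeriv ℝ i (fun y => unitBump E y - 1) (a • x) := h2
          rw [h3, norm_smul, norm_pow, Real.norm_of_nonneg ha0.le]
          exact (mul_le_of_le_one_left (norm_nonneg _) (pow_le_one₀ ha0.le ha1)).trans (hB i _)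
      _ ≤ (a * ‖x‖) * (‖x‖ ^ k * ∑ i ∈ Finset.range (n + 1), (n.choose i : ℝ) * B i *
          ‖iteratedFDeriv ℝ (n - i) φ x‖) := by
          refine le_mul_of_one_le_left (mul_nonneg (by positivity) (Finset.sum_nonneg fun i _ =>
            mul_nonneg (mul_nonneg (Nat.cast_nonneg _) (hB0 i)) (norm_nonneg _))) hx
      _ = a * ∑ i ∈ Finset.range (n + 1), (n.choose i : ℝ) * B i *
          (‖x‖ ^ (k + 1) * ‖iteratedFDeriv ℝ (n - i) φ x‖) := by
          rw [mul_assoc, Finset.mul_sum, Finset.mul_sum]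
          congr 1
          refine Finset.sum_congr rfl fun i _ => ?_
          ring
      _ ≤ _ := by
          refine mul_le_mul_of_nonneg_left (Finset.sum_le_sum fun i _ => ?_) ha0.le
          exact mul_le_mul_of_nonneg_left (SchwartzMap.le_seminorm ℂ (k + 1) (n - i) φ x)
            (mul_nonneg (Nat.cast_nonneg _) (hB0 i))
  · have hev : ((cutoff a ha φ - φ : 𝓢(E, ℂ)) : E → ℂ) =ᶠ[𝓝 x] fun _ => 0 := by
      have hop : IsOpen {y : E | a * ‖y‖ < 1} := isOpen_lt (by fun_prop) continuous_const
      filter_upwards [hop.mem_nhds (not_le.1 hx)] with y hy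
      rw [hfun]
      have : unitBump E (a • y) = 1 := by
        refine (unitBump E).one_of_mem_closedBall ?_
        rw [mem_closedBall_zero_iff, norm_smul, Real.norm_of_nonneg ha0.le]
        exact le_of_lt hy
      simp only [this, sub_self, zero_smul]
    rw [(hev.iteratedFDeriv ℝ n).self_of_nhds]
    have : iteratedFDeriv ℝ n (fun _ : E => (0 : ℂ)) x = 0 := by
      rw [iteratedFDeriv_fun_zero]
      rfl
    rw [this, norm_zero, mul_zero]
    exact mul_nonneg ha0.le (Finset.sum_nonneg fun i _ => mul_nonneg (mul_nonneg
      (Nat.cast_nonneg _) (hB0 i)) (apply_nonneg _ _))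

/-- Every Schwartz function is a limit, in the topology of the Schwartz space, of smooth compactly
supported functions. -/
theorem exists_seq_hasCompactSupport_tendsto (φ : 𝓢(E, ℂ)) :
    ∃ ψ : ℕ → 𝓢(E, ℂ), (∀ n, HasCompactSupport (ψ n)) ∧ Tendsto ψ atTop (𝓝 φ) := by
  have ha : ∀ n : ℕ, (1 / ((n : ℝ) + 1)) ≠ 0 := fun n => by positivity
  refine ⟨fun n => cutoff _ (ha n) φ, fun n => hasCompactSupport_cutoff _ _ _, ?_⟩
  rw [(schwartz_withSeminorms ℂ E ℂ).tendsto_nhds]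
  rintro ⟨k, n⟩ ε hε
  obtain ⟨C, hC0, hC⟩ := seminorm_cutoff_sub_le k n φ
  have h1 : Tendsto (fun m : ℕ => 1 / ((m : ℝ) + 1) * C) atTop (𝓝 0) := by
    simpa using tendsto_one_div_add_atTop_nhds_zero_nat.mul_const C
  filter_upwards [h1.eventually_lt_const hε] with m hm
  refine lt_of_le_of_lt (hC _ (ha m) (by positivity) ?_) hm
  rw [div_le_one (by positivity)]
  linarith [(Nat.cast_nonneg m : (0 : ℝ) ≤ m)]

end Cutoff

/-! ### The group generated by `A_u` as transport in momentum space. -/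

section MomentumGroup

open Filter Topology

variable {ν : ℕ}

theorem continuous_orbit_of_dense {H : Type*} [NormedAddCommGroup H] [InnerProductSpace ℂ H]
    {U : ℝ → (H ≃ₗᵢ[ℂ] H)} (hadd : ∀ (s t : ℝ) (f : H), U (s + t) f = U s (U t f))
    {D : Set H} (hD : Dense D)
    (h : ∀ f ∈ D, ContinuousAt (fun t => U t f) 0) (f : H) : Continuous fun t => U t f := by
  have h0 : ContinuousAt (fun t => U t f) 0 := by
    rw [Metric.continuousAt_iff']
    intro ε hε
    obtain ⟨φ, hφ, hfφ⟩ := Metric.mem_closure_iff.1 (hD f) (ε / 3) (by positivity)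
    filter_upwards [Metric.continuousAt_iff'.1 (h φ hφ) (ε / 3) (by positivity)] with t ht
    have h4 := dist_triangle4 (U t f) (U t φ) (U 0 φ) (U 0 f)
    rw [LinearIsometryEquiv.dist_map, LinearIsometryEquiv.dist_map, dist_comm φ f] at h4
    linarith
  rw [continuous_iff_continuousAt]
  intro t
  have h1 : ContinuousAt (fun s => U (s - t) f) t := by
    have h2 : ContinuousAt (fun t => U t f) (t - t) := by rw [sub_self]; exact h0
    exact ContinuousAt.comp (f := fun s : ℝ => s - t) h2 (by fun_prop)
  have h3 : (fun s => U s f) = fun s => U t (U (s - t) f) := by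
    funext s; rw [← hadd, add_sub_cancel]
  rw [h3]
  exact (U t).continuous.continuousAt.comp h1

theorem hasTemperateGrowth_coord (j : Fin ν) :
    (fun x : X ν => ((x j : ℝ) : ℂ)).HasTemperateGrowth :=
  Function.Complex.hasTemperateGrowth_ofReal.comp
    (EuclideanSpace.proj (𝕜 := ℝ) j : X ν →L[ℝ] ℝ).hasTemperateGrowth

theorem hasTemperateGrowth_comp_coord {v : ℝ → ℝ} (hv : v.HasTemperateGrowth) (j : Fin ν) :
    (fun ξ : X ν => ((v ((2 * Real.pi) * ξ j) : ℝ) : ℂ)).HasTemperateGrowth :=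
  Function.Complex.hasTemperateGrowth_ofReal.comp (hv.comp
    ((2 * Real.pi) • (EuclideanSpace.proj (𝕜 := ℝ) j : X ν →L[ℝ] ℝ)).hasTemperateGrowth)

theorem qOp_apply (j : Fin ν) (φ : 𝓢(X ν, ℂ)) (x : X ν) : qOp j φ x = (x j : ℂ) * φ x := by
  rw [qOp, SchwartzMap.smulLeftCLM_apply_apply (hasTemperateGrowth_coord j)]; rfl

theorem smulLeftCLM_inner_basisVec (j : Fin ν) (φ : 𝓢(X ν, ℂ)) :
    SchwartzMap.smulLeftCLM ℂ (fun x : X ν => inner ℝ x (basisVec j)) φ = qOp j φ := by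
  ext x
  have : (fun x : X ν => inner ℝ x (basisVec j)).HasTemperateGrowth := by fun_prop
  rw [SchwartzMap.smulLeftCLM_apply_apply this, qOp_apply]
  simp [basisVec, EuclideanSpace.inner_single_right]

theorem fourier_qOp (j : Fin ν) (φ : 𝓢(X ν, ℂ)) :
    𝓕 (qOp j φ) = (Complex.I / (2 * Real.pi)) • ∂_{basisVec j} (𝓕 φ) := by
  rw [SchwartzMap.lineDerivOp_fourier_eq]
  rw [smulLeftCLM_inner_basisVec, FourierTransform.fourier_smul, smul_smul]
  have : (Complex.I / (2 * Real.pi)) * -(2 * Real.pi * Complex.I) = 1 := by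
    have : (Real.pi : ℂ) ≠ 0 := by exact_mod_cast Real.pi_ne_zero
    field_simp
    simp
  rw [this, one_smul]

theorem fourier_pFun (m : X ν → ℝ) (φ : 𝓢(X ν, ℂ)) :
    𝓕 (pFun m φ) = SchwartzMap.smulLeftCLM ℂ (fun ξ : X ν => ((m ((2 * Real.pi) • ξ) : ℝ) : ℂ)) (𝓕 φ) := by
  rw [pFun, SchwartzMap.fourierMultiplierCLM_apply, fourier_fourierInv_eq]

/-- The operator `A_u` as a continuous operator on the Schwartz space. -/
def conjOpCLM (u : X ν → X ν) : 𝓢(X ν, ℂ) →L[ℂ] 𝓢(X ν, ℂ) :=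
  (1 / 2 : ℂ) • ∑ j : Fin ν,
    (pFun (fun k => u k j) ∘L qOp j + qOp j ∘L pFun (fun k => u k j))

theorem conjOpCLM_apply (u : X ν → X ν) (φ : 𝓢(X ν, ℂ)) : conjOpCLM u φ = conjOp u φ := by
  simp [conjOpCLM, conjOp]

theorem lineDerivOp_mul_comp_coord {v : ℝ → ℝ} (hv : v.HasTemperateGrowth) (j : Fin ν)
    (g : 𝓢(X ν, ℂ)) (ξ : X ν) :
    ∂_{basisVec j} (SchwartzMap.smulLeftCLM ℂ (fun ξ : X ν => ((v ((2 * Real.pi) * ξ j) : ℝ) : ℂ)) g) ξ =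
      (v ((2 * Real.pi) * ξ j) : ℂ) * ∂_{basisVec j} g ξ +
        ((2 * Real.pi * deriv v ((2 * Real.pi) * ξ j) : ℝ) : ℂ) * g ξ := by
  have hvd : Differentiable ℝ v := hv.1.differentiable (by simp)
  have h1 : HasDerivAt (fun t : ℝ => (v ((2 * Real.pi) * ((ξ + t • basisVec j) j)) : ℂ))
      ((2 * Real.pi * deriv v ((2 * Real.pi) * ξ j) : ℝ) : ℂ) 0 := by
    have h2 : HasDerivAt (fun t : ℝ => (2 * Real.pi) * ((ξ + t • basisVec j) j)) (2 * Real.pi) 0 := by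
      have : (fun t : ℝ => (2 * Real.pi) * ((ξ + t • basisVec j) j)) =
          fun t => (2 * Real.pi) * (ξ j + t) := by
        funext t; simp [basisVec]
      rw [this]
      simpa using ((hasDerivAt_id (0 : ℝ)).const_add (ξ j)).const_mul (2 * Real.pi)
    have h3 : HasDerivAt v (deriv v ((2 * Real.pi) * ξ j))
        ((2 * Real.pi) * ((ξ + (0 : ℝ) • basisVec j) j)) := by
      rw [zero_smul, add_zero]
      exact (hvd _).hasDerivAt
    have h4 := (h3.comp 0 h2).ofReal_comp
    rw [mul_comm (deriv v _)] at h4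
    exact h4
  have h2 : HasLineDerivAt ℝ g (∂_{basisVec j} g ξ) ξ (basisVec j) := by
    rw [SchwartzMap.lineDerivOp_apply]
    exact (g.differentiableAt.lineDifferentiableAt).hasLineDerivAt
  have h3 := h1.mul h2
  rw [SchwartzMap.lineDerivOp_apply]
  have h4 : HasLineDerivAt ℝ (SchwartzMap.smulLeftCLM ℂ
      (fun ξ : X ν => ((v ((2 * Real.pi) * ξ j) : ℝ) : ℂ)) g)
      ((v ((2 * Real.pi) * ξ j) : ℂ) * ∂_{basisVec j} g ξ +
        ((2 * Real.pi * deriv v ((2 * Real.pi) * ξ j) : ℝ) : ℂ) * g ξ) ξ (basisVec j) := by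
    have h5 : (SchwartzMap.smulLeftCLM ℂ (fun ξ : X ν => ((v ((2 * Real.pi) * ξ j) : ℝ) : ℂ)) g : X ν → ℂ) =
        fun ξ => (v ((2 * Real.pi) * ξ j) : ℂ) * g ξ := by
      funext ξ
      rw [SchwartzMap.smulLeftCLM_apply_apply (hasTemperateGrowth_comp_coord hv j)]; rfl
    rw [h5]
    refine HasDerivAt.congr_deriv h3 ?_
    simp only [zero_smul, add_zero]
    ring
  exact h4.lineDeriv

/-- The position `q_j` becomes `(i/2π) ∂_j` in momentum space, and moving `∂_j` past `v` leaves a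
derivative of `v`. Symmetrisation keeps half of it, which is the derivative of the square root of
the Jacobian found in `hasDerivAt_transport`. -/
theorem fourier_conjOp_apply {v : ℝ → ℝ} (hv : v.HasTemperateGrowth)
    {u : X ν → X ν} (hu : ∀ k j, u k j = v (k j)) (φ : 𝓢(X ν, ℂ)) (ξ : X ν) :
    Complex.I * 𝓕 (conjOp u φ) ξ = ∑ j : Fin ν,
      (((-(v ((2 * Real.pi) * ξ j) / (2 * Real.pi)) : ℝ) : ℂ) * ∂_{basisVec j} (𝓕 φ) ξ -
        ((deriv v ((2 * Real.pi) * ξ j) / 2 : ℝ) : ℂ) * 𝓕 φ ξ) := by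
  have hm : ∀ j : Fin ν, (fun ξ : X ν => ((u ((2 * Real.pi) • ξ) j : ℝ) : ℂ)) =
      fun ξ => ((v ((2 * Real.pi) * ξ j) : ℝ) : ℂ) := fun j => by
    funext ξ; rw [hu]; rfl
  have hF : 𝓕 (conjOp u φ) = (1 / 2 : ℂ) • ∑ j : Fin ν,
      (𝓕 (pFun (fun k => u k j) (qOp j φ)) + 𝓕 (qOp j (pFun (fun k => u k j) φ))) := by
    rw [conjOp, FourierTransform.fourier_smul, ← FourierTransform.fourierCLM_apply (R := ℂ),
      map_sum]
    simp only [map_add, FourierTransform.fourierCLM_apply]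
  rw [hF, smul_apply, sum_apply, smul_eq_mul, Finset.mul_sum, Finset.mul_sum]
  refine Finset.sum_congr rfl fun j _ => ?_
  rw [add_apply, fourier_pFun, fourier_qOp, fourier_qOp, fourier_pFun]
  simp only [hm]
  rw [smul_apply, lineDerivOp_mul_comp_coord hv, map_smul, smul_apply,
    SchwartzMap.smulLeftCLM_apply_apply (hasTemperateGrowth_comp_coord hv j)]
  have hpi : (Real.pi : ℂ) ≠ 0 := by exact_mod_cast Real.pi_ne_zero
  push_cast
  simp only [smul_eq_mul]
  field_simp
  linear_combination ((2 * (v ((2 * Real.pi) * ξ j) : ℂ) * ∂_{basisVec j} (𝓕 φ) ξ +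
    2 * Real.pi * ((deriv v ((2 * Real.pi) * ξ j) : ℝ) : ℂ) * 𝓕 φ ξ)) * Complex.I_sq

/-- The Schwartz functions with compactly supported Fourier transform. -/
def momentumCore (ν : ℕ) : Submodule ℂ 𝓢(X ν, ℂ) where
  carrier := {φ | HasCompactSupport (𝓕 φ : 𝓢(X ν, ℂ))}
  add_mem' {φ ψ} hφ hψ := by
    change HasCompactSupport (𝓕 (φ + ψ) : 𝓢(X ν, ℂ))
    rw [FourierTransform.fourier_add]
    exact HasCompactSupport.add hφ hψ
  zero_mem' := by
    change HasCompactSupport (𝓕 (0 : 𝓢(X ν, ℂ)) : 𝓢(X ν, ℂ))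
    rw [FourierTransform.fourier_zero]
    exact HasCompactSupport.zero
  smul_mem' c φ hφ := by
    change HasCompactSupport (𝓕 (c • φ) : 𝓢(X ν, ℂ))
    rw [FourierTransform.fourier_smul]
    exact HasCompactSupport.smul_left (f := fun _ => c) hφ

theorem mem_momentumCore {φ : 𝓢(X ν, ℂ)} : φ ∈ momentumCore ν ↔ HasCompactSupport (𝓕 φ : 𝓢(X ν, ℂ)) := Iff.rfl

theorem exists_seq_momentumCore_tendsto (φ : 𝓢(X ν, ℂ)) :
    ∃ ψ : ℕ → 𝓢(X ν, ℂ), (∀ n, ψ n ∈ momentumCore ν) ∧ Tendsto ψ atTop (𝓝 φ) := by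
  obtain ⟨ψ, h1, h2⟩ := exists_seq_hasCompactSupport_tendsto (𝓕 φ)
  refine ⟨fun n => 𝓕⁻ (ψ n), fun n => ?_, ?_⟩
  · rw [mem_momentumCore, fourier_fourierInv_eq]; exact h1 n
  · have h3 : Continuous (fun φ : 𝓢(X ν, ℂ) => 𝓕⁻ φ) := ContinuousFourierInv.continuous_fourierInv
    have := (h3.tendsto (𝓕 φ)).comp h2
    rwa [fourierInv_fourier_eq] at this

/-- A differential operator in momentum space does not enlarge supports. This allows `A_u` to be
applied twice within the core. -/
theorem conjOp_mem_momentumCore {v : ℝ → ℝ} (hv : v.HasTemperateGrowth)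
    {u : X ν → X ν} (hu : ∀ k j, u k j = v (k j)) {φ : 𝓢(X ν, ℂ)} (hφ : φ ∈ momentumCore ν) :
    conjOp u φ ∈ momentumCore ν := by
  rw [mem_momentumCore] at hφ ⊢
  refine HasCompactSupport.intro' hφ (isClosed_tsupport _) fun ξ hξ => ?_
  have h := fourier_conjOp_apply hv hu φ ξ
  have h1 : 𝓕 φ ξ = 0 := image_eq_zero_of_notMem_tsupport hξ
  have h2 : ∀ j : Fin ν, ∂_{basisVec j} (𝓕 φ) ξ = 0 := fun j =>
    image_eq_zero_of_notMem_tsupport fun h =>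
      hξ (SchwartzMap.tsupport_lineDerivOp_subset (basisVec j) (𝓕 φ) h)
  simp only [h1, h2, mul_zero, sub_zero, Finset.sum_const_zero, mul_eq_zero, Complex.I_ne_zero,
    false_or] at h
  exact h

theorem dense_toLp_of_seq_dense {s : Set 𝓢(X ν, ℂ)}
    (h : ∀ φ : 𝓢(X ν, ℂ), ∃ ψ : ℕ → 𝓢(X ν, ℂ), (∀ n, ψ n ∈ s) ∧ Tendsto ψ atTop (𝓝 φ)) :
    Dense ((fun φ : 𝓢(X ν, ℂ) => (φ.toLp 2 volume : L2 ν)) '' s) := by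
  intro f
  have h1 : f ∈ closure (Set.range (SchwartzMap.toLpCLM ℝ ℂ 2 (volume : Measure (X ν)))) :=
    SchwartzMap.denseRange_toLpCLM ENNReal.ofNat_ne_top f
  refine closure_minimal ?_ isClosed_closure h1
  rintro _ ⟨φ, rfl⟩
  obtain ⟨ψ, h2, h3⟩ := h φ
  refine mem_closure_of_tendsto (((SchwartzMap.toLpCLM ℝ ℂ 2
    (volume : Measure (X ν))).continuous.tendsto φ).comp h3) (Eventually.of_forall fun n => ?_)
  exact ⟨ψ n, h2 n, rfl⟩

theorem dense_toLp_momentumCore :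
    Dense ((fun φ : 𝓢(X ν, ℂ) => (φ.toLp 2 volume : L2 ν)) '' momentumCore ν) :=
  dense_toLp_of_seq_dense exists_seq_momentumCore_tendsto

namespace LineFlow

variable {v : ℝ → ℝ} (b : LineFlow v)

theorem contDiff_transport_prod {g : X ν → ℂ} (hg : ContDiff ℝ ∞ g) :
    ContDiff ℝ ∞ (fun p : ℝ × X ν => b.transport p.1 g p.2) := by
  refine ContDiff.mul ?_ (hg.comp b.contDiff_flow)
  exact Complex.ofRealCLM.contDiff.comp (b.contDiff_det.sqrt fun p => (b.det_pos _ _).ne')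

theorem contDiff_transport {g : X ν → ℂ} (hg : ContDiff ℝ ∞ g) (t : ℝ) :
    ContDiff ℝ ∞ (b.transport t g) :=
  (b.contDiff_transport_prod hg).comp (contDiff_const.prodMk contDiff_id)

theorem hasCompactSupport_transport {g : X ν → ℂ} (hg : HasCompactSupport g) (t : ℝ) :
    HasCompactSupport (b.transport t g) := by
  have h : HasCompactSupport (g ∘ b.flow t) := by
    refine HasCompactSupport.intro (K := b.flow (-t) '' tsupport g)
      (hg.isCompact.image (b.continuous_flow _)) fun x hx => ?_
    refine image_eq_zero_of_notMem_tsupport (f := g) fun h => hx ⟨_, h, b.flow_neg_flow t x⟩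
  exact h.mul_left

/-- The transport of a smooth compactly supported function. -/
def transportS (t : ℝ) (g : 𝓢(X ν, ℂ)) (hg : HasCompactSupport g) : 𝓢(X ν, ℂ) :=
  (b.hasCompactSupport_transport hg t).toSchwartzMap (b.contDiff_transport (g.smooth ⊤) t)

theorem transportS_apply (t : ℝ) (g : 𝓢(X ν, ℂ)) (hg : HasCompactSupport g) (x : X ν) :
    b.transportS t g hg x = b.transport t g x := rfl

theorem transportEquiv_toLp (t : ℝ) (g : 𝓢(X ν, ℂ)) (hg : HasCompactSupport g) :
    b.transportEquiv t (g.toLp 2) = (b.transportS t g hg).toLp 2 := by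
  refine Lp.ext ?_
  filter_upwards [b.coeFn_transportL2 t (g.toLp 2), b.transport_congr t (g.coeFn_toLp 2),
    (b.transportS t g hg).coeFn_toLp 2] with x h1 h2 h3
  rw [h3, transportS_apply, transportEquiv_apply, h1, h2]

theorem hasDerivAt_transport (g : 𝓢(X ν, ℂ)) (x : X ν) :
    HasDerivAt (fun t => b.transport t g x) (∑ j : Fin ν,
      (((-(v ((2 * Real.pi) * x j) / (2 * Real.pi)) : ℝ) : ℂ) * ∂_{basisVec j} g x -
        ((deriv v ((2 * Real.pi) * x j) / 2 : ℝ) : ℂ) * g x)) 0 := by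
  have h1 : HasDerivAt (fun t => b.det t x) (∑ j, -(deriv v ((2 * Real.pi) * x j))) 0 := by
    have := HasDerivAt.fun_finsetProd (u := Finset.univ) (fun j _ => b.hasDerivAt_jac (x j))
    simpa [b.jac_zero, det] using this
  have h2 : HasDerivAt (fun t => (Real.sqrt (b.det t x) : ℂ))
      (((∑ j, -(deriv v ((2 * Real.pi) * x j))) / 2 : ℝ) : ℂ) 0 := by
    have := (h1.sqrt (b.det_pos 0 x).ne').ofReal_comp
    rwa [b.det_zero, Real.sqrt_one, mul_one] at this
  have h3 : HasDerivAt (fun t => b.flow t x)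
      (∑ j, (-(v ((2 * Real.pi) * x j) / (2 * Real.pi))) • basisVec j) 0 := by
    have h := ((EuclideanSpace.equiv (Fin ν) ℝ).symm : (Fin ν → ℝ) →L[ℝ] X ν).hasFDerivAt.comp_hasDerivAt
      (0 : ℝ) (hasDerivAt_pi.2 fun j => b.hasDerivAt_time (x j))
    refine h.congr_deriv ?_
    ext j
    simp [basisVec, Finset.sum_apply, Pi.single_apply]
  have h4 : HasDerivAt (fun t => g (b.flow t x)) (∑ j : Fin ν,
      ((-(v ((2 * Real.pi) * x j) / (2 * Real.pi)) : ℝ) : ℂ) * ∂_{basisVec j} g x) 0 := by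
    have h5 : HasFDerivAt g (fderiv ℝ g x) (b.flow 0 x) := by
      rw [b.flow_zero]; exact g.hasFDerivAt x
    refine (h5.comp_hasDerivAt 0 h3).congr_deriv ?_
    rw [map_sum]
    refine Finset.sum_congr rfl fun j _ => ?_
    rw [map_smul, SchwartzMap.lineDerivOp_apply_eq_fderiv, Complex.real_smul]
  refine (h2.mul h4).congr_deriv ?_
  rw [b.flow_zero, b.det_zero, Finset.sum_sub_distrib, ← Finset.sum_mul]
  push_cast
  rw [Finset.sum_div, Real.sqrt_one]
  simp only [Finset.sum_neg_distrib, neg_div, Complex.ofReal_one, one_mul]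
  ring

/-- The unitary group `exp (i t A_u)`. -/
def unitary (t : ℝ) : L2 ν ≃ₗᵢ[ℂ] L2 ν :=
  (Lp.fourierTransformₗᵢ (X ν) ℂ).trans
    ((b.transportEquiv t).trans (Lp.fourierTransformₗᵢ (X ν) ℂ).symm)

theorem fourier_unitary (t : ℝ) (f : L2 ν) : 𝓕 (b.unitary t f) = b.transportL2 t (𝓕 f) :=
  (Lp.fourierTransformₗᵢ (X ν) ℂ).apply_symm_apply _

theorem fourier_injective {f g : L2 ν} (h : 𝓕 f = 𝓕 g) : f = g :=
  (Lp.fourierTransformₗᵢ (X ν) ℂ).injective h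

/-- The action of the unitary group on the core. -/
def evolveS (t : ℝ) (φ : 𝓢(X ν, ℂ)) (hφ : φ ∈ momentumCore ν) : 𝓢(X ν, ℂ) :=
  𝓕⁻ (b.transportS t (𝓕 φ) hφ)

theorem fourier_evolveS (t : ℝ) (φ : 𝓢(X ν, ℂ)) (hφ : φ ∈ momentumCore ν) :
    𝓕 (b.evolveS t φ hφ) = b.transportS t (𝓕 φ) hφ := by
  rw [evolveS, fourier_fourierInv_eq]

theorem evolveS_mem (t : ℝ) (φ : 𝓢(X ν, ℂ)) (hφ : φ ∈ momentumCore ν) :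
    b.evolveS t φ hφ ∈ momentumCore ν := by
  rw [mem_momentumCore, fourier_evolveS]
  exact b.hasCompactSupport_transport hφ t

theorem unitary_toLp (t : ℝ) (φ : 𝓢(X ν, ℂ)) (hφ : φ ∈ momentumCore ν) :
    b.unitary t (φ.toLp 2) = (b.evolveS t φ hφ).toLp 2 := by
  apply fourier_injective
  rw [b.fourier_unitary, SchwartzMap.toLp_fourier_eq, SchwartzMap.toLp_fourier_eq,
    b.fourier_evolveS t φ hφ, ← b.transportEquiv_apply, b.transportEquiv_toLp t _ hφ]

theorem hasDerivAt_transportL2 (hv : v.HasTemperateGrowth) {u : X ν → X ν}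
    (hu : ∀ k j, u k j = v (k j)) {φ : 𝓢(X ν, ℂ)} (hφ : φ ∈ momentumCore ν) :
    HasDerivAt (fun t => b.transportL2 t ((𝓕 φ : 𝓢(X ν, ℂ)).toLp 2 : L2 ν))
      (Complex.I • ((𝓕 (conjOp u φ) : 𝓢(X ν, ℂ)).toLp 2 : L2 ν)) 0 := by
  obtain ⟨R, hR⟩ := (show HasCompactSupport (𝓕 φ : 𝓢(X ν, ℂ))
    from hφ).isCompact.isBounded.subset_closedBall 0
  have hsmooth : ContDiff ℝ ∞ (𝓕 φ : 𝓢(X ν, ℂ)) := SchwartzMap.smooth _ ⊤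
  -- For `|t| ≤ 1` the flow changes norms by a factor at most `exp 1`, so all the transported
  -- functions are supported in the ball of radius `exp 1 * R`.
  refine hasDerivAt_L2_of_contDiff (b.contDiff_transport_prod hsmooth)
    (R := Real.exp 1 * R) ?_ ?_ (b.hasDerivAt_transport (𝓕 φ)) ?_
  · intro t x ht hx
    have : b.flow t x ∉ tsupport (𝓕 φ : 𝓢(X ν, ℂ)) := fun h => by
      have h1 := mem_closedBall_zero_iff.1 (hR h)
      have h2 := b.norm_le_flow t x
      have h3 : Real.exp |t| * ‖b.flow t x‖ ≤ Real.exp 1 * R :=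
        mul_le_mul (Real.exp_le_exp.2 ht) h1 (norm_nonneg _) (Real.exp_pos 1).le
      linarith
    change b.transport t (𝓕 φ : 𝓢(X ν, ℂ)) x = 0
    rw [transport, image_eq_zero_of_notMem_tsupport this, mul_zero]
  · intro t
    exact (b.coeFn_transportL2 t _).trans
      (b.transport_congr t ((𝓕 φ : 𝓢(X ν, ℂ)).coeFn_toLp 2 volume))
  · have h2 := (𝓕 (conjOp u φ) : 𝓢(X ν, ℂ)).coeFn_toLp 2 volume
    filter_upwards [Lp.coeFn_smul Complex.I ((𝓕 (conjOp u φ) : 𝓢(X ν, ℂ)).toLp 2 volume : L2 ν),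
      h2] with x h1 h2
    rw [h1, Pi.smul_apply, h2, smul_eq_mul, fourier_conjOp_apply hv hu]

theorem hasDerivAt_unitary (hv : v.HasTemperateGrowth) {u : X ν → X ν}
    (hu : ∀ k j, u k j = v (k j)) {φ : 𝓢(X ν, ℂ)} (hφ : φ ∈ momentumCore ν) :
    HasDerivAt (fun t => b.unitary t (φ.toLp 2 volume : L2 ν))
      (Complex.I • ((conjOp u φ).toLp 2 volume : L2 ν)) 0 := by
  have key := b.hasDerivAt_transportL2 hv hu hφ
  have h2 := ((Lp.fourierTransformₗᵢ (X ν)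
    ℂ).symm.toContinuousLinearEquiv.toContinuousLinearMap.restrictScalars
    ℝ).hasFDerivAt.comp_hasDerivAt 0 key
  have h3 : (fun t => b.unitary t (φ.toLp 2 volume : L2 ν)) = fun t =>
      (Lp.fourierTransformₗᵢ (X ν) ℂ).symm
        (b.transportL2 t ((𝓕 φ : 𝓢(X ν, ℂ)).toLp 2 volume : L2 ν)) := by
    funext t
    apply fourier_injective
    rw [b.fourier_unitary, SchwartzMap.toLp_fourier_eq]
    exact ((Lp.fourierTransformₗᵢ (X ν) ℂ).apply_symm_apply _).symm
  have h4 : Complex.I • ((conjOp u φ).toLp 2 volume : L2 ν) =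
      (Lp.fourierTransformₗᵢ (X ν) ℂ).symm
        (Complex.I • ((𝓕 (conjOp u φ) : 𝓢(X ν, ℂ)).toLp 2 volume : L2 ν)) := by
    rw [map_smul, ← SchwartzMap.toLp_fourier_eq]
    exact congrArg _ ((Lp.fourierTransformₗᵢ (X ν) ℂ).symm_apply_apply _).symm
  rw [h3, h4]
  exact h2

theorem isOneParamGroup_unitary (hv : v.HasTemperateGrowth) :
    IsOneParamGroup (fun t => (b.unitary t : L2 ν ≃ₗᵢ[ℂ] L2 ν)) where
  map_zero := by
    ext1 f
    apply fourier_injective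
    rw [b.fourier_unitary, b.transportL2_zero]; rfl
  map_add s t := by
    ext1 f
    apply fourier_injective
    change _ = 𝓕 (b.unitary s (b.unitary t f))
    rw [b.fourier_unitary, b.fourier_unitary, b.fourier_unitary, b.transportL2_transportL2,
      add_comm]
  continuous f := by
    have hadd : ∀ (s t : ℝ) (f : L2 ν), b.unitary (s + t) f = b.unitary s (b.unitary t f) := by
      intro s t f
      apply fourier_injective
      rw [b.fourier_unitary, b.fourier_unitary, b.fourier_unitary, b.transportL2_transportL2,
        add_comm]
    refine continuous_orbit_of_dense hadd dense_toLp_momentumCore ?_ f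
    rintro _ ⟨φ, hφ, rfl⟩
    exact (b.hasDerivAt_unitary hv (u := fun k => WithLp.toLp 2 fun j => v (k j))
        (fun _ _ => rfl) hφ).continuousAt

end LineFlow

end MomentumGroup

/-! ### Bounds for the hyperbolic functions behind the bounded vector field. -/

section Tanh

theorem hasDerivAt_tanh (x : ℝ) : HasDerivAt Real.tanh (1 - Real.tanh x ^ 2) x := by
  have h := (Real.hasDerivAt_sinh x).div (Real.hasDerivAt_cosh x) (Real.cosh_pos x).ne'
  have h2 : Real.sinh / Real.cosh = Real.tanh := by
    funext y; rw [Real.tanh_eq_sinh_div_cosh]; rfl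
  rw [h2] at h
  refine h.congr_deriv ?_
  rw [Real.tanh_eq_sinh_div_cosh]
  have := (Real.cosh_pos x).ne'
  field_simp

theorem abs_tanh_le_one (x : ℝ) : |Real.tanh x| ≤ 1 := by
  rw [Real.tanh_eq_sinh_div_cosh, abs_div, abs_of_pos (Real.cosh_pos x),
    div_le_one (Real.cosh_pos x)]
  refine abs_le_of_sq_le_sq ?_ (Real.cosh_pos x).le
  linarith [Real.cosh_sq x]

/-- The equation `tanh' = 1 - tanh²` keeps the derivatives inside the polynomials in `tanh`. All of
them are therefore bounded, since `|tanh| ≤ 1`. -/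
theorem exists_polynomial_iteratedDeriv_tanh (n : ℕ) :
    ∃ P : Polynomial ℝ, iteratedDeriv n Real.tanh = fun x => P.eval (Real.tanh x) := by
  induction n with
  | zero => exact ⟨Polynomial.X, by funext x; simp⟩
  | succ n ih =>
    obtain ⟨P, hP⟩ := ih
    refine ⟨P.derivative * (1 - Polynomial.X ^ 2), ?_⟩
    rw [iteratedDeriv_succ, hP]
    funext x
    have := (P.hasDerivAt (Real.tanh x)).comp x (hasDerivAt_tanh x)
    refine this.deriv.trans ?_
    simp

theorem contDiff_tanh : ContDiff ℝ ∞ Real.tanh := by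
  have : Real.tanh = fun x => Real.sinh x / Real.cosh x := funext Real.tanh_eq_sinh_div_cosh
  rw [this]
  exact Real.contDiff_sinh.div Real.contDiff_cosh fun x => (Real.cosh_pos x).ne'

theorem exists_bound_iteratedFDeriv_tanh (n : ℕ) :
    ∃ C, ∀ x, ‖iteratedFDeriv ℝ n Real.tanh x‖ ≤ C := by
  obtain ⟨P, hP⟩ := exists_polynomial_iteratedDeriv_tanh n
  obtain ⟨C, hC⟩ := (isCompact_Icc (a := (-1 : ℝ)) (b := 1)).exists_bound_of_continuousOn
    P.continuous.continuousOn
  refine ⟨C, fun x => ?_⟩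
  rw [norm_iteratedFDeriv_eq_norm_iteratedDeriv, hP]
  exact hC _ (abs_le.1 (abs_tanh_le_one x))

theorem hasTemperateGrowth_tanh : Real.tanh.HasTemperateGrowth := by
  refine ⟨contDiff_tanh, fun n => ?_⟩
  obtain ⟨C, hC⟩ := exists_bound_iteratedFDeriv_tanh n
  exact ⟨0, C, by simpa using hC⟩

/-- Both sides vanish at zero and their derivatives compare because `cosh` is increasing on the
half-line. This is what bounds the distortion of `tanhFlow`. -/
theorem mul_sinh_le {l x : ℝ} (hl : 1 ≤ l) (hx : 0 ≤ x) : l * Real.sinh x ≤ Real.sinh (l * x) := by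
  have hd : ∀ y, HasDerivAt (fun y => Real.sinh (l * y) - l * Real.sinh y)
      (Real.cosh (l * y) * l - l * Real.cosh y) y := fun y => by
    have h1 := (Real.hasDerivAt_sinh (l * y)).comp y ((hasDerivAt_id y).const_mul l)
    rw [mul_one] at h1
    exact h1.sub ((Real.hasDerivAt_sinh y).const_mul l)
  have hmono : MonotoneOn (fun y => Real.sinh (l * y) - l * Real.sinh y) (Set.Ici 0) := by
    refine monotoneOn_of_deriv_nonneg (convex_Ici 0)
      (fun y _ => (hd y).continuousAt.continuousWithinAt)
      (fun y _ => (hd y).differentiableAt.differentiableWithinAt) fun y hy => ?_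
    rw [interior_Ici, Set.mem_Ioi] at hy
    rw [(hd y).deriv]
    have : Real.cosh y ≤ Real.cosh (l * y) := by
      rw [Real.cosh_le_cosh, abs_of_pos hy, abs_of_pos (by positivity)]
      nlinarith
    nlinarith
  have := hmono Set.self_mem_Ici (show x ∈ Set.Ici 0 from hx) hx
  simp only [mul_zero, Real.sinh_zero, sub_zero] at this
  linarith

end Tanh

/-! ### The two explicit flows; existence and uniqueness of the unitary groups. -/

section Flows

open Filter Topology

/-- The flow generating dilations. -/
def dilationFlow : LineFlow (fun s => s) where
  toFun t s := Real.exp (-t) * s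
  jac t _ := Real.exp (-t)
  contDiff := by fun_prop
  contDiff_jac := by fun_prop
  map_zero s := by simp
  map_add t t' s := by rw [neg_add, Real.exp_add]; ring
  hasDerivAt t s := by simpa using (hasDerivAt_id s).const_mul (Real.exp (-t))
  jac_pos t s := Real.exp_pos _
  hasDerivAt_time s := by
    have h := ((hasDerivAt_neg (0 : ℝ)).exp).mul_const s
    refine h.congr_deriv ?_
    have := Real.pi_ne_zero
    field_simp
    simp
  hasDerivAt_jac s := by
    refine ((hasDerivAt_neg (0 : ℝ)).exp).congr_deriv ?_
    simp
  abs_le t s := by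
    rw [abs_mul, abs_of_pos (Real.exp_pos _)]
    exact mul_le_mul_of_nonneg_right (Real.exp_le_exp.2 (neg_le_abs t)) (abs_nonneg s)

/-- For `x ≥ 0` one has `exp(-t) sinh x ≤ exp|t| sinh x ≤ sinh(exp|t| x)`, and `arsinh` is
increasing; oddness gives the other sign. -/
theorem abs_arsinh_mul_sinh_le (t x : ℝ) :
    |Real.arsinh (Real.exp (-t) * Real.sinh x)| ≤ Real.exp |t| * |x| := by
  have key : ∀ x, 0 ≤ x → |Real.arsinh (Real.exp (-t) * Real.sinh x)| ≤ Real.exp |t| * |x| := by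
    intro x hx
    have hs : 0 ≤ Real.sinh x := Real.sinh_nonneg_iff.2 hx
    rw [abs_of_nonneg (Real.arsinh_nonneg_iff.2 (by positivity)), abs_of_nonneg hx,
      ← Real.arsinh_sinh (Real.exp |t| * x), Real.arsinh_le_arsinh]
    refine le_trans ?_ (mul_sinh_le (Real.one_le_exp (abs_nonneg t)) hx)
    exact mul_le_mul_of_nonneg_right (Real.exp_le_exp.2 (neg_le_abs t)) hs
  rcases le_total 0 x with hx | hx
  · exact key x hx
  · have := key (-x) (by linarith)
    rwa [Real.sinh_neg, mul_neg, Real.arsinh_neg, abs_neg, abs_neg] at this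

/-- The flow with velocity field `-tanh (2πs) / (2π)`. -/
def tanhFlow : LineFlow Real.tanh where
  -- The substitution `sinh` linearises the equation: if `y' = -tanh y` then `(sinh y)' = -sinh y`.
  -- The factors `2π` come from the normalisation of the Fourier transform.
  toFun t s := Real.arsinh (Real.exp (-t) * Real.sinh ((2 * Real.pi) * s)) / (2 * Real.pi)
  jac t s := Real.exp (-t) * Real.cosh ((2 * Real.pi) * s) /
    Real.sqrt (1 + (Real.exp (-t) * Real.sinh ((2 * Real.pi) * s)) ^ 2)
  contDiff := by fun_prop
  contDiff_jac := by
    have h : ContDiff ℝ ∞ fun p : ℝ × ℝ =>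
        1 + (Real.exp (-p.1) * Real.sinh ((2 * Real.pi) * p.2)) ^ 2 := by fun_prop
    refine ContDiff.div (by fun_prop) (h.sqrt fun p => by positivity) fun p => by positivity
  map_zero s := by
    have := Real.pi_ne_zero
    simp only [neg_zero, Real.exp_zero, one_mul, Real.arsinh_sinh]
    field_simp
  map_add t t' s := by
    have := Real.pi_ne_zero
    rw [mul_div_cancel₀ _ (by positivity), Real.sinh_arsinh, neg_add, Real.exp_add, mul_assoc]
  hasDerivAt t s := by
    have h1 := (Real.hasDerivAt_sinh ((2 * Real.pi) * s)).comp s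
      ((hasDerivAt_id s).const_mul (2 * Real.pi))
    have h2 := ((h1.const_mul (Real.exp (-t))).arsinh).div_const (2 * Real.pi)
    refine h2.congr_deriv ?_
    have := Real.pi_ne_zero
    simp only [Function.comp_apply, smul_eq_mul]
    field_simp
  jac_pos t s := by
    have := Real.cosh_pos ((2 * Real.pi) * s)
    positivity
  hasDerivAt_time s := by
    have h1 := ((((hasDerivAt_neg (0 : ℝ)).exp).mul_const
      (Real.sinh ((2 * Real.pi) * s))).arsinh).div_const (2 * Real.pi)
    refine h1.congr_deriv ?_
    simp only [neg_zero, Real.exp_zero, one_mul, smul_eq_mul]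
    rw [show 1 + Real.sinh ((2 * Real.pi) * s) ^ 2 = Real.cosh ((2 * Real.pi) * s) ^ 2 by
      rw [Real.cosh_sq]; ring, Real.sqrt_sq (Real.cosh_pos _).le, Real.tanh_eq_sinh_div_cosh]
    ring
  hasDerivAt_jac s := by
    set c := Real.cosh ((2 * Real.pi) * s) with hc
    set S := Real.sinh ((2 * Real.pi) * s) with hS
    have hcpos : 0 < c := Real.cosh_pos _
    have hcS : 1 + S ^ 2 = c ^ 2 := by rw [hc, hS, Real.cosh_sq]; ring
    have h0 : HasDerivAt (fun t : ℝ => Real.exp (-t)) (-1) 0 := by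
      refine ((hasDerivAt_neg (0 : ℝ)).exp).congr_deriv ?_
      simp
    have h1 : HasDerivAt (fun t : ℝ => 1 + (Real.exp (-t) * S) ^ 2) (-2 * S ^ 2) 0 := by
      refine (((h0.mul_const S).pow 2).const_add 1).congr_deriv ?_
      simp
      ring
    have hval : 1 + (Real.exp (-(0 : ℝ)) * S) ^ 2 = c ^ 2 := by simp [hcS]
    have h2 := h1.sqrt (by rw [hval]; positivity)
    have h3 := (h0.mul_const c).div h2 (by rw [hval]; positivity)
    refine h3.congr_deriv ?_
    rw [(hasDerivAt_tanh _).deriv, hval, Real.sqrt_sq hcpos.le, Real.tanh_eq_sinh_div_cosh,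
      ← hc, ← hS]
    simp only [neg_zero, Real.exp_zero, one_mul]
    have : S ^ 2 = c ^ 2 - 1 := by linarith
    field_simp
    rw [this]
    ring
  abs_le t s := by
    have h := abs_arsinh_mul_sinh_le t ((2 * Real.pi) * s)
    have hpi : 0 < 2 * Real.pi := by positivity
    rw [abs_div, abs_of_pos hpi, div_le_iff₀ hpi]
    rw [abs_mul, abs_of_pos hpi] at h
    linarith

variable {ν : ℕ}

/-- The bounded vector field with components `tanh (k j)`. -/
def tanhField (ν : ℕ) : X ν → X ν := fun k => WithLp.toLp 2 fun j => Real.tanh (k j)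

theorem tanhField_mem (ν : ℕ) : tanhField ν ∈ VectorFieldClass ν := by
  have hsum : tanhField ν = fun k => ∑ j, ((ContinuousLinearMap.toSpanSingleton ℝ
      (basisVec j : X ν)) ∘ (Real.tanh ∘ (EuclideanSpace.proj (𝕜 := ℝ) j : X ν →L[ℝ] ℝ))) k := by
    funext k
    ext i
    simp [tanhField, basisVec, Pi.single_apply]
  have hsm : ∀ j, ContDiff ℝ ∞ (Real.tanh ∘ (EuclideanSpace.proj (𝕜 := ℝ) j : X ν →L[ℝ] ℝ)) :=
    fun j => contDiff_tanh.comp (ContinuousLinearMap.contDiff _)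
  refine ⟨?_, fun n => ?_, fun x hx => ?_⟩
  · rw [hsum]
    exact ContDiff.sum fun j _ => (ContinuousLinearMap.contDiff _).comp (hsm j)
  · obtain ⟨C, hC⟩ := exists_bound_iteratedFDeriv_tanh n
    refine ⟨∑ j : Fin ν, ‖ContinuousLinearMap.toSpanSingleton ℝ (basisVec j : X ν)‖ *
      (C * ‖(EuclideanSpace.proj (𝕜 := ℝ) j : X ν →L[ℝ] ℝ)‖ ^ n), fun x => ?_⟩
    rw [hsum, iteratedFDeriv_fun_sum_apply fun j _ => (((ContinuousLinearMap.contDiff _).comp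
      (hsm j)).of_le (by exact_mod_cast le_top)).contDiffAt]
    refine (norm_sum_le _ _).trans (Finset.sum_le_sum fun j _ => ?_)
    refine (ContinuousLinearMap.norm_iteratedFDeriv_comp_left _
      (hsm j).contDiffAt (by exact_mod_cast le_top)).trans ?_
    refine mul_le_mul_of_nonneg_left ?_ (norm_nonneg _)
    rw [ContinuousLinearMap.iteratedFDeriv_comp_right _ contDiff_tanh x (by exact_mod_cast le_top)]
    refine (ContinuousMultilinearMap.norm_compContinuousLinearMap_le _ _).trans ?_
    rw [Finset.prod_const, Finset.card_univ, Fintype.card_fin]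
    exact mul_le_mul_of_nonneg_right (hC _) (by positivity)
  · have hnn : ∀ s : ℝ, s ≠ 0 → 0 < Real.tanh s * s := by
      intro s hs
      rw [Real.tanh_eq_sinh_div_cosh, div_mul_eq_mul_div]
      refine div_pos ?_ (Real.cosh_pos s)
      rcases lt_or_gt_of_ne hs with h | h
      · exact mul_pos_of_neg_of_neg (Real.sinh_neg_iff.2 h) h
      · exact mul_pos (Real.sinh_pos_iff.2 h) h
    have hne : ∃ j, x j ≠ 0 := by
      by_contra hcon
      push Not at hcon
      exact hx (by ext j; simp [hcon j])
    obtain ⟨j, hj⟩ := hne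
    rw [PiLp.inner_apply]
    refine Finset.sum_pos' (fun i _ => ?_) ⟨j, Finset.mem_univ _, ?_⟩
    · rcases eq_or_ne (x i) 0 with h | h
      · simp [h]
      · exact (hnn _ h).le
    · exact hnn _ hj

/-- The pair `(φ, A_u φ)` in `L² × L²`. -/
def graphMap (u : X ν → X ν) : 𝓢(X ν, ℂ) →L[ℂ] L2 ν × L2 ν :=
  (SchwartzMap.toLpCLM ℂ ℂ 2 (volume : Measure (X ν))).prod
    ((SchwartzMap.toLpCLM ℂ ℂ 2 (volume : Measure (X ν))) ∘L conjOpCLM u)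

theorem graphMap_apply (u : X ν → X ν) (φ : 𝓢(X ν, ℂ)) :
    graphMap u φ = (φ.toLp 2, (conjOp u φ).toLp 2) := by
  rw [← conjOpCLM_apply]; rfl

theorem closure_image_of_seq_dense {u : X ν → X ν} {s t : Set 𝓢(X ν, ℂ)}
    (h : ∀ φ : 𝓢(X ν, ℂ), ∃ ψ : ℕ → 𝓢(X ν, ℂ), (∀ n, ψ n ∈ t) ∧ Tendsto ψ atTop (𝓝 φ)) :
    closure (graphMap u '' s) ⊆ closure (graphMap u '' t) := by
  refine closure_minimal ?_ isClosed_closure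
  rintro _ ⟨φ, _, rfl⟩
  obtain ⟨ψ, h1, h2⟩ := h φ
  exact mem_closure_of_tendsto (((graphMap u).continuous.tendsto φ).comp h2)
    (Eventually.of_forall fun n => ⟨ψ n, h1 n, rfl⟩)

theorem compactGraph_eq (u : X ν → X ν) :
    {p : L2 ν × L2 ν | ∃ φ : 𝓢(X ν, ℂ), HasCompactSupport φ ∧
      p = (φ.toLp 2, (conjOp u φ).toLp 2)} = graphMap u '' {φ | HasCompactSupport φ} := by
  ext p
  constructor
  · rintro ⟨φ, hφ, rfl⟩
    exact ⟨φ, hφ, graphMap_apply u φ⟩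
  · rintro ⟨φ, hφ, rfl⟩
    exact ⟨φ, hφ, graphMap_apply u φ⟩

/-- Both spaces are dense in the Schwartz space, on which `graphMap u` is continuous. So the
generator, defined through functions compactly supported in position, may be computed from functions
compactly supported in momentum, which the group preserves. -/
theorem closure_compactGraph (u : X ν → X ν) :
    closure (graphMap u '' {φ | HasCompactSupport φ}) =
      closure (graphMap u '' (momentumCore ν : Set 𝓢(X ν, ℂ))) :=
  (closure_image_of_seq_dense exists_seq_momentumCore_tendsto).antisymm
    (closure_image_of_seq_dense exists_seq_hasCompactSupport_tendsto)

theorem IsUnitaryGroup.isOneParamGroup {u : X ν → X ν} {U : ℝ → (L2 ν ≃ₗᵢ[ℂ] L2 ν)}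
    (h : IsUnitaryGroup u U) : IsOneParamGroup U := ⟨h.map_zero, h.map_add, h.continuous⟩

theorem IsUnitaryGroup.genGraph_eq {u : X ν → X ν} {U : ℝ → (L2 ν ≃ₗᵢ[ℂ] L2 ν)}
    (h : IsUnitaryGroup u U) :
    genGraph U = closure (graphMap u '' (momentumCore ν : Set 𝓢(X ν, ℂ))) := by
  rw [← closure_compactGraph, ← compactGraph_eq]
  exact h.generator

theorem dense_fst_graphMap (u : X ν → X ν) :
    Dense (Prod.fst '' (graphMap u '' (momentumCore ν : Set 𝓢(X ν, ℂ)))) := by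
  rw [Set.image_image]
  exact dense_toLp_momentumCore

theorem IsUnitaryGroup.unique {u : X ν → X ν} {U U' : ℝ → (L2 ν ≃ₗᵢ[ℂ] L2 ν)}
    (h : IsUnitaryGroup u U) (h' : IsUnitaryGroup u U') : U = U' := by
  refine h.isOneParamGroup.eq_of_genGraph_eq h'.isOneParamGroup
    (h.genGraph_eq.trans h'.genGraph_eq.symm) ?_
  rw [h.genGraph_eq]
  exact (dense_fst_graphMap u).mono (Set.image_mono subset_closure)

/-- One inclusion is closedness of the generator. The other is the core criterion
`genGraph_subset_closure`, which applies because transport preserves smoothness and compactness of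
support in momentum space. -/
theorem LineFlow.isUnitaryGroup {v : ℝ → ℝ} (b : LineFlow v) (hv : v.HasTemperateGrowth)
    {u : X ν → X ν} (hu : ∀ k j, u k j = v (k j)) :
    IsUnitaryGroup u (fun t => b.unitary t) where
  map_zero := (b.isOneParamGroup_unitary hv).map_zero
  map_add := (b.isOneParamGroup_unitary hv).map_add
  continuous := (b.isOneParamGroup_unitary hv).continuous
  generator := by
    rw [compactGraph_eq, closure_compactGraph]
    have hU := b.isOneParamGroup_unitary (ν := ν) hv
    have hsub : graphMap u '' (momentumCore ν : Set 𝓢(X ν, ℂ)) ⊆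
        genGraph (fun t => (b.unitary t : L2 ν ≃ₗᵢ[ℂ] L2 ν)) := by
      rintro _ ⟨φ, hφ, rfl⟩
      rw [graphMap_apply]
      exact b.hasDerivAt_unitary hv hu hφ
    refine Set.Subset.antisymm ?_ (closure_minimal hsub hU.isClosed_genGraph)
    have hmap : (((momentumCore ν).map (graphMap u : 𝓢(X ν, ℂ) →ₗ[ℂ] L2 ν × L2 ν) :
        Submodule ℂ (L2 ν × L2 ν)) : Set (L2 ν × L2 ν)) =
        graphMap u '' (momentumCore ν : Set 𝓢(X ν, ℂ)) := rfl
    have := hU.genGraph_subset_closure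
      ((momentumCore ν).map (graphMap u : 𝓢(X ν, ℂ) →ₗ[ℂ] L2 ν × L2 ν))
      (by rw [hmap]; exact hsub) ?_ (by rw [hmap]; exact dense_fst_graphMap u)
    · rw [hmap] at this
      exact this
    · rintro _ ⟨φ, hφ, rfl⟩ t
      refine ⟨(conjOp u (b.evolveS t φ hφ)).toLp 2, b.evolveS t φ hφ, b.evolveS_mem t φ hφ, ?_⟩
      change graphMap u _ = _
      rw [graphMap_apply, ← b.unitary_toLp]
      rfl

end Flows

/-! ### The Sobolev space in the momentum representation and the group acting on it. -/

section Sobolev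

open Filter Topology

variable {ν : ℕ}

/-- The product `ξ_j f` need not be square integrable, but it is locally integrable, so testing
against real smooth functions of compact support identifies it almost everywhere. -/
theorem toTemperedDistribution_congr_iff {j : Fin ν} {f F : L2 ν} :
    ((2 * Real.pi * Complex.I : ℂ) • TemperedDistribution.smulLeftCLM ℂ
      (fun x : X ν => ((inner ℝ x (basisVec j) : ℝ) : ℂ)) (f : 𝓢'(X ν, ℂ)) = (F : 𝓢'(X ν, ℂ))) ↔
      F =ᵐ[volume] fun ξ => (2 * Real.pi * Complex.I) * (ξ j : ℂ) * f ξ := by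
  have hin : ∀ x : X ν, inner ℝ x (basisVec j) = x j := fun x => by
    simp [basisVec, EuclideanSpace.inner_single_right]
  simp only [hin]
  have happ : ∀ φ : 𝓢(X ν, ℂ), ((2 * Real.pi * Complex.I : ℂ) • TemperedDistribution.smulLeftCLM ℂ
      (fun x : X ν => ((x j : ℝ) : ℂ)) (f : 𝓢'(X ν, ℂ))) φ =
      ∫ ξ, φ ξ • ((2 * Real.pi * Complex.I) * (ξ j : ℂ) * f ξ) := by
    intro φ
    change (2 * Real.pi * Complex.I : ℂ) • (TemperedDistribution.smulLeftCLM ℂ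
      (fun x : X ν => ((x j : ℝ) : ℂ)) (f : 𝓢'(X ν, ℂ)) φ) = _
    rw [TemperedDistribution.smulLeftCLM_apply_apply, Lp.toTemperedDistribution_apply,
      ← integral_smul]
    refine integral_congr_ae (Eventually.of_forall fun ξ => ?_)
    simp only [SchwartzMap.smulLeftCLM_apply_apply (hasTemperateGrowth_coord j), smul_eq_mul]
    ring
  constructor
  · intro h
    have hf : LocallyIntegrable (fun ξ => (2 * Real.pi * Complex.I) * (ξ j : ℂ) * f ξ) := by
      have h1 : LocallyIntegrable f := (Lp.memLp f).locallyIntegrable (by norm_num)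
      have h2 : Continuous fun ξ : X ν => (2 * Real.pi * Complex.I) * (ξ j : ℂ) := by fun_prop
      rw [← locallyIntegrableOn_univ] at h1 ⊢
      exact h1.continuousOn_mul h2.continuousOn isOpen_univ.isLocallyClosed
    refine ae_eq_of_integral_contDiff_smul_eq
      ((Lp.memLp F).locallyIntegrable (by norm_num)) hf fun g hg hgc => ?_
    have hgs : HasCompactSupport (fun x => (g x : ℂ)) := hgc.comp_left (g := Complex.ofReal) rfl
    have hgd : ContDiff ℝ ∞ (fun x => (g x : ℂ)) := Complex.ofRealCLM.contDiff.comp hg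
    have h2 := DFunLike.congr_fun h (hgs.toSchwartzMap hgd)
    rw [happ, Lp.toTemperedDistribution_apply] at h2
    have h3 : ∀ x, hgs.toSchwartzMap hgd x = (g x : ℂ) := fun x => rfl
    simp only [h3] at h2
    simp only [Complex.real_smul, smul_eq_mul] at h2 ⊢
    exact h2.symm
  · intro h
    ext φ
    rw [happ, Lp.toTemperedDistribution_apply]
    refine integral_congr_ae ?_
    filter_upwards [h] with ξ hξ
    rw [hξ]

/-- The gradient in the momentum representation. -/
theorem lineDeriv_eq_iff_fourier {j : Fin ν} {f F : L2 ν} :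
    ∂_{basisVec j} (f : 𝓢'(X ν, ℂ)) = (F : 𝓢'(X ν, ℂ)) ↔
      (𝓕 F : L2 ν) =ᵐ[volume] fun ξ => (2 * Real.pi * Complex.I) * (ξ j : ℂ) * (𝓕 f : L2 ν) ξ := by
  rw [← toTemperedDistribution_congr_iff, ← Lp.fourier_toTemperedDistribution_eq,
    ← Lp.fourier_toTemperedDistribution_eq, ← TemperedDistribution.fourier_lineDerivOp_eq]
  constructor
  · intro h; rw [h]
  · intro h
    have h2 := congrArg (fun w : 𝓢'(X ν, ℂ) => (𝓕⁻ w : 𝓢'(X ν, ℂ))) h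
    simpa only [fourierInv_fourier_eq] using h2

/-- The components of the gradient of an element of `H¹`. -/
def H1.grad (h : H1 ν) (j : Fin ν) : L2 ν := h.1.snd j

theorem H1.lineDeriv_toL2 (h : H1 ν) (j : Fin ν) :
    ∂_{basisVec j} (h.toL2 : 𝓢'(X ν, ℂ)) = (h.grad j : 𝓢'(X ν, ℂ)) := h.2 j

theorem H1.fourier_grad (h : H1 ν) (j : Fin ν) : (𝓕 (h.grad j) : L2 ν) =ᵐ[volume]
    fun ξ => (2 * Real.pi * Complex.I) * (ξ j : ℂ) * (𝓕 h.toL2 : L2 ν) ξ :=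
  lineDeriv_eq_iff_fourier.1 (h.lineDeriv_toL2 j)

theorem H1.norm_sq (h : H1 ν) : ‖h‖ ^ 2 = ‖h.toL2‖ ^ 2 + ∑ j, ‖h.grad j‖ ^ 2 := by
  have h1 : ‖h‖ = ‖h.1‖ := rfl
  rw [h1, WithLp.prod_norm_sq_eq_of_L2, PiLp.norm_sq_eq_of_L2]
  rfl

theorem H1.inner_eq (g h : H1 ν) :
    inner ℂ g h = inner ℂ g.toL2 h.toL2 + ∑ j, inner ℂ (g.grad j) (h.grad j) := by
  have h1 : inner ℂ g h = inner ℂ g.1 h.1 := rfl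
  rw [h1, WithLp.prod_inner_apply, PiLp.inner_apply]
  rfl

/-- The function determines its gradient through the Fourier transform. Identities in `H¹` can
therefore be checked in `L²`. -/
theorem H1.toL2_injective : Function.Injective (H1.toL2 : H1 ν → L2 ν) := by
  intro g h hgh
  have hgrad : ∀ j, g.grad j = h.grad j := fun j => by
    apply LineFlow.fourier_injective
    refine Lp.ext ?_
    filter_upwards [g.fourier_grad j, h.fourier_grad j] with ξ h1 h2
    rw [h1, h2, hgh]
  refine Subtype.ext ?_
  apply (WithLp.ofLp_injective 2)
  refine Prod.ext hgh ?_
  ext1 j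
  exact hgrad j

theorem H1.norm_toL2_le (h : H1 ν) : ‖h.toL2‖ ≤ ‖h‖ := by
  refine le_of_sq_le_sq ?_ (norm_nonneg _)
  rw [h.norm_sq]
  exact le_add_of_nonneg_right (Finset.sum_nonneg fun j _ => sq_nonneg _)

/-- The embedding `H¹ ⊂ L²` as a continuous linear map. -/
def H1.toL2CLM (ν : ℕ) : H1 ν →L[ℂ] L2 ν :=
  LinearMap.mkContinuous
    { toFun := H1.toL2
      map_add' := fun _ _ => rfl
      map_smul' := fun _ _ => rfl } 1 fun h => by rw [one_mul]; exact h.norm_toL2_le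

theorem H1.toL2_add (g h : H1 ν) : (g + h).toL2 = g.toL2 + h.toL2 := rfl

theorem H1.toL2_smul (c : ℂ) (h : H1 ν) : (c • h).toL2 = c • h.toL2 := rfl

theorem toH1_toL2 (φ : 𝓢(X ν, ℂ)) : (toH1 φ).toL2 = φ.toLp 2 := rfl

theorem toH1_grad (φ : 𝓢(X ν, ℂ)) (j : Fin ν) : (toH1 φ).grad j = (∂_{basisVec j} φ).toLp 2 := rfl

/-- The element of `H¹` with given function and gradient. -/
def H1.mk (f : L2 ν) (F : Fin ν → L2 ν)
    (h : ∀ j, ∂_{basisVec j} (f : 𝓢'(X ν, ℂ)) = (F j : 𝓢'(X ν, ℂ))) : H1 ν :=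
  (⟨WithLp.toLp 2 (f, WithLp.toLp 2 F), h⟩ : gradGraph ν)

theorem H1.mk_toL2 (f : L2 ν) (F : Fin ν → L2 ν)
    (h : ∀ j, ∂_{basisVec j} (f : 𝓢'(X ν, ℂ)) = (F j : 𝓢'(X ν, ℂ))) : (H1.mk f F h).toL2 = f := rfl

theorem H1.mk_grad (f : L2 ν) (F : Fin ν → L2 ν)
    (h : ∀ j, ∂_{basisVec j} (f : 𝓢'(X ν, ℂ)) = (F j : 𝓢'(X ν, ℂ))) (j : Fin ν) :
    (H1.mk f F h).grad j = F j := rfl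

/-- A pair of operators on `L²` intertwined by the gradient defines an operator on `H¹`. -/
def H1.mapCLM (A : L2 ν →L[ℂ] L2 ν) (B : Fin ν → (L2 ν →L[ℂ] L2 ν)) (C : ℝ)
    (hA : ∀ f, ‖A f‖ ≤ C * ‖f‖) (hB : ∀ j f, ‖B j f‖ ≤ C * ‖f‖)
    (hAB : ∀ (h : H1 ν) (j : Fin ν),
      ∂_{basisVec j} (A h.toL2 : 𝓢'(X ν, ℂ)) = (B j (h.grad j) : 𝓢'(X ν, ℂ))) :
    H1 ν →L[ℂ] H1 ν :=
  LinearMap.mkContinuous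
    { toFun := fun h => H1.mk (A h.toL2) (fun j => B j (h.grad j)) (hAB h)
      map_add' := fun g h => by
        apply H1.toL2_injective
        simp only [H1.toL2_add, H1.mk_toL2, map_add]
      map_smul' := fun c h => by
        apply H1.toL2_injective
        simp only [H1.toL2_smul, H1.mk_toL2, map_smul, RingHom.id_apply] } |C| fun h => by
    have hC : ∀ x : L2 ν, C * ‖x‖ ≤ |C| * ‖x‖ := fun x =>
      mul_le_mul_of_nonneg_right (le_abs_self C) (norm_nonneg _)
    change ‖H1.mk (A h.toL2) (fun j => B j (h.grad j)) (hAB h)‖ ≤ |C| * ‖h‖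
    refine le_of_sq_le_sq ?_ (by positivity)
    rw [H1.norm_sq, mul_pow, H1.norm_sq, mul_add, Finset.mul_sum]
    refine add_le_add ?_ (Finset.sum_le_sum fun j _ => ?_)
    · rw [← mul_pow, H1.mk_toL2]
      exact pow_le_pow_left₀ (norm_nonneg _) ((hA _).trans (hC _)) 2
    · rw [← mul_pow, H1.mk_grad]
      exact pow_le_pow_left₀ (norm_nonneg _) ((hB j _).trans (hC _)) 2

theorem H1.norm_mapCLM_le (A : L2 ν →L[ℂ] L2 ν) (B : Fin ν → (L2 ν →L[ℂ] L2 ν)) (C : ℝ)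
    (hA : ∀ f, ‖A f‖ ≤ C * ‖f‖) (hB : ∀ j f, ‖B j f‖ ≤ C * ‖f‖)
    (hAB : ∀ (h : H1 ν) (j : Fin ν),
      ∂_{basisVec j} (A h.toL2 : 𝓢'(X ν, ℂ)) = (B j (h.grad j) : 𝓢'(X ν, ℂ))) :
    ‖H1.mapCLM A B C hA hB hAB‖ ≤ |C| :=
  LinearMap.mkContinuous_norm_le _ (abs_nonneg C) _

/-- Multiplication by a bounded measurable function on `L²`. -/
def mulL2 (m : X ν → ℂ) (hm : MemLp m ⊤ volume) : L2 ν →L[ℂ] L2 ν :=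
  (ContinuousLinearMap.lsmul ℂ ℂ).holderL volume ⊤ 2 2 (hm.toLp m)

theorem coeFn_mulL2 (m : X ν → ℂ) (hm : MemLp m ⊤ volume) (f : L2 ν) :
    mulL2 m hm f =ᵐ[volume] fun x => m x * f x := by
  filter_upwards [(ContinuousLinearMap.lsmul ℂ ℂ).coeFn_holder (r := 2) (hm.toLp m) f,
    hm.coeFn_toLp] with x h1 h2
  have h3 : mulL2 m hm f = (ContinuousLinearMap.lsmul ℂ ℂ).holder 2 (hm.toLp m) f := rfl
  rw [h3, h1, h2]
  rfl

theorem norm_mulL2_le (m : X ν → ℂ) (hm : MemLp m ⊤ volume) {C : ℝ} (hC : ∀ x, ‖m x‖ ≤ C)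
    (f : L2 ν) : ‖mulL2 m hm f‖ ≤ C * ‖f‖ := by
  refine Lp.norm_le_mul_norm_of_ae_le_mul ?_
  filter_upwards [coeFn_mulL2 m hm f] with x hx
  rw [hx, norm_mul]
  exact mul_le_mul_of_nonneg_right (hC x) (norm_nonneg _)

namespace LineFlow

variable {v : ℝ → ℝ} (b : LineFlow v)

/-- The ratio `ξ_j / Ψ_t(ξ)_j`, by which the gradient is multiplied under the flow. -/
def ratio (t : ℝ) (j : Fin ν) (ξ : X ν) : ℂ := ((ξ j / b.toFun t (ξ j) : ℝ) : ℂ)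

theorem norm_ratio_le (t : ℝ) (j : Fin ν) (ξ : X ν) : ‖b.ratio t j ξ‖ ≤ Real.exp |t| := by
  rw [ratio, Complex.norm_real, Real.norm_eq_abs, abs_div]
  exact div_le_of_le_mul₀ (abs_nonneg _) (Real.exp_pos _).le (b.abs_ge t (ξ j))

/-- Where the denominator of the ratio vanishes, division returns zero; there `abs_ge` forces `ξ j =
0`, so the identity survives. -/
theorem ratio_mul (t : ℝ) (j : Fin ν) (ξ : X ν) :
    b.ratio t j ξ * (b.flow t ξ j : ℂ) = (ξ j : ℂ) := by
  rw [ratio, b.flow_apply, ← Complex.ofReal_mul]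
  rcases eq_or_ne (b.toFun t (ξ j)) 0 with h | h
  · have := b.abs_ge t (ξ j)
    rw [h, abs_zero, mul_zero] at this
    have h0 : ξ j = 0 := abs_eq_zero.1 (le_antisymm this (abs_nonneg _))
    simp [h0]
  · rw [div_mul_cancel₀ _ h]

theorem memLp_ratio (t : ℝ) (j : Fin ν) : MemLp (b.ratio t j : X ν → ℂ) ⊤ volume := by
  refine memLp_top_of_bound ?_ (Real.exp |t|) (Eventually.of_forall (b.norm_ratio_le t j))
  have h1 : Measurable fun ξ : X ν => ξ j :=
    (EuclideanSpace.proj (𝕜 := ℝ) j : X ν →L[ℝ] ℝ).continuous.measurable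
  have h2 : Measurable fun ξ : X ν => b.toFun t (ξ j) :=
    ((EuclideanSpace.proj (𝕜 := ℝ) j : X ν →L[ℝ] ℝ).continuous.comp
      (b.continuous_flow t)).measurable
  exact (Complex.measurable_ofReal.comp (h1.div h2)).aestronglyMeasurable

/-- The action of the group on the components of the gradient. -/
def gradOp (t : ℝ) (j : Fin ν) : L2 ν →L[ℂ] L2 ν :=
  (Lp.fourierTransformₗᵢ (X ν) ℂ).symm.toContinuousLinearEquiv.toContinuousLinearMap ∘L
    mulL2 _ (b.memLp_ratio t j) ∘L
      (b.transportEquiv t).toContinuousLinearEquiv.toContinuousLinearMap ∘L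
        (Lp.fourierTransformₗᵢ (X ν) ℂ).toContinuousLinearEquiv.toContinuousLinearMap

theorem fourier_gradOp (t : ℝ) (j : Fin ν) (f : L2 ν) :
    𝓕 (b.gradOp t j f) = mulL2 _ (b.memLp_ratio t j) (b.transportL2 t (𝓕 f)) :=
  (Lp.fourierTransformₗᵢ (X ν) ℂ).apply_symm_apply _

theorem norm_gradOp_le (t : ℝ) (j : Fin ν) (f : L2 ν) :
    ‖b.gradOp t j f‖ ≤ Real.exp |t| * ‖f‖ := by
  rw [← Lp.norm_fourier_eq, fourier_gradOp]
  refine (norm_mulL2_le _ _ (b.norm_ratio_le t j) _).trans_eq ?_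
  rw [← b.transportEquiv_apply, LinearIsometryEquiv.norm_map, Lp.norm_fourier_eq]

/-- Multiplication by `ξ_j` after transport is transport of the multiplication by `ξ_j`, corrected
by the bounded factor `ratio`. Each component of the gradient thus evolves by itself, which gives
the invariance of `H¹`. -/
theorem lineDeriv_unitary (t : ℝ) (h : H1 ν) (j : Fin ν) :
    ∂_{basisVec j} (b.unitary t h.toL2 : 𝓢'(X ν, ℂ)) =
      (b.gradOp t j (h.grad j) : 𝓢'(X ν, ℂ)) := by
  rw [lineDeriv_eq_iff_fourier, b.fourier_gradOp, b.fourier_unitary]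
  filter_upwards [coeFn_mulL2 _ (b.memLp_ratio t j) (b.transportL2 t (𝓕 (h.grad j))),
    b.coeFn_transportL2 t (𝓕 (h.grad j)), b.coeFn_transportL2 t (𝓕 h.toL2),
    b.transport_congr t (h.fourier_grad j)] with ξ h1 h2 h3 h4
  rw [h1, h2, h3, h4, transport, transport, ← b.ratio_mul t j ξ]
  ring

/-- The group `exp (i t A_u)` on `H¹`. -/
def sobolevGroup (t : ℝ) : H1 ν →L[ℂ] H1 ν :=
  H1.mapCLM (b.unitary t).toContinuousLinearEquiv.toContinuousLinearMap (b.gradOp t) (Real.exp |t|)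
    (fun f => by
      refine ((b.unitary t).norm_map f).le.trans ?_
      exact le_mul_of_one_le_left (norm_nonneg _) (Real.one_le_exp (abs_nonneg t)))
    (b.norm_gradOp_le t) (b.lineDeriv_unitary t)

theorem sobolevGroup_toL2 (t : ℝ) (h : H1 ν) :
    (b.sobolevGroup t h).toL2 = b.unitary t h.toL2 := rfl

theorem norm_sobolevGroup_le (t : ℝ) : ‖(b.sobolevGroup t : H1 ν →L[ℂ] H1 ν)‖ ≤ Real.exp |t| :=
  (H1.norm_mapCLM_le _ _ _ _ _ _).trans_eq (abs_of_pos (Real.exp_pos _))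

theorem isSobolevGroup (hv : v.HasTemperateGrowth) {u : X ν → X ν}
    (hu : ∀ k j, u k j = v (k j)) : IsSobolevGroup u (fun t => b.sobolevGroup t) :=
  ⟨_, b.isUnitaryGroup hv hu, fun t f => b.sobolevGroup_toL2 t f⟩

theorem sobolevGroup_toH1 (t : ℝ) {φ : 𝓢(X ν, ℂ)} (hφ : φ ∈ momentumCore ν) :
    b.sobolevGroup t (toH1 φ) = toH1 (b.evolveS t φ hφ) := by
  apply H1.toL2_injective
  rw [b.sobolevGroup_toL2, toH1_toL2, toH1_toL2, b.unitary_toLp]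

end LineFlow

/-- The regularity classes quantify existentially over the group. Refuting one of them requires
identifying an arbitrary such group with the explicit one. -/
theorem IsSobolevGroup.unique {u : X ν → X ν} {S S' : ℝ → (H1 ν →L[ℂ] H1 ν)}
    (h : IsSobolevGroup u S) (h' : IsSobolevGroup u S') : S = S' := by
  obtain ⟨U, hU, hS⟩ := h
  obtain ⟨U', hU', hS'⟩ := h'
  funext t
  ext1 f
  apply H1.toL2_injective
  rw [hS, hS', hU.unique hU']

/-- Schwartz functions as elements of `H¹`, as a linear map. -/
def toH1L (ν : ℕ) : 𝓢(X ν, ℂ) →ₗ[ℂ] H1 ν where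
  toFun := toH1
  map_add' φ ψ := by
    apply H1.toL2_injective
    exact (SchwartzMap.toLpCLM ℂ ℂ 2 (volume : Measure (X ν))).map_add φ ψ
  map_smul' c φ := by
    apply H1.toL2_injective
    exact (SchwartzMap.toLpCLM ℂ ℂ 2 (volume : Measure (X ν))).map_smul c φ

theorem inner_fourier_lineDeriv (φ : 𝓢(X ν, ℂ)) (h : H1 ν) (j : Fin ν) :
    inner ℂ ((∂_{basisVec j} φ).toLp 2 : L2 ν) (h.grad j) =
      inner ℂ (((4 * Real.pi ^ 2 : ℂ) • qOp j (qOp j (𝓕 φ : 𝓢(X ν, ℂ)))).toLp 2 volume : L2 ν)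
        (𝓕 h.toL2) := by
  rw [← Lp.inner_fourier_eq, L2.inner_def, L2.inner_def, SchwartzMap.toLp_fourier_eq]
  refine integral_congr_ae ?_
  filter_upwards [h.fourier_grad j, (𝓕 (∂_{basisVec j} φ)).coeFn_toLp 2 volume,
    ((4 * Real.pi ^ 2 : ℂ) • qOp j (qOp j (𝓕 φ : 𝓢(X ν, ℂ)))).coeFn_toLp 2 volume] with ξ h1 h2 h3
  rw [h1, h2, h3, SchwartzMap.fourier_lineDerivOp_eq, smulLeftCLM_inner_basisVec, smul_apply,
    smul_apply, qOp_apply, qOp_apply, qOp_apply]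
  simp only [RCLike.inner_apply, smul_eq_mul, map_mul, Complex.conj_I, Complex.conj_ofReal,
    map_ofNat, map_pow]
  linear_combination (-4 * Real.pi ^ 2 * (ξ j : ℂ) ^ 2 * (conj (𝓕 φ ξ) *
    (𝓕 h.toL2 : L2 ν) ξ)) * Complex.I_sq

instance (ν : ℕ) : CompleteSpace (H1 ν) := by
  have hcl : IsClosed (gradGraph ν : Set (WithLp 2 (L2 ν × PiLp 2 (fun _ : Fin ν => L2 ν)))) := by
    have : (gradGraph ν : Set (WithLp 2 (L2 ν × PiLp 2 (fun _ : Fin ν => L2 ν)))) =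
        ⋂ j, {h | ∂_{basisVec j} (h.fst : 𝓢'(X ν, ℂ)) = (h.snd j : 𝓢'(X ν, ℂ))} := by
      ext h
      simp only [Set.mem_iInter]
      rfl
    rw [this]
    refine isClosed_iInter fun j => isClosed_eq ?_ ?_
    · exact (lineDerivOpCLM ℂ 𝓢'(X ν, ℂ) (basisVec j)).continuous.comp
        ((Lp.toTemperedDistributionCLM ℂ (volume : Measure (X ν)) 2).continuous.comp
          (continuous_fst.comp (WithLp.prod_continuous_ofLp _ _ _)))
    · exact (Lp.toTemperedDistributionCLM ℂ (volume : Measure (X ν)) 2).continuous.comp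
        ((PiLp.continuous_apply 2 _ j).comp (continuous_snd.comp (WithLp.prod_continuous_ofLp _ _ _)))
  exact hcl.completeSpace_coe

/-- In momentum space the `H¹` inner product carries the smooth positive weight `w = 1 + 4π²|ξ|²`. A
vector orthogonal to the core is tested against `w⁻¹ g`, with `g` smooth of compact support; the
weight cancels and leaves orthogonality to `g` in `L²`. -/
theorem dense_toH1_momentumCore :
    Dense (toH1 '' (momentumCore ν : Set 𝓢(X ν, ℂ)) : Set (H1 ν)) := by
  have key : ((momentumCore ν).map (toH1L ν)).topologicalClosure = ⊤ := by
    rw [Submodule.topologicalClosure_eq_top_iff, Submodule.eq_bot_iff]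
    intro h hh
    have hort : ∀ g : 𝓢(X ν, ℂ), HasCompactSupport g →
        inner ℂ (g.toLp 2 volume : L2 ν) (𝓕 h.toL2) = (0 : ℂ) := by
      intro g hg
      set w : X ν → ℂ := fun ξ => ((1 + ∑ j, 4 * Real.pi ^ 2 * (ξ j) ^ 2 : ℝ) : ℂ) with hw
      have hw0 : ∀ ξ, w ξ ≠ 0 := fun ξ => by
        have : 0 < 1 + ∑ j, 4 * Real.pi ^ 2 * (ξ j) ^ 2 := by positivity
        exact Complex.ofReal_ne_zero.2 this.ne'
      have hwd : ContDiff ℝ ∞ w := by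
        refine Complex.ofRealCLM.contDiff.comp (contDiff_const.add (ContDiff.sum fun j _ => ?_))
        exact contDiff_const.mul
          (((EuclideanSpace.proj (𝕜 := ℝ) j : X ν →L[ℝ] ℝ).contDiff).pow 2)
      have hkc : HasCompactSupport fun ξ => (w ξ)⁻¹ * g ξ := hg.mul_left
      have hkd : ContDiff ℝ ∞ fun ξ => (w ξ)⁻¹ * g ξ := (hwd.inv hw0).mul (g.smooth ⊤)
      set k : 𝓢(X ν, ℂ) := hkc.toSchwartzMap hkd with hk
      have hkapp : ∀ ξ, k ξ = (w ξ)⁻¹ * g ξ := fun ξ => rfl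
      have hmem : 𝓕⁻ k ∈ momentumCore ν := by
        rw [mem_momentumCore, fourier_fourierInv_eq]; exact hkc
      have h0 : inner ℂ (toH1 (𝓕⁻ k)) h = (0 : ℂ) := hh _ (Submodule.mem_map_of_mem hmem)
      rw [H1.inner_eq, toH1_toL2] at h0
      simp only [toH1_grad, inner_fourier_lineDeriv, fourier_fourierInv_eq] at h0
      rw [← Lp.inner_fourier_eq, SchwartzMap.toLp_fourier_eq, fourier_fourierInv_eq,
        ← sum_inner, ← inner_add_left] at h0
      have hg' : g = k + ∑ j, (4 * Real.pi ^ 2 : ℂ) • qOp j (qOp j k) := by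
        ext ξ
        have h3 : g ξ = w ξ * k ξ := by rw [hkapp, mul_inv_cancel_left₀ (hw0 ξ)]
        simp only [add_apply, sum_apply, smul_apply, qOp_apply, smul_eq_mul]
        rw [h3, hw]
        push_cast
        rw [add_mul, Finset.sum_mul, one_mul]
        congr 1
        refine Finset.sum_congr rfl fun j _ => ?_
        ring
      have h4 := congrArg (SchwartzMap.toLpCLM ℂ ℂ 2 (volume : Measure (X ν))) hg'
      rw [map_add, map_sum] at h4
      exact (congrArg (fun x : L2 ν => inner ℂ x (𝓕 h.toL2)) h4).trans h0
    have hz : (𝓕 h.toL2 : L2 ν) = 0 := by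
      have hd := dense_toLp_of_seq_dense (ν := ν) (s := {φ | HasCompactSupport φ})
        exists_seq_hasCompactSupport_tendsto
      have := Continuous.ext_on hd (f := fun x => inner ℂ x (𝓕 h.toL2 : L2 ν))
        (g := fun _ => (0 : ℂ)) (by fun_prop) (by fun_prop)
        (by rintro _ ⟨φ, hφ, rfl⟩; exact hort φ hφ)
      exact inner_self_eq_zero.1 (congrFun this _)
    apply H1.toL2_injective
    apply LineFlow.fourier_injective
    rw [hz]
    exact (map_zero (Lp.fourierTransformₗᵢ (X ν) ℂ)).symm
  rw [dense_iff_closure_eq]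
  have h2 := congrArg (fun s : Submodule ℂ (H1 ν) => (s : Set (H1 ν))) key
  rw [Submodule.topologicalClosure_coe] at h2
  exact h2

end Sobolev

/-! ### Integration by parts along radial vector fields. -/

section RadialIntegration

open Filter Topology

variable {ν : ℕ}

theorem hasLineDerivAt_norm {x : X ν} (hx : x ≠ 0) (j : Fin ν) :
    HasLineDerivAt ℝ (fun y : X ν => ‖y‖) (x j / ‖x‖) x (basisVec j) := by
  have h1 : HasDerivAt (fun t : ℝ => x + t • basisVec j) (basisVec j) 0 := by
    simpa using ((hasDerivAt_id (0 : ℝ)).smul_const (basisVec j : X ν)).const_add x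
  have h2 := (h1.norm_sq).sqrt (by simpa using hx)
  refine (h2.congr_deriv ?_).congr_of_eventuallyEq (Eventually.of_forall fun t => ?_)
  · have h3 : inner ℝ x (basisVec j) = x j := by
      rw [basisVec, EuclideanSpace.inner_single_right]; simp
    rw [zero_smul, add_zero, h3, Real.sqrt_sq (norm_nonneg _)]
    ring
  · exact (Real.sqrt_sq (norm_nonneg _)).symm

theorem hasLineDerivAt_coord (x : X ν) (j : Fin ν) :
    HasLineDerivAt ℝ (fun y : X ν => y j) 1 x (basisVec j) := by
  have h : HasDerivAt (fun t : ℝ => x j + t) 1 0 := by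
    simpa using (hasDerivAt_id (0 : ℝ)).const_add (x j)
  refine h.congr_of_eventuallyEq (Eventually.of_forall fun t => ?_)
  simp [basisVec]

/-- Since `k` vanishes near zero, the singularity of the norm at the origin plays no role. -/
theorem hasLineDerivAt_radial_mul_coord {k : ℝ → ℝ} {c : ℝ} (hc : 0 < c)
    (hk : ∀ r, 0 < r → DifferentiableAt ℝ k r) (hk0 : ∀ r ≤ c, k r = 0) (x : X ν) (j : Fin ν) :
    HasLineDerivAt ℝ (fun y : X ν => k ‖y‖ * y j)
      (k ‖x‖ + deriv k ‖x‖ * (x j / ‖x‖) * x j) x (basisVec j) := by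
  rcases eq_or_ne x 0 with rfl | hx
  · have h : HasDerivAt (fun _ : ℝ => (0 : ℝ)) 0 0 := hasDerivAt_const 0 0
    refine (h.congr_deriv ?_).congr_of_eventuallyEq ?_
    · simp [hk0 0 hc.le]
    · have hcont : ContinuousAt (fun t : ℝ => ‖(0 : X ν) + t • basisVec j‖) 0 := by fun_prop
      have : ∀ᶠ t : ℝ in 𝓝 0, ‖(0 : X ν) + t • basisVec j‖ < c :=
        hcont.eventually_lt continuousAt_const (by simpa using hc)
      filter_upwards [this] with t ht
      simp only [hk0 _ ht.le, zero_mul]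
  · have hx' : 0 < ‖x‖ := norm_pos_iff.2 hx
    have h1 : HasDerivAt k (deriv k ‖x‖) ‖x + (0 : ℝ) • basisVec j‖ := by
      simpa using (hk _ hx').hasDerivAt
    have h2 := (h1.comp (0 : ℝ) (hasLineDerivAt_norm hx j)).mul (hasLineDerivAt_coord x j)
    refine h2.congr_deriv ?_
    simp
    ring

/-- Integration by parts along the radial vector field `x ↦ k(|x|) x`. -/
theorem integral_radial {k : ℝ → ℝ} {c R M : ℝ} (hc : 0 < c)
    (hk : ∀ r, 0 < r → DifferentiableAt ℝ k r) (hk0 : ∀ r ≤ c, k r = 0)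
    (hkR : ∀ r, R ≤ r → k r = 0) (hkM : ∀ r, |k r| ≤ M) (hkM' : ∀ r, |deriv k r| ≤ M)
    {Φ : X ν → ℂ} {Φ' : Fin ν → X ν → ℂ} (hΦ : Integrable Φ) (hΦ' : ∀ j, Integrable (Φ' j))
    (hd : ∀ j x, HasLineDerivAt ℝ Φ (Φ' j x) x (basisVec j)) :
    Integrable (fun x => ((ν * k ‖x‖ + ‖x‖ * deriv k ‖x‖ : ℝ) : ℂ) * Φ x +
      (k ‖x‖ : ℂ) * ∑ j, (x j : ℂ) * Φ' j x) ∧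
    ∫ x, (((ν * k ‖x‖ + ‖x‖ * deriv k ‖x‖ : ℝ) : ℂ) * Φ x +
      (k ‖x‖ : ℂ) * ∑ j, (x j : ℂ) * Φ' j x) = 0 := by
  have hkm : Measurable k := by
    have hcont : Continuous k := by
      rw [continuous_iff_continuousAt]
      intro r
      rcases lt_or_ge 0 r with h | h
      · exact (hk r h).continuousAt
      · have : k =ᶠ[𝓝 r] fun _ => 0 := by
          filter_upwards [Iio_mem_nhds (h.trans_lt hc)] with s hs
          exact hk0 s (le_of_lt hs)
        exact this.continuousAt
    exact hcont.measurable
  have hM : 0 ≤ M := (abs_nonneg _).trans (hkM 0)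
  have hdkR : ∀ r, R < r → deriv k r = 0 := fun r hr => by
    have : k =ᶠ[𝓝 r] fun _ => 0 := by
      filter_upwards [Ioi_mem_nhds hr] with s hs
      exact hkR s (le_of_lt hs)
    rw [this.deriv_eq, deriv_const]
  have habs : ∀ (x : X ν) j, |x j| ≤ ‖x‖ := fun x j => by
    simpa using PiLp.norm_apply_le x j
  have hb1 : ∀ (x : X ν) j, ‖k ‖x‖ * x j‖ ≤ M * |R| := fun x j => by
    rw [norm_mul]
    rcases le_or_gt R ‖x‖ with h | h
    · rw [hkR _ h]; simp; positivity
    · exact mul_le_mul (hkM _) ((habs x j).trans (h.le.trans (le_abs_self R)))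
        (norm_nonneg _) hM
  have hb2 : ∀ (x : X ν) j, ‖k ‖x‖ + deriv k ‖x‖ * (x j / ‖x‖) * x j‖ ≤ M + M * |R| := fun x j => by
    refine (norm_add_le _ _).trans (add_le_add (hkM _) ?_)
    rw [norm_mul, norm_mul]
    rcases le_or_gt ‖x‖ R with h | h
    · refine mul_le_mul ?_ ((habs x j).trans (h.trans (le_abs_self R))) (norm_nonneg _) hM
      refine (mul_le_mul (hkM' _) ?_ (norm_nonneg _) hM).trans_eq (mul_one M)
      rw [norm_div, norm_norm]
      exact div_le_one_of_le₀ (habs x j) (norm_nonneg _)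
    · rw [hdkR _ h]; simp; positivity
  have hm1 : ∀ j, Measurable fun x : X ν => k ‖x‖ * x j := fun j =>
    (hkm.comp measurable_norm).mul (by fun_prop)
  have hm2 : ∀ j, Measurable fun x : X ν => k ‖x‖ + deriv k ‖x‖ * (x j / ‖x‖) * x j := fun j =>
    (hkm.comp measurable_norm).add ((((measurable_deriv k).comp measurable_norm).mul
      ((by fun_prop : Measurable fun x : X ν => x j).div measurable_norm)).mul (by fun_prop))
  have i1 : ∀ (j : Fin ν) (Ψ : X ν → ℂ), Integrable Ψ →
      Integrable fun x => (k ‖x‖ * x j) • Ψ x := fun j Ψ h =>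
    h.bdd_smul _ (hm1 j).aestronglyMeasurable (Eventually.of_forall fun x => hb1 x j)
  have i2 : ∀ (j : Fin ν), Integrable fun x => (k ‖x‖ + deriv k ‖x‖ * (x j / ‖x‖) * x j) • Φ x :=
    fun j => hΦ.bdd_smul _ (hm2 j).aestronglyMeasurable (Eventually.of_forall fun x => hb2 x j)
  have key : ∀ j : Fin ν, ∫ x, (k ‖x‖ * x j) • Φ' j x =
      -∫ x, (k ‖x‖ + deriv k ‖x‖ * (x j / ‖x‖) * x j) • Φ x := fun j =>
    integral_bilinear_hasLineDerivAt_right_eq_neg_left_of_integrable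
      (B := ContinuousLinearMap.lsmul ℝ ℝ) (i2 j) (i1 j _ (hΦ' j)) (i1 j _ hΦ)
      (fun x _ => hasLineDerivAt_radial_mul_coord hc hk hk0 x j) (fun x _ => hd j x)
  -- The coefficient of `Φ` is the divergence of `k(|x|) x`: summing `k + k' x_j²/|x|` over the
  -- coordinates gives `ν k + |x| k'`.
  have hfun : (fun x => ((ν * k ‖x‖ + ‖x‖ * deriv k ‖x‖ : ℝ) : ℂ) * Φ x +
      (k ‖x‖ : ℂ) * ∑ j, (x j : ℂ) * Φ' j x) = fun x =>
      ∑ j, ((k ‖x‖ + deriv k ‖x‖ * (x j / ‖x‖) * x j) • Φ x + (k ‖x‖ * x j) • Φ' j x) := by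
    funext x
    rw [Finset.sum_add_distrib]
    simp only [Complex.real_smul]
    rw [← Finset.sum_mul, ← Complex.ofReal_sum]
    congr 1
    swap
    · rw [Finset.mul_sum]
      push_cast
      exact Finset.sum_congr rfl fun j _ => by ring
    congr 2
    rw [Finset.sum_add_distrib, Finset.sum_const, Finset.card_univ, Fintype.card_fin, nsmul_eq_mul]
    congr 1
    have h2 : ‖x‖ ^ 2 = ∑ j, x j ^ 2 := EuclideanSpace.real_norm_sq_eq x
    rcases eq_or_ne x 0 with rfl | hx
    · simp
    · have hx' : ‖x‖ ≠ 0 := norm_ne_zero_iff.2 hx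
      have : ∀ j, deriv k ‖x‖ * (x j / ‖x‖) * x j = deriv k ‖x‖ / ‖x‖ * x j ^ 2 := fun j => by
        field_simp
      rw [Finset.sum_congr rfl fun j _ => this j, ← Finset.mul_sum, ← h2]
      field_simp
  rw [hfun]
  have i3 : ∀ j : Fin ν, Integrable fun x =>
      (k ‖x‖ + deriv k ‖x‖ * (x j / ‖x‖) * x j) • Φ x + (k ‖x‖ * x j) • Φ' j x :=
    fun j => (i2 j).add (i1 j _ (hΦ' j))
  refine ⟨integrable_finsetSum _ fun j _ => i3 j, ?_⟩
  rw [integral_finsetSum _ fun j _ => i3 j]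
  refine Finset.sum_eq_zero fun j _ => ?_
  rw [integral_add (i2 j) (i1 j _ (hΦ' j)), key j, add_neg_cancel]

end RadialIntegration

/-! ### The mass of a function on a thin shell. -/

section Shell

open Filter Topology

variable {ν : ℕ}

theorem hasLineDerivAt_schwartz (F : 𝓢(X ν, ℂ)) (j : Fin ν) (x : X ν) :
    HasLineDerivAt ℝ F (∂_{basisVec j} F x) x (basisVec j) := by
  rw [SchwartzMap.lineDerivOp_apply_eq_fderiv]
  exact F.differentiableAt.hasFDerivAt.hasLineDerivAt _

theorem hasLineDerivAt_mul_conj (F G : 𝓢(X ν, ℂ)) (j : Fin ν) (x : X ν) :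
    HasLineDerivAt ℝ (fun x => F x * conj (G x))
      (∂_{basisVec j} F x * conj (G x) + F x * conj (∂_{basisVec j} G x)) x (basisVec j) := by
  have h := (hasLineDerivAt_schwartz F j x).mul (hasLineDerivAt_schwartz G j x).star
  refine h.congr_deriv ?_
  simp

theorem exists_norm_le_schwartz (F : 𝓢(X ν, ℂ)) : ∃ C, ∀ x, ‖F x‖ ≤ C :=
  ⟨_, SchwartzMap.norm_le_seminorm ℂ F⟩

theorem integrable_mul_conj (F G : 𝓢(X ν, ℂ)) : Integrable fun x => F x * conj (G x) := by
  obtain ⟨C, hC⟩ := exists_norm_le_schwartz G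
  exact F.integrable.mul_bdd (Complex.continuous_conj.comp G.continuous).aestronglyMeasurable
    (Eventually.of_forall fun x => by simpa using hC x)

theorem integrable_lineDeriv_mul_conj (F G : 𝓢(X ν, ℂ)) (j : Fin ν) :
    Integrable fun x => ∂_{basisVec j} F x * conj (G x) + F x * conj (∂_{basisVec j} G x) :=
  (integrable_mul_conj (∂_{basisVec j} F) G).add (integrable_mul_conj F (∂_{basisVec j} G))

theorem integrable_norm_sq (F : 𝓢(X ν, ℂ)) : Integrable fun x => ‖F x‖ ^ 2 := by
  refine (integrable_mul_conj F F).norm.congr (Eventually.of_forall fun x => ?_)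
  simp [sq]

/-- The density `|F|² + |∇F|²`. -/
def energyDensity (F : 𝓢(X ν, ℂ)) (x : X ν) : ℝ :=
  ‖F x‖ ^ 2 + ∑ j : Fin ν, ‖(∂_{basisVec j} F : 𝓢(X ν, ℂ)) x‖ ^ 2

/-- The shell of width `2` around the sphere of radius `a`. -/
def shell (ν : ℕ) (a : ℝ) : Set (X ν) := {x | |‖x‖ - a| ≤ 1}

/-- The squared `H¹` norm of `F` on the shell around the sphere of radius `a`. -/
def shellEnergy (a : ℝ) (F : 𝓢(X ν, ℂ)) : ℝ := ∫ x in shell ν a, energyDensity F x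

theorem energyDensity_nonneg (F : 𝓢(X ν, ℂ)) (x : X ν) : 0 ≤ energyDensity F x := by
  unfold energyDensity; positivity

theorem integrable_energyDensity (F : 𝓢(X ν, ℂ)) : Integrable (energyDensity F) :=
  (integrable_norm_sq F).add (integrable_finsetSum Finset.univ fun j _ =>
    integrable_norm_sq (∂_{basisVec j} F))

theorem measurableSet_shell (a : ℝ) : MeasurableSet (shell ν a) :=
  measurableSet_le (by fun_prop) measurable_const

theorem shellEnergy_nonneg (a : ℝ) (F : 𝓢(X ν, ℂ)) : 0 ≤ shellEnergy a F :=
  integral_nonneg fun x => energyDensity_nonneg F x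

theorem norm_sq_toLp (F : 𝓢(X ν, ℂ)) : ‖(F.toLp 2 volume : L2 ν)‖ ^ 2 = ∫ x, ‖F x‖ ^ 2 := by
  rw [← inner_self_eq_norm_sq (𝕜 := ℂ), L2.inner_def, ← integral_re]
  · refine integral_congr_ae ?_
    filter_upwards [F.coeFn_toLp 2 volume] with x hx
    rw [hx, inner_self_eq_norm_sq]
  · exact L2.integrable_inner _ _

theorem norm_sq_toH1 (F : 𝓢(X ν, ℂ)) : ‖toH1 F‖ ^ 2 = ∫ x, energyDensity F x := by
  rw [H1.norm_sq, toH1_toL2, norm_sq_toLp]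
  simp only [toH1_grad, norm_sq_toLp, energyDensity]
  rw [integral_add (integrable_norm_sq F) (integrable_finsetSum _ fun j _ => integrable_norm_sq _),
    integral_finsetSum _ fun j _ => integrable_norm_sq _]

theorem shellEnergy_le (a : ℝ) (F : 𝓢(X ν, ℂ)) : shellEnergy a F ≤ ‖toH1 F‖ ^ 2 := by
  rw [norm_sq_toH1]
  exact setIntegral_le_integral (integrable_energyDensity F)
    (Eventually.of_forall fun x => energyDensity_nonneg F x)

theorem setIntegral_indicator_energyDensity (a : ℝ) (F : 𝓢(X ν, ℂ)) :
    ∫ x, (shell ν a).indicator (energyDensity F) x = shellEnergy a F :=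
  integral_indicator (measurableSet_shell a)

variable {χ : ℝ → ℝ}

theorem hasCompactSupport_of_abs_gt (h : ∀ t : ℝ, 1 < |t| → χ t = 0) : HasCompactSupport χ :=
  HasCompactSupport.intro (isCompact_Icc (a := (-1 : ℝ)) (b := 1)) fun t ht => h t (by
    rw [Set.mem_Icc, ← abs_le] at ht
    exact not_le.1 ht)

/-- The mass of a Schwartz function on a shell of width `1 / N`. -/
theorem exists_shell_estimate (hχ : Continuous χ) (hs : ∀ t : ℝ, 1 < |t| → χ t = 0) :
    ∃ C : ℝ, 0 ≤ C ∧ ∀ (a N : ℝ), 2 ≤ a → 8 ≤ N → ∀ F : 𝓢(X ν, ℂ),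
      ∫ x, χ (N * (‖x‖ - a)) ^ 2 * ‖F x‖ ^ 2 ≤ C * N⁻¹ * shellEnergy a F := by
  -- The weight `χ(N(r-a))²` is realised as a derivative: `N⁻¹ H(N(r-a))` is a primitive of it and
  -- is of size `N⁻¹`. This primitive does not vanish far outside, so it is multiplied by the cutoff
  -- `θ(4(r-a))`, equal to 1 where the weight lives because `N ≥ 8`. The derivative of the cutoff
  -- contributes a term of size `N⁻¹` as well.
  set H : ℝ → ℝ := fun t => ∫ s in (-1 : ℝ)..t, χ s ^ 2 with hH
  have hHd : ∀ t, HasDerivAt H (χ t ^ 2) t := fun t =>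
    (Continuous.integral_hasStrictDerivAt (f := fun s => χ s ^ 2) (hχ.pow 2) (-1) t).hasDerivAt
  have hc : HasCompactSupport fun s => χ s ^ 2 :=
    (hasCompactSupport_of_abs_gt hs).comp_left (g := fun s => s ^ 2) (by simp)
  obtain ⟨M, hM⟩ : ∃ M, ∀ t, |H t| ≤ M := by
    have hi : Integrable fun s => χ s ^ 2 :=
      (hχ.pow 2).integrable_of_hasCompactSupport hc
    refine ⟨∫ s, ‖χ s ^ 2‖, fun t => ?_⟩
    refine (intervalIntegral.norm_integral_le_integral_norm_uIoc (f := fun s => χ s ^ 2)).trans ?_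
    exact setIntegral_le_integral hi.norm (Eventually.of_forall fun _ => norm_nonneg _)
  have hM0 : 0 ≤ M := (abs_nonneg _).trans (hM 0)
  obtain ⟨A, hA⟩ : ∃ A, ∀ t, ‖χ t ^ 2‖ ≤ A := by
    exact hc.exists_bound_of_continuous (hχ.pow 2)
  set θ : ℝ → ℝ := ⇑(unitBump ℝ) with hθ
  have hθd : ContDiff ℝ ∞ θ := (unitBump ℝ).contDiff
  have hθ1 : ∀ t, |t| ≤ 1 → θ t = 1 := fun t ht =>
    (unitBump ℝ).one_of_mem_closedBall (by simpa [unitBump] using ht)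
  have hθ0 : ∀ t, 2 ≤ |t| → θ t = 0 := fun t ht =>
    (unitBump ℝ).zero_of_le_dist (by simpa [unitBump] using ht)
  have hθb : ∀ t, |θ t| ≤ 1 := fun t => by
    rw [abs_of_nonneg (unitBump ℝ).nonneg]; exact (unitBump ℝ).le_one
  obtain ⟨L, hL⟩ : ∃ L, ∀ t, ‖deriv θ t‖ ≤ L :=
    ((unitBump ℝ).hasCompactSupport.deriv).exists_bound_of_continuous
      (hθd.continuous_deriv (by simp))
  have hL0 : 0 ≤ L := (norm_nonneg _).trans (hL 0)
  have hθ'0 : ∀ t, 2 < |t| → deriv θ t = 0 := fun t ht => by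
    have : θ =ᶠ[𝓝 t] fun _ => 0 := by
      filter_upwards [(isOpen_lt continuous_const continuous_abs).mem_nhds ht] with s hs
      exact hθ0 s (le_of_lt hs)
    rw [this.deriv_eq, deriv_const]
  refine ⟨4 * M * (2 * ν + 1 + 4 * L), by positivity, fun a N ha hN F => ?_⟩
  have hN0 : 0 < N := by linarith
  set k : ℝ → ℝ := fun r => N⁻¹ * (H (N * (r - a)) * θ (4 * (r - a))) with hk
  have hkd : ∀ r, HasDerivAt k (χ (N * (r - a)) ^ 2 +
      4 * N⁻¹ * (H (N * (r - a)) * deriv θ (4 * (r - a)))) r := fun r => by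
    have e1 : HasDerivAt (fun r => N * (r - a)) N r := by
      simpa using ((hasDerivAt_id r).sub_const a).const_mul N
    have e2 : HasDerivAt (fun r => 4 * (r - a)) 4 r := by
      simpa using ((hasDerivAt_id r).sub_const a).const_mul (4 : ℝ)
    have e3 : HasDerivAt θ (deriv θ (4 * (r - a))) (4 * (r - a)) :=
      (hθd.differentiable (by simp) _).hasDerivAt
    refine ((((hHd _).comp r e1).mul (e3.comp r e2)).const_mul N⁻¹).congr_deriv ?_
    have e4 : χ (N * (r - a)) ^ 2 * θ (4 * (r - a)) = χ (N * (r - a)) ^ 2 := by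
      rcases le_or_gt |N * (r - a)| 1 with h | h
      · rw [hθ1, mul_one]
        rw [abs_mul, abs_of_pos hN0] at h
        rw [abs_mul, abs_of_pos (by norm_num : (0 : ℝ) < 4)]
        nlinarith [abs_nonneg (r - a)]
      · rw [hs _ h]; ring
    have e5 : N⁻¹ * N = 1 := inv_mul_cancel₀ hN0.ne'
    simp only [Function.comp_apply]
    linear_combination (χ (N * (r - a)) ^ 2 * θ (4 * (r - a))) * e5 + e4
  have hk0 : ∀ r, 1 / 2 ≤ |r - a| → k r = 0 := fun r hr => by
    have : θ (4 * (r - a)) = 0 := hθ0 _ (by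
      rw [abs_mul, abs_of_pos (by norm_num : (0 : ℝ) < 4)]; linarith)
    simp only [hk, this, mul_zero]
  have hkM : ∀ r, |k r| ≤ N⁻¹ * M := fun r => by
    rw [hk, abs_mul, abs_mul, abs_of_pos (inv_pos.2 hN0)]
    refine mul_le_mul_of_nonneg_left ?_ (inv_pos.2 hN0).le
    exact (mul_le_mul (hM _) (hθb _) (abs_nonneg _) hM0).trans_eq (mul_one M)
  have hHθ : ∀ r, |4 * N⁻¹ * (H (N * (r - a)) * deriv θ (4 * (r - a)))| ≤ 4 * N⁻¹ * (M * L) :=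
    fun r => by
    rw [abs_mul (4 * N⁻¹), abs_mul (H _), abs_of_pos (by positivity : 0 < 4 * N⁻¹)]
    exact mul_le_mul_of_nonneg_left (mul_le_mul (hM _) (hL _) (abs_nonneg _) hM0) (by positivity)
  obtain ⟨hi, h0⟩ := integral_radial (ν := ν) (k := k) (c := 1) (R := a + 1)
    (M := max (N⁻¹ * M) (A + 4 * N⁻¹ * (M * L))) one_pos
    (fun r _ => (hkd r).differentiableAt)
    (fun r hr => hk0 r (by rw [abs_sub_comm]; exact le_trans (by linarith) (le_abs_self _)))
    (fun r hr => hk0 r (le_trans (by linarith) (le_abs_self _)))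
    (fun r => (hkM r).trans (le_max_left _ _))
    (fun r => by
      rw [(hkd r).deriv]
      exact ((abs_add_le _ _).trans (add_le_add (hA _) (hHθ r))).trans (le_max_right _ _))
    (integrable_mul_conj F F)
    (integrable_lineDeriv_mul_conj F F)
    (hasLineDerivAt_mul_conj F F)
  set I : X ν → ℂ := fun x => ((ν * k ‖x‖ + ‖x‖ * deriv k ‖x‖ : ℝ) : ℂ) * (F x * conj (F x)) +
      (k ‖x‖ : ℂ) * ∑ j, (x j : ℂ) * (∂_{basisVec j} F x * conj (F x) +
        F x * conj (∂_{basisVec j} F x)) with hI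
  set B : ℝ := N⁻¹ * M * (a + 1) * (2 * ν + 1 + 4 * L) with hB
  -- The integral of `I` is zero, and on the shell `I` is `|x| χ² |F|²` plus an error controlled by
  -- the energy density. Since `a ≥ 2`, the shell satisfies `|x| ≥ a/2`, and the factor `a + 1` in
  -- `B` is at most `2a`; dividing by `a/2` leaves a constant independent of `a`.
  have hpt : ∀ x, (a / 2) * (χ (N * (‖x‖ - a)) ^ 2 * ‖F x‖ ^ 2) ≤
      (I x).re + B * (shell ν a).indicator (energyDensity F) x := fun x => by
    have hE := energyDensity_nonneg F x
    have hq : ∀ j : Fin ν, ‖(∂_{basisVec j} F : 𝓢(X ν, ℂ)) x * conj (F x) +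
        F x * conj ((∂_{basisVec j} F : 𝓢(X ν, ℂ)) x)‖ ≤
        ‖F x‖ ^ 2 + ‖(∂_{basisVec j} F : 𝓢(X ν, ℂ)) x‖ ^ 2 := fun j => by
      refine (norm_add_le _ _).trans ?_
      rw [norm_mul, norm_mul, RCLike.norm_conj, RCLike.norm_conj]
      nlinarith [sq_nonneg (‖F x‖ - ‖(∂_{basisVec j} F : 𝓢(X ν, ℂ)) x‖)]
    by_cases hx : x ∈ shell ν a
    · rw [Set.indicator_of_mem hx]
      have hx1 : ‖x‖ ≤ a + 1 := by
        have := (abs_le.1 (show |‖x‖ - a| ≤ 1 from hx)).2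
        linarith
      set R : ℂ := ((ν * k ‖x‖ + ‖x‖ * (4 * N⁻¹ * (H (N * (‖x‖ - a)) *
        deriv θ (4 * (‖x‖ - a)))) : ℝ) : ℂ) * (F x * conj (F x)) +
        (k ‖x‖ : ℂ) * ∑ j, (x j : ℂ) * (∂_{basisVec j} F x * conj (F x) +
        F x * conj (∂_{basisVec j} F x)) with hR
      have hIR : I x = ((‖x‖ * (χ (N * (‖x‖ - a)) ^ 2 * ‖F x‖ ^ 2) : ℝ) : ℂ) + R := by
        rw [hI, hR]
        simp only [(hkd ‖x‖).deriv]
        rw [Complex.mul_conj, Complex.normSq_eq_norm_sq]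
        push_cast
        ring
      have hRn : ‖R‖ ≤ B * energyDensity F x := by
        have h1 : ‖((ν * k ‖x‖ + ‖x‖ * (4 * N⁻¹ * (H (N * (‖x‖ - a)) *
            deriv θ (4 * (‖x‖ - a)))) : ℝ) : ℂ)‖ ≤ N⁻¹ * M * (a + 1) * (ν + 4 * L) := by
          rw [Complex.norm_real, Real.norm_eq_abs]
          refine (abs_add_le _ _).trans ?_
          rw [abs_mul (ν : ℝ), abs_mul ‖x‖, Nat.abs_cast, abs_norm]
          calc _ ≤ ν * (N⁻¹ * M) + (a + 1) * (4 * N⁻¹ * (M * L)) :=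
                add_le_add (mul_le_mul_of_nonneg_left (hkM _) (Nat.cast_nonneg _))
                  (mul_le_mul hx1 (hHθ _) (abs_nonneg _) (by linarith))
            _ ≤ _ := by
                have : 0 ≤ ν * (N⁻¹ * M) := by positivity
                nlinarith
        have h2 : ‖(k ‖x‖ : ℂ) * ∑ j, (x j : ℂ) * (∂_{basisVec j} F x * conj (F x) +
            F x * conj (∂_{basisVec j} F x))‖ ≤ N⁻¹ * M * ((a + 1) *
            ∑ j : Fin ν, (‖F x‖ ^ 2 + ‖(∂_{basisVec j} F : 𝓢(X ν, ℂ)) x‖ ^ 2)) := by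
          rw [norm_mul, Complex.norm_real, Finset.mul_sum]
          refine mul_le_mul (hkM _) ((norm_sum_le _ _).trans (Finset.sum_le_sum fun j _ => ?_))
            (norm_nonneg _) (by positivity)
          rw [norm_mul, Complex.norm_real]
          exact mul_le_mul ((PiLp.norm_apply_le x j).trans hx1) (hq j) (norm_nonneg _)
            (by linarith)
        rw [Finset.sum_add_distrib, Finset.sum_const, Finset.card_univ, Fintype.card_fin,
          nsmul_eq_mul] at h2
        refine (norm_add_le _ _).trans ((add_le_add (norm_mul_le_of_le h1 (le_refl _)) h2).trans ?_)
        rw [norm_mul, RCLike.norm_conj, hB]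
        have h3 : 0 ≤ ∑ j : Fin ν, ‖(∂_{basisVec j} F : 𝓢(X ν, ℂ)) x‖ ^ 2 := by positivity
        have h4 : (ν + 4 * L) * ‖F x‖ ^ 2 + (ν * ‖F x‖ ^ 2 +
            ∑ j : Fin ν, ‖(∂_{basisVec j} F : 𝓢(X ν, ℂ)) x‖ ^ 2) ≤
            (2 * ν + 1 + 4 * L) * energyDensity F x := by
          unfold energyDensity
          have : 0 ≤ (2 * ν + 4 * L) * ∑ j : Fin ν, ‖(∂_{basisVec j} F : 𝓢(X ν, ℂ)) x‖ ^ 2 := by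
            positivity
          nlinarith [sq_nonneg ‖F x‖]
        have h5 := mul_le_mul_of_nonneg_left h4 (by positivity : 0 ≤ N⁻¹ * M * (a + 1))
        nlinarith
      rw [hIR, Complex.add_re, Complex.ofReal_re]
      have h6 := (abs_le.1 ((Complex.abs_re_le_norm R).trans hRn)).1
      have h7 : a / 2 * (χ (N * (‖x‖ - a)) ^ 2 * ‖F x‖ ^ 2) ≤
          ‖x‖ * (χ (N * (‖x‖ - a)) ^ 2 * ‖F x‖ ^ 2) := by
        refine mul_le_mul_of_nonneg_right ?_ (by positivity)
        have := (abs_le.1 (show |‖x‖ - a| ≤ 1 from hx)).1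
        linarith
      linarith
    · have hx' : 1 < |‖x‖ - a| := not_le.1 hx
      rw [Set.indicator_of_notMem hx]
      have h1 : χ (N * (‖x‖ - a)) = 0 := hs _ (by
        rw [abs_mul, abs_of_pos hN0]; nlinarith)
      have h2 : deriv θ (4 * (‖x‖ - a)) = 0 := hθ'0 _ (by
        rw [abs_mul, abs_of_pos (by norm_num : (0 : ℝ) < 4)]; linarith)
      rw [hI]
      simp only [(hkd ‖x‖).deriv, hk0 ‖x‖ (by linarith), h1, h2]
      simp
  have hint : ∫ x, (a / 2) * (χ (N * (‖x‖ - a)) ^ 2 * ‖F x‖ ^ 2) ≤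
      ∫ x, ((I x).re + B * (shell ν a).indicator (energyDensity F) x) := by
    refine integral_mono_of_nonneg (Eventually.of_forall fun x => by positivity)
      (hi.re.add (((integrable_energyDensity F).indicator (measurableSet_shell a)).const_mul B))
      (Eventually.of_forall hpt)
  have hre : ∫ x, (I x).re = 0 := by
    have := integral_re hi
    simp only [RCLike.re_to_complex] at this
    rw [this, h0, Complex.zero_re]
  have hire : Integrable fun x => (I x).re := hi.re
  rw [integral_const_mul, integral_add hire
    (((integrable_energyDensity F).indicator (measurableSet_shell a)).const_mul B),
    integral_const_mul, setIntegral_indicator_energyDensity] at hint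
  rw [hre, zero_add] at hint
  have hE := shellEnergy_nonneg a F
  have hfin : B * shellEnergy a F ≤ a / 2 * (4 * M * (2 * ν + 1 + 4 * L) * N⁻¹ * shellEnergy a F) := by
    rw [hB]
    have : N⁻¹ * M * (a + 1) * (2 * ν + 1 + 4 * L) ≤
        a / 2 * (4 * M * (2 * ν + 1 + 4 * L) * N⁻¹) := by
      have h1 : 0 ≤ N⁻¹ * M * (2 * ν + 1 + 4 * L) := by positivity
      nlinarith
    calc _ ≤ a / 2 * (4 * M * (2 * ν + 1 + 4 * L) * N⁻¹) * shellEnergy a F :=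
          mul_le_mul_of_nonneg_right this hE
      _ = _ := by ring
  exact le_of_mul_le_mul_left (hint.trans hfin) (by linarith)

end Shell

/-! ### The form of one oscillating shell. -/

section Form

open Filter Topology

variable {ν : ℕ} {χ : ℝ → ℝ}

/-- This is optimisation over `b`. Reading the hypothesis as nonnegativity of a quadratic polynomial
and taking its discriminant avoids dividing by `P` or `Q`, which may vanish. -/
theorem sq_le_of_forall_pos {K P Q Z : ℝ} (hK : 0 ≤ K) (hP : 0 ≤ P) (hQ : 0 ≤ Q) (hZ : 0 ≤ Z)
    (h : ∀ b : ℝ, 0 < b → Z ≤ K * (b * P + b⁻¹ * Q)) : Z ^ 2 ≤ 4 * K ^ 2 * P * Q := by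
  have h1 : discrim (K * P) (-Z) (K * Q) ≤ 0 := by
    refine discrim_le_zero fun x => ?_
    have h3 : 0 ≤ K * P * (x * x) := mul_nonneg (mul_nonneg hK hP) (mul_self_nonneg x)
    have h4 : 0 ≤ K * Q := mul_nonneg hK hQ
    rcases le_or_gt x 0 with hx | hx
    · nlinarith
    · have h2 := mul_le_mul_of_nonneg_left (h x hx) hx.le
      have h5 : x * (K * (x * P + x⁻¹ * Q)) = K * P * (x * x) + K * Q := by
        field_simp
      linarith
  rw [discrim] at h1
  nlinarith

theorem deriv_eq_zero_of_abs_gt (hs : ∀ t : ℝ, 1 < |t| → χ t = 0) {t : ℝ} (ht : 1 < |t|) :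
    deriv χ t = 0 := by
  have : χ =ᶠ[𝓝 t] fun _ => 0 := by
    filter_upwards [(isOpen_lt continuous_const continuous_abs).mem_nhds ht] with s h
    exact hs s h
  rw [this.deriv_eq, deriv_const]

/-- The form `∫ χ'(N (|x| - a)) F Ḡ` is controlled by the energies of `F` and `G` on the shell. -/
theorem exists_form_estimate (hν : 1 ≤ ν) (hχ : ContDiff ℝ 1 χ)
    (hs : ∀ t : ℝ, 1 < |t| → χ t = 0) :
    ∃ C : ℝ, 0 ≤ C ∧ ∀ (a N : ℝ), 2 ≤ a → 8 ≤ N → ∀ F G : 𝓢(X ν, ℂ),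
      ‖∫ x, ((deriv χ (N * (‖x‖ - a)) : ℝ) : ℂ) * (F x * conj (G x))‖ ^ 2 ≤
        C * N⁻¹ ^ 3 * shellEnergy a F * shellEnergy a G := by
  obtain ⟨C₁, hC₁, hsh⟩ := exists_shell_estimate (ν := ν) hχ.continuous hs
  obtain ⟨A, hA⟩ := (hasCompactSupport_of_abs_gt hs).exists_bound_of_continuous hχ.continuous
  obtain ⟨A', hA'⟩ := (hasCompactSupport_of_abs_gt hs).deriv.exists_bound_of_continuous
    (hχ.continuous_deriv le_rfl)
  have hA0 : 0 ≤ A := (norm_nonneg _).trans (hA 0)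
  have hA'0 : 0 ≤ A' := (norm_nonneg _).trans (hA' 0)
  refine ⟨4 * (ν * (1 + C₁)) ^ 2, by positivity, fun a N ha hN F G => ?_⟩
  have hN0 : 0 < N := by linarith
  have hEF := shellEnergy_nonneg a F
  have hEG := shellEnergy_nonneg a G
  -- With this profile, `k(|x|) x` is `N⁻¹ χ(N(|x|-a))` times the radial unit vector. Its divergence
  -- is `χ'(N(|x|-a))` plus a curvature term, which like the gradient terms carries `N⁻¹ χ`.
  set k : ℝ → ℝ := fun r => N⁻¹ * χ (N * (r - a)) * r⁻¹ with hk
  have hkd : ∀ r, 0 < r → HasDerivAt k (deriv χ (N * (r - a)) * r⁻¹ -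
      N⁻¹ * χ (N * (r - a)) * (r ^ 2)⁻¹) r := fun r hr => by
    have e1 : HasDerivAt (fun r => N * (r - a)) N r := by
      simpa using ((hasDerivAt_id r).sub_const a).const_mul N
    have e2 : HasDerivAt χ (deriv χ (N * (r - a))) (N * (r - a)) :=
      (hχ.differentiable one_ne_zero _).hasDerivAt
    refine (((e2.comp r e1).const_mul N⁻¹).mul (hasDerivAt_inv hr.ne')).congr_deriv ?_
    have e5 : N⁻¹ * N = 1 := inv_mul_cancel₀ hN0.ne'
    simp only [Function.comp_apply]
    linear_combination (deriv χ (N * (r - a)) * r⁻¹) * e5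
  have hout : ∀ r, 1 / 2 ≤ |r - a| → 1 < |N * (r - a)| := fun r hr => by
    rw [abs_mul, abs_of_pos hN0]; nlinarith
  have hlow : ∀ r, r ≤ 3 / 2 → 1 / 2 ≤ |r - a| := fun r hr => by
    rw [abs_sub_comm]; exact le_trans (by linarith) (le_abs_self _)
  have hk0 : ∀ r, 1 / 2 ≤ |r - a| → k r = 0 := fun r hr => by
    simp only [hk, hs _ (hout r hr), mul_zero, zero_mul]
  have hkM : ∀ r, |k r| ≤ A := fun r => by
    rcases le_or_gt r (3 / 2) with h | h
    · rw [hk0 r (hlow r h), abs_zero]; exact hA0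
    · rw [hk, abs_mul, abs_mul, abs_of_pos (inv_pos.2 hN0),
        abs_of_pos (inv_pos.2 (show 0 < r by linarith))]
      have h1 : N⁻¹ ≤ 1 := inv_le_one_of_one_le₀ (by linarith)
      have h2 : r⁻¹ ≤ 1 := inv_le_one_of_one_le₀ (by linarith)
      have h3 : 0 ≤ r⁻¹ := inv_nonneg.2 (by linarith)
      calc N⁻¹ * |χ (N * (r - a))| * r⁻¹ ≤ 1 * A * 1 := by
            gcongr
            exact hA _
        _ = A := by ring
  have hdk0 : ∀ r, r < 3 / 2 → deriv k r = 0 := fun r h => by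
    have : k =ᶠ[𝓝 r] fun _ => 0 := by
      filter_upwards [Iio_mem_nhds h] with s hs
      exact hk0 s (hlow s (le_of_lt hs))
    rw [this.deriv_eq, deriv_const]
  have hkM' : ∀ r, |deriv k r| ≤ A' + A := fun r => by
    rcases lt_or_ge r (3 / 2) with h | h
    · rw [hdk0 r h, abs_zero]
      positivity
    · rw [(hkd r (by linarith)).deriv]
      have h1 : N⁻¹ ≤ 1 := inv_le_one_of_one_le₀ (by linarith)
      have h2 : r⁻¹ ≤ 1 := inv_le_one_of_one_le₀ (by linarith)
      have h3 : 0 ≤ r⁻¹ := inv_nonneg.2 (by linarith)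
      have h4 : (r ^ 2)⁻¹ ≤ 1 := inv_le_one_of_one_le₀ (by nlinarith)
      have h5 : 0 ≤ (r ^ 2)⁻¹ := by positivity
      refine (abs_sub _ _).trans ?_
      rw [abs_mul, abs_mul, abs_mul, abs_of_pos (inv_pos.2 hN0), abs_of_nonneg h3, abs_of_nonneg h5]
      calc |deriv χ (N * (r - a))| * r⁻¹ + N⁻¹ * |χ (N * (r - a))| * (r ^ 2)⁻¹ ≤
            A' * 1 + 1 * A * 1 := by
            gcongr
            · exact hA' _
            · exact hA _
        _ = A' + A := by ring
  obtain ⟨hi, h0⟩ := integral_radial (ν := ν) (k := k) (c := 1) (R := a + 1)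
    (M := A' + A) one_pos (fun r hr => (hkd r hr).differentiableAt)
    (fun r hr => hk0 r (hlow r (by linarith)))
    (fun r hr => hk0 r (le_trans (by linarith) (le_abs_self _)))
    (fun r => (hkM r).trans (by linarith)) hkM'
    (integrable_mul_conj F G) (integrable_lineDeriv_mul_conj F G) (hasLineDerivAt_mul_conj F G)
  set I : X ν → ℂ := fun x => ((ν * k ‖x‖ + ‖x‖ * deriv k ‖x‖ : ℝ) : ℂ) * (F x * conj (G x)) +
      (k ‖x‖ : ℂ) * ∑ j, (x j : ℂ) * (∂_{basisVec j} F x * conj (G x) +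
        F x * conj (∂_{basisVec j} G x)) with hI
  set J : X ν → ℂ := fun x => ((deriv χ (N * (‖x‖ - a)) : ℝ) : ℂ) * (F x * conj (G x)) with hJ
  have hJi : Integrable J := by
    refine (integrable_mul_conj F G).bdd_mul (c := A') ?_ (Eventually.of_forall fun x => ?_)
    · exact (Complex.continuous_ofReal.comp ((hχ.continuous_deriv le_rfl).comp
        (by fun_prop))).aestronglyMeasurable
    · rw [Complex.norm_real]; exact hA' _
  have hpt : ∀ x, ‖J x - I x‖ ≤ N⁻¹ * (|χ (N * (‖x‖ - a))| * (ν * (‖F x‖ * ‖G x‖) +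
      ∑ j : Fin ν, (‖(∂_{basisVec j} F : 𝓢(X ν, ℂ)) x‖ * ‖G x‖ +
        ‖F x‖ * ‖(∂_{basisVec j} G : 𝓢(X ν, ℂ)) x‖))) := fun x => by
    rcases lt_or_ge ‖x‖ (3 / 2) with h | h
    · have h1 : J x = 0 := by
        simp only [hJ, deriv_eq_zero_of_abs_gt hs (hout _ (hlow _ h.le)), Complex.ofReal_zero,
          zero_mul]
      have h2 : I x = 0 := by
        simp only [hI, hdk0 _ h, hk0 _ (hlow _ h.le)]
        simp
      rw [h1, h2, sub_zero, norm_zero]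
      positivity
    · have hr0 : 0 < ‖x‖ := by linarith
      have h1 : ν * k ‖x‖ + ‖x‖ * deriv k ‖x‖ = deriv χ (N * (‖x‖ - a)) +
          (ν - 1) * (N⁻¹ * χ (N * (‖x‖ - a)) * ‖x‖⁻¹) := by
        rw [(hkd _ hr0).deriv, hk]
        field_simp
        ring
      have h2 : J x - I x = -((N⁻¹ * χ (N * (‖x‖ - a)) * ‖x‖⁻¹ : ℝ) : ℂ) *
          ((((ν : ℝ) - 1 : ℝ) : ℂ) * (F x * conj (G x)) +
          ∑ j, (x j : ℂ) * (∂_{basisVec j} F x * conj (G x) +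
            F x * conj (∂_{basisVec j} G x))) := by
        simp only [hI, hJ, h1]
        generalize deriv χ (N * (‖x‖ - a)) = d
        generalize ∑ j, (x j : ℂ) * (∂_{basisVec j} F x * conj (G x) +
            F x * conj (∂_{basisVec j} G x)) = S
        simp only [hk]
        push_cast
        ring
      have hν1 : (1 : ℝ) ≤ ν := by exact_mod_cast hν
      have h3 : ‖(((ν : ℝ) - 1 : ℝ) : ℂ) * (F x * conj (G x)) +
          ∑ j, (x j : ℂ) * (∂_{basisVec j} F x * conj (G x) +
            F x * conj (∂_{basisVec j} G x))‖ ≤ ‖x‖ * (ν * (‖F x‖ * ‖G x‖) +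
          ∑ j : Fin ν, (‖(∂_{basisVec j} F : 𝓢(X ν, ℂ)) x‖ * ‖G x‖ +
            ‖F x‖ * ‖(∂_{basisVec j} G : 𝓢(X ν, ℂ)) x‖)) := by
        rw [mul_add, Finset.mul_sum]
        refine (norm_add_le _ _).trans (add_le_add ?_
          ((norm_sum_le _ _).trans (Finset.sum_le_sum fun j _ => ?_)))
        · rw [norm_mul, norm_mul, RCLike.norm_conj, Complex.norm_real, Real.norm_eq_abs,
            abs_of_nonneg (by linarith), ← mul_assoc ‖x‖]
          exact mul_le_mul_of_nonneg_right (by nlinarith) (by positivity)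
        · rw [norm_mul, Complex.norm_real]
          refine mul_le_mul (PiLp.norm_apply_le x j) ((norm_add_le _ _).trans_eq ?_)
            (norm_nonneg _) (norm_nonneg _)
          rw [norm_mul, norm_mul, RCLike.norm_conj, RCLike.norm_conj]
      rw [h2, norm_mul, norm_neg, Complex.norm_real, Real.norm_eq_abs, abs_mul, abs_mul,
        abs_of_pos (inv_pos.2 hN0), abs_of_pos (inv_pos.2 hr0)]
      refine (mul_le_mul_of_nonneg_left h3 (by positivity)).trans_eq ?_
      field_simp
  -- The weights `p` and `p'` replace Cauchy–Schwarz: one factor of each product is estimated by the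
  -- energy on the shell, the other carries `χ` and gains a further `N⁻¹` from
  -- `exists_shell_estimate`.
  have hmain : ∀ p p' : ℝ, 0 < p → 0 < p' → ‖∫ x, J x‖ ≤
      N⁻¹ * ν * (p * shellEnergy a F + p⁻¹ * (C₁ * N⁻¹ * shellEnergy a G) +
        (p' * shellEnergy a G + p'⁻¹ * (C₁ * N⁻¹ * shellEnergy a F))) := fun p p' hp hp' => by
    have hci : ∀ F : 𝓢(X ν, ℂ), Integrable fun x => χ (N * (‖x‖ - a)) ^ 2 * ‖F x‖ ^ 2 :=
      fun F => by
      refine (integrable_norm_sq F).bdd_mul (c := A ^ 2) ?_ (Eventually.of_forall fun x => ?_)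
      · exact ((hχ.continuous.comp (by fun_prop)).pow 2).aestronglyMeasurable
      · rw [norm_pow]
        exact pow_le_pow_left₀ (norm_nonneg _) (hA _) 2
    have hdi : ∀ F : 𝓢(X ν, ℂ), Integrable ((shell ν a).indicator (energyDensity F)) :=
      fun F => (integrable_energyDensity F).indicator (measurableSet_shell a)
    have i1 : ∀ (F G : 𝓢(X ν, ℂ)) (p : ℝ), Integrable fun x =>
        p * (shell ν a).indicator (energyDensity F) x +
          p⁻¹ * (χ (N * (‖x‖ - a)) ^ 2 * ‖G x‖ ^ 2) := fun F G p =>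
      ((hdi F).const_mul p).add ((hci G).const_mul p⁻¹)
    have e1 : ∀ (F G : 𝓢(X ν, ℂ)) (p : ℝ), 0 < p → ∫ x, (p * (shell ν a).indicator (energyDensity F) x +
          p⁻¹ * (χ (N * (‖x‖ - a)) ^ 2 * ‖G x‖ ^ 2)) ≤
        p * shellEnergy a F + p⁻¹ * (C₁ * N⁻¹ * shellEnergy a G) := fun F G p hp => by
      rw [integral_add ((hdi F).const_mul p) ((hci G).const_mul p⁻¹), integral_const_mul,
        integral_const_mul, setIntegral_indicator_energyDensity]
      gcongr
      exact hsh a N ha hN G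
    have hJI : ∫ x, J x = ∫ x, (J x - I x) := by
      rw [integral_sub hJi hi, h0, sub_zero]
    rw [hJI]
    have i2 : Integrable fun x => N⁻¹ * ν * ((p * (shell ν a).indicator (energyDensity F) x +
          p⁻¹ * (χ (N * (‖x‖ - a)) ^ 2 * ‖G x‖ ^ 2)) +
          (p' * (shell ν a).indicator (energyDensity G) x +
          p'⁻¹ * (χ (N * (‖x‖ - a)) ^ 2 * ‖F x‖ ^ 2))) :=
      ((i1 F G p).add (i1 G F p')).const_mul _
    refine (norm_integral_le_of_norm_le i2 (Eventually.of_forall fun x => (hpt x).trans ?_)).trans ?_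
    · rw [mul_assoc N⁻¹]
      refine mul_le_mul_of_nonneg_left ?_ (inv_pos.2 hN0).le
      by_cases hx : x ∈ shell ν a
      · rw [Set.indicator_of_mem hx, Set.indicator_of_mem hx]
        have hν1 : (1 : ℝ) ≤ ν := by exact_mod_cast hν
        have young : ∀ q y z : ℝ, 0 < q → |χ (N * (‖x‖ - a))| * (y * z) ≤
            (q * y ^ 2 + q⁻¹ * (χ (N * (‖x‖ - a)) ^ 2 * z ^ 2)) / 2 := fun q y z hq => by
          have h1 := sq_nonneg (q * y - |χ (N * (‖x‖ - a))| * z)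
          have h2 : (q * y ^ 2 + q⁻¹ * (χ (N * (‖x‖ - a)) ^ 2 * z ^ 2)) / 2 -
              |χ (N * (‖x‖ - a))| * (y * z) =
              q⁻¹ / 2 * (q * y - |χ (N * (‖x‖ - a))| * z) ^ 2 := by
            rw [← sq_abs (χ (N * (‖x‖ - a)))]
            field_simp
            ring
          have h3 : 0 ≤ q⁻¹ / 2 * (q * y - |χ (N * (‖x‖ - a))| * z) ^ 2 := by positivity
          linarith
        have hS : |χ (N * (‖x‖ - a))| * (ν * (‖F x‖ * ‖G x‖) +
            ∑ j : Fin ν, (‖(∂_{basisVec j} F : 𝓢(X ν, ℂ)) x‖ * ‖G x‖ +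
            ‖F x‖ * ‖(∂_{basisVec j} G : 𝓢(X ν, ℂ)) x‖)) ≤
            ν * ((p * ‖F x‖ ^ 2 + p⁻¹ * (χ (N * (‖x‖ - a)) ^ 2 * ‖G x‖ ^ 2)) / 2) +
            ∑ j : Fin ν, ((p * ‖(∂_{basisVec j} F : 𝓢(X ν, ℂ)) x‖ ^ 2 +
              p⁻¹ * (χ (N * (‖x‖ - a)) ^ 2 * ‖G x‖ ^ 2)) / 2 +
              (p' * ‖(∂_{basisVec j} G : 𝓢(X ν, ℂ)) x‖ ^ 2 +
              p'⁻¹ * (χ (N * (‖x‖ - a)) ^ 2 * ‖F x‖ ^ 2)) / 2) := by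
          rw [mul_add, Finset.mul_sum]
          refine add_le_add ?_ (Finset.sum_le_sum fun j _ => ?_)
          · rw [mul_left_comm]
            exact mul_le_mul_of_nonneg_left (young p _ _ hp) (Nat.cast_nonneg _)
          · rw [mul_add]
            refine add_le_add (young p _ _ hp) ?_
            rw [mul_comm ‖F x‖]
            exact young p' _ _ hp'
        refine hS.trans ?_
        simp only [add_div, Finset.sum_add_distrib, Finset.sum_const, Finset.card_univ,
          Fintype.card_fin, nsmul_eq_mul, ← Finset.sum_div, ← Finset.mul_sum, energyDensity]
        have q1 : 0 ≤ p * ∑ j : Fin ν, ‖(∂_{basisVec j} F : 𝓢(X ν, ℂ)) x‖ ^ 2 := by positivity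
        have q2 : 0 ≤ p' * ∑ j : Fin ν, ‖(∂_{basisVec j} G : 𝓢(X ν, ℂ)) x‖ ^ 2 := by positivity
        have q3 : 0 ≤ ν * (p * ‖F x‖ ^ 2) := by positivity
        have q4 : 0 ≤ ν * (p' * ‖G x‖ ^ 2) := by positivity
        have q5 : 0 ≤ ν * (p'⁻¹ * (χ (N * (‖x‖ - a)) ^ 2 * ‖F x‖ ^ 2)) := by positivity
        nlinarith
      · rw [Set.indicator_of_notMem hx, Set.indicator_of_notMem hx]
        have hx' : 1 < |‖x‖ - a| := not_le.1 hx
        rw [hs _ (hout _ (by linarith))]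
        simp
    · rw [integral_const_mul, integral_add (i1 F G p) (i1 G F p')]
      exact mul_le_mul_of_nonneg_left (add_le_add (e1 F G p hp) (e1 G F p' hp')) (by positivity)
  obtain ⟨σ, hσ0, hσ⟩ : ∃ σ : ℝ, 0 < σ ∧ N⁻¹ = σ * σ :=
    ⟨Real.sqrt N⁻¹, Real.sqrt_pos.2 (inv_pos.2 hN0), (Real.mul_self_sqrt (inv_pos.2 hN0).le).symm⟩
  -- With `p = bσ` and `p' = b⁻¹σ`, where `σ² = N⁻¹`, all four terms combine into `σ (1 + C₁)(b E_F
  -- + b⁻¹ E_G)`. Thus the form is of order `N⁻¹ σ = N^{-3/2}`.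
  have := sq_le_of_forall_pos (K := N⁻¹ * ν * (1 + C₁) * σ) (by positivity)
    hEF hEG (norm_nonneg (∫ x, J x)) (fun b hb => by
      refine (hmain (b * σ) (b⁻¹ * σ) (by positivity) (by positivity)).trans_eq ?_
      rw [hσ]
      field_simp
      ring)
  refine this.trans_eq ?_
  linear_combination -(4 * N⁻¹ ^ 2 * ν ^ 2 * (1 + C₁) ^ 2 * shellEnergy a F * shellEnergy a G) * hσ

end Form

/-! ### The potential as a norm-convergent series of operators. -/

section Multiplication

open Filter Topology

variable {ν : ℕ} {χ : ℝ → ℝ}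

theorem eight_le_rpow (hν : 3 ≤ ν) {n : ℕ} (hn : 2 ≤ n) :
    (8 : ℝ) ≤ (n : ℝ) ^ (3 * (ν : ℝ) / 2) := by
  have h2 : (2 : ℝ) ≤ n := by exact_mod_cast hn
  have h3 : (3 : ℝ) ≤ ν := by exact_mod_cast hν
  calc (8 : ℝ) = 2 ^ 3 := by norm_num
    _ ≤ (n : ℝ) ^ 3 := by gcongr
    _ = (n : ℝ) ^ (3 : ℝ) := by norm_cast
    _ ≤ _ := Real.rpow_le_rpow_of_exponent_le (by linarith) (by linarith)

theorem abs_norm_sub_le_of_potentialTerm_ne_zero (hν : 3 ≤ ν) (hs : ∀ t : ℝ, 1 < |t| → χ t = 0)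
    {n : ℕ} (hn : 2 ≤ n) {x : X ν} (hx : potentialTerm ν χ n x ≠ 0) : |‖x‖ - n| ≤ 1 / 8 := by
  by_contra h
  refine hx ?_
  rw [potentialTerm, deriv_eq_zero_of_abs_gt hs, mul_zero]
  have h8 := eight_le_rpow hν hn
  rw [abs_mul, abs_of_pos (by linarith)]
  nlinarith [not_le.1 h]

theorem finite_potentialTerm_ne_zero (hν : 3 ≤ ν) (hs : ∀ t : ℝ, 1 < |t| → χ t = 0) (x : X ν) :
    {n : Set.Ici (2 : ℕ) | potentialTerm ν χ n x ≠ 0}.Finite := by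
  refine Set.Finite.of_finite_image (f := Subtype.val)
    ((Set.finite_Iic (⌈‖x‖ + 1⌉₊)).subset ?_) Subtype.val_injective.injOn
  rintro _ ⟨n, hn, rfl⟩
  have h := (abs_le.1 (abs_norm_sub_le_of_potentialTerm_ne_zero hν hs n.2 hn)).1
  exact_mod_cast (show ((n : ℕ) : ℝ) ≤ ⌈‖x‖ + 1⌉₊ from le_trans (by linarith) (Nat.le_ceil _))

theorem continuous_potentialTerm (hχ : ContDiff ℝ 1 χ) (n : ℕ) :
    Continuous (potentialTerm ν χ n) :=
  continuous_const.mul ((hχ.continuous_deriv le_rfl).comp (by fun_prop))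

theorem exists_bound_potentialTerm (hχ : ContDiff ℝ 1 χ) (hs : ∀ t : ℝ, 1 < |t| → χ t = 0) (n : ℕ) :
    ∃ C, ∀ x : X ν, ‖((potentialTerm ν χ n x : ℝ) : ℂ)‖ ≤ C := by
  obtain ⟨A, hA⟩ := (hasCompactSupport_of_abs_gt hs).deriv.exists_bound_of_continuous
    (hχ.continuous_deriv le_rfl)
  refine ⟨|(n : ℝ) ^ ((3 * (ν : ℝ) - 1) / 2)| * A, fun x => ?_⟩
  rw [Complex.norm_real, potentialTerm, norm_mul]
  exact mul_le_mul_of_nonneg_left (hA _) (abs_nonneg _)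

theorem memLp_potentialTerm (hχ : ContDiff ℝ 1 χ) (hs : ∀ t : ℝ, 1 < |t| → χ t = 0) (n : ℕ) :
    MemLp (fun x : X ν => ((potentialTerm ν χ n x : ℝ) : ℂ)) ⊤ volume := by
  obtain ⟨C, hC⟩ := exists_bound_potentialTerm (ν := ν) hχ hs n
  exact memLp_top_of_bound (Complex.continuous_ofReal.comp
    (continuous_potentialTerm hχ n)).aestronglyMeasurable C (Eventually.of_forall hC)

/-- The embedding of `L²` in `H⁻¹`. -/
def L2.toHneg1 (ν : ℕ) : L2 ν →L[ℂ] Hneg1 ν :=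
  ContinuousLinearMap.precomp ℂ (H1.toL2CLM ν) ∘L innerSLFlip ℂ

/-- The operator of multiplication by a bounded function, from `H¹` to `H⁻¹`. -/
def mulOp (m : X ν → ℂ) (hm : MemLp m ⊤ volume) : H1 ν →L[ℂ] Hneg1 ν :=
  L2.toHneg1 ν ∘L mulL2 m hm ∘L H1.toL2CLM ν

theorem mulOp_apply (m : X ν → ℂ) (hm : MemLp m ⊤ volume) (f g : H1 ν) :
    mulOp m hm f g = inner ℂ g.toL2 (mulL2 m hm f.toL2) := rfl

theorem mulOp_toH1 (m : X ν → ℂ) (hm : MemLp m ⊤ volume) (φ ψ : 𝓢(X ν, ℂ)) :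
    mulOp m hm (toH1 φ) (toH1 ψ) = ∫ x, m x * (φ x * conj (ψ x)) := by
  rw [mulOp_apply, L2.inner_def, toH1_toL2, toH1_toL2]
  refine integral_congr_ae ?_
  filter_upwards [coeFn_mulL2 m hm (φ.toLp 2 volume), φ.coeFn_toLp 2 volume,
    ψ.coeFn_toLp 2 volume] with x h1 h2 h3
  rw [h1, h2, h3, RCLike.inner_apply]
  ring

theorem norm_le_of_forall_momentumCore (T : H1 ν →L[ℂ] Hneg1 ν) {K : ℝ} (hK : 0 ≤ K)
    (h : ∀ φ ∈ momentumCore ν, ∀ ψ ∈ momentumCore ν,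
      ‖T (toH1 φ) (toH1 ψ)‖ ≤ K * ‖toH1 φ‖ * ‖toH1 ψ‖) : ‖T‖ ≤ K := by
  refine T.opNorm_le_bound₂ hK fun f g => ?_
  have hd := dense_toH1_momentumCore (ν := ν)
  have h1 : ∀ ψ ∈ momentumCore ν, ∀ f, ‖T f (toH1 ψ)‖ ≤ K * ‖f‖ * ‖toH1 ψ‖ := fun ψ hψ f => by
    refine hd.induction (P := fun f => ‖T f (toH1 ψ)‖ ≤ K * ‖f‖ * ‖toH1 ψ‖) ?_ ?_ f
    · rintro _ ⟨φ, hφ, rfl⟩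
      exact h φ hφ ψ hψ
    · exact isClosed_le (by fun_prop) (by fun_prop)
  refine hd.induction (P := fun g => ‖T f g‖ ≤ K * ‖f‖ * ‖g‖) ?_ ?_ g
  · rintro _ ⟨ψ, hψ, rfl⟩
    exact h1 ψ hψ f
  · exact isClosed_le (by fun_prop) (by fun_prop)

/-- The form of a single term of the potential is controlled by the energies on its shell. -/
theorem exists_potentialTerm_estimate (hν : 3 ≤ ν) (hχ : ContDiff ℝ 1 χ)
    (hs : ∀ t : ℝ, 1 < |t| → χ t = 0) :
    ∃ C : ℝ, 0 ≤ C ∧ ∀ n : ℕ, 2 ≤ n → ∀ F G : 𝓢(X ν, ℂ),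
      ‖∫ x, ((potentialTerm ν χ n x : ℝ) : ℂ) * (F x * conj (G x))‖ ^ 2 ≤
        (C * (n : ℝ) ^ (-(11 / 4) : ℝ)) ^ 2 * shellEnergy n F * shellEnergy n G := by
  obtain ⟨C, hC0, hC⟩ := exists_form_estimate (ν := ν) (by omega) hχ hs
  refine ⟨Real.sqrt C, Real.sqrt_nonneg _, fun n hn F G => ?_⟩
  have h2 : (2 : ℝ) ≤ n := by exact_mod_cast hn
  have h3 : (3 : ℝ) ≤ ν := by exact_mod_cast hν
  have hn0 : (0 : ℝ) < n := by linarith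
  have h := hC n ((n : ℝ) ^ (3 * (ν : ℝ) / 2)) h2 (eight_le_rpow hν hn) F G
  have e1 : ∫ x, ((potentialTerm ν χ n x : ℝ) : ℂ) * (F x * conj (G x)) =
      (((n : ℝ) ^ ((3 * (ν : ℝ) - 1) / 2) : ℝ) : ℂ) *
      ∫ x, ((deriv χ ((n : ℝ) ^ (3 * (ν : ℝ) / 2) * (‖x‖ - n)) : ℝ) : ℂ) * (F x * conj (G x)) := by
    rw [← integral_const_mul]
    refine integral_congr_ae (Eventually.of_forall fun x => ?_)
    simp only [potentialTerm]
    push_cast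
    ring
  rw [e1, norm_mul, mul_pow, Complex.norm_real, Real.norm_eq_abs, sq_abs]
  -- The exponent is `(3ν - 1) - 9ν/2 = -3ν/2 - 1`, at most `-11/2` when `ν ≥ 3`.
  have e2 : ((n : ℝ) ^ ((3 * (ν : ℝ) - 1) / 2)) ^ 2 * ((n : ℝ) ^ (3 * (ν : ℝ) / 2))⁻¹ ^ 3 ≤
      ((n : ℝ) ^ (-(11 / 4) : ℝ)) ^ 2 := by
    rw [← Real.rpow_neg hn0.le, ← Real.rpow_mul_natCast hn0.le, ← Real.rpow_mul_natCast hn0.le,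
      ← Real.rpow_mul_natCast hn0.le, ← Real.rpow_add hn0]
    refine Real.rpow_le_rpow_of_exponent_le (by linarith) ?_
    push_cast
    linarith
  have hE : 0 ≤ C * (shellEnergy n F * shellEnergy n G) :=
    mul_nonneg hC0 (mul_nonneg (shellEnergy_nonneg _ _) (shellEnergy_nonneg _ _))
  calc _ ≤ ((n : ℝ) ^ ((3 * (ν : ℝ) - 1) / 2)) ^ 2 * (C * ((n : ℝ) ^ (3 * (ν : ℝ) / 2))⁻¹ ^ 3 *
        shellEnergy n F * shellEnergy n G) := mul_le_mul_of_nonneg_left h (by positivity)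
    _ = (((n : ℝ) ^ ((3 * (ν : ℝ) - 1) / 2)) ^ 2 * ((n : ℝ) ^ (3 * (ν : ℝ) / 2))⁻¹ ^ 3) *
        (C * (shellEnergy n F * shellEnergy n G)) := by ring
    _ ≤ ((n : ℝ) ^ (-(11 / 4) : ℝ)) ^ 2 * (C * (shellEnergy n F * shellEnergy n G)) :=
        mul_le_mul_of_nonneg_right e2 hE
    _ = _ := by rw [mul_pow, Real.sq_sqrt hC0]; ring

/-- Multiplication by a single term of the potential, from `H¹` to `H⁻¹`. -/
def termOp (ν : ℕ) (hχ : ContDiff ℝ 1 χ) (hs : ∀ t : ℝ, 1 < |t| → χ t = 0) (n : ℕ) :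
    H1 ν →L[ℂ] Hneg1 ν := mulOp _ (memLp_potentialTerm (ν := ν) hχ hs n)

theorem exists_norm_termOp_le (hν : 3 ≤ ν) (hχ : ContDiff ℝ 1 χ)
    (hs : ∀ t : ℝ, 1 < |t| → χ t = 0) :
    ∃ C : ℝ, 0 ≤ C ∧ ∀ n : ℕ, 2 ≤ n → ‖termOp ν hχ hs n‖ ≤ C * (n : ℝ) ^ (-(11 / 4) : ℝ) := by
  obtain ⟨C, hC0, hC⟩ := exists_potentialTerm_estimate hν hχ hs
  refine ⟨C, hC0, fun n hn => ?_⟩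
  have hr : 0 ≤ C * (n : ℝ) ^ (-(11 / 4) : ℝ) := mul_nonneg hC0 (by positivity)
  refine norm_le_of_forall_momentumCore _ hr fun φ _ ψ _ => ?_
  rw [termOp, mulOp_toH1]
  refine le_of_sq_le_sq ((hC n hn φ ψ).trans ?_) (by positivity)
  calc _ ≤ (C * (n : ℝ) ^ (-(11 / 4) : ℝ)) ^ 2 * ‖toH1 φ‖ ^ 2 * ‖toH1 ψ‖ ^ 2 :=
        mul_le_mul (mul_le_mul_of_nonneg_left (shellEnergy_le _ _) (sq_nonneg _))
          (shellEnergy_le _ _) (shellEnergy_nonneg _ _) (by positivity)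
    _ = _ := by ring

theorem summable_rpow_Ici {p : ℝ} (hp : p < -1) (C : ℝ) :
    Summable fun n : Set.Ici (2 : ℕ) => C * ((n : ℕ) : ℝ) ^ p :=
  ((Real.summable_nat_rpow.2 hp).mul_left C).subtype _

theorem summable_of_norm_le {E ι : Type*} [NormedAddCommGroup E] [CompleteSpace E] (f : ι → E)
    (g : ι → ℝ) (hg : Summable g) (h : ∀ n, ‖f n‖ ≤ g n) : Summable f :=
  Summable.of_norm_bounded hg h

theorem summable_termOp (hν : 3 ≤ ν) (hχ : ContDiff ℝ 1 χ) (hs : ∀ t : ℝ, 1 < |t| → χ t = 0) :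
    Summable fun n : Set.Ici (2 : ℕ) => termOp ν hχ hs n := by
  obtain ⟨C, hC0, hC⟩ := exists_norm_termOp_le hν hχ hs
  have h : ∀ n : Set.Ici (2 : ℕ),
      ‖termOp ν hχ hs n‖ ≤ C * ((n : ℕ) : ℝ) ^ (-(11 / 4) : ℝ) := fun n => hC n n.2
  have h' := summable_rpow_Ici (p := (-(11 / 4) : ℝ)) (by norm_num) C
  exact summable_of_norm_le (fun n : Set.Ici (2 : ℕ) => termOp ν hχ hs n) (fun n : Set.Ici (2 : ℕ) => C * ((n : ℕ) : ℝ) ^ (-(11 / 4) : ℝ)) h' h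

/-- Multiplication by the potential, from `H¹` to `H⁻¹`. -/
def potentialOp (ν : ℕ) (hχ : ContDiff ℝ 1 χ) (hs : ∀ t : ℝ, 1 < |t| → χ t = 0) :
    H1 ν →L[ℂ] Hneg1 ν := ∑' n : Set.Ici (2 : ℕ), termOp ν hχ hs n

theorem potentialOp_apply (hν : 3 ≤ ν) (hχ : ContDiff ℝ 1 χ) (hs : ∀ t : ℝ, 1 < |t| → χ t = 0)
    (f g : H1 ν) : potentialOp ν hχ hs f g = ∑' n : Set.Ici (2 : ℕ), termOp ν hχ hs n f g := by
  have h1 := (summable_termOp hν hχ hs).hasSum.mapL (ContinuousLinearMap.apply ℂ (Hneg1 ν) f)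
  have h2 := h1.mapL (ContinuousLinearMap.apply' ℂ (starRingEnd ℂ) g)
  exact h2.tsum_eq.symm

/-- Only finitely many shells meet the support of a test function, so on test functions the series
is a finite sum and commutes with the integral. -/
theorem isMultiplicationBy_potentialOp (hν : 3 ≤ ν) (hχ : ContDiff ℝ 1 χ)
    (hs : ∀ t : ℝ, 1 < |t| → χ t = 0) :
    IsMultiplicationBy (potential ν χ) (potentialOp ν hχ hs) := by
  intro φ ψ hφ _
  obtain ⟨R, hR⟩ := hφ.isCompact.isBounded.exists_norm_le
  have hfin : {n : Set.Ici (2 : ℕ) | (n : ℕ) ≤ ⌈R + 1⌉₊}.Finite :=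
    Set.Finite.of_finite_image (f := Subtype.val)
      ((Set.finite_Iic (⌈R + 1⌉₊)).subset (by rintro _ ⟨n, hn, rfl⟩; exact hn))
      Subtype.val_injective.injOn
  have hz : ∀ n ∉ hfin.toFinset, ∀ x, φ x ≠ 0 → potentialTerm ν χ (n : ℕ) x = 0 :=
    fun n hn x hx => by
    by_contra h
    have h1 := (abs_le.1 (abs_norm_sub_le_of_potentialTerm_ne_zero hν hs n.2 h)).1
    have h2 := hR x (subset_tsupport _ hx)
    refine hn (hfin.mem_toFinset.2 ?_)
    exact_mod_cast (show ((n : ℕ) : ℝ) ≤ ⌈R + 1⌉₊ from le_trans (by linarith) (Nat.le_ceil _))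
  have hi : ∀ n : ℕ, Integrable fun x => ((potentialTerm ν χ n x : ℝ) : ℂ) * (φ x * conj (ψ x)) :=
    fun n => by
    obtain ⟨C, hC⟩ := exists_bound_potentialTerm (ν := ν) hχ hs n
    exact (integrable_mul_conj φ ψ).bdd_mul (Complex.continuous_ofReal.comp
      (continuous_potentialTerm hχ n)).aestronglyMeasurable (Eventually.of_forall hC)
  rw [potentialOp_apply hν, tsum_eq_sum (s := hfin.toFinset)]
  · simp only [termOp, mulOp_toH1]
    rw [← integral_finsetSum hfin.toFinset fun (n : Set.Ici (2 : ℕ)) _ => hi n]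
    refine integral_congr_ae (Eventually.of_forall fun x => ?_)
    simp only
    rw [← Finset.sum_mul, ← Complex.ofReal_sum, mul_assoc]
    rcases eq_or_ne (φ x) 0 with hx | hx
    · rw [hx, zero_mul, mul_zero, mul_zero]
    · rw [potential, tsum_eq_sum (s := hfin.toFinset) fun n hn => hz n hn x hx]
  · intro n hn
    rw [termOp, mulOp_toH1]
    refine integral_eq_zero_of_ae (Eventually.of_forall fun x => ?_)
    rcases eq_or_ne (φ x) 0 with hx | hx
    · simp [hx]
    · simp [hz n hn x hx]

end Multiplication

/-! ### Compactness of operators with square integrable kernels. -/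

section Kernel

open Filter Topology

variable {α H : Type*} [MeasurableSpace α] {μ : Measure α} [NormedAddCommGroup H]
  [NormedSpace ℂ H]

/-- The operator `f ↦ (x ↦ G(x) f)` with values in `L²`. -/
def kernelOp (G : Lp (H →L[ℂ] ℂ) 2 μ) : H →L[ℂ] Lp ℂ 2 μ :=
  LinearMap.mkContinuous
    { toFun := fun f => (ContinuousLinearMap.apply ℂ ℂ f).compLp G
      map_add' := fun f g => by rw [map_add, ContinuousLinearMap.add_compLp]
      map_smul' := fun c f => by
        rw [map_smul, ContinuousLinearMap.smul_compLp, RingHom.id_apply] } ‖G‖ fun f => by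
    refine (ContinuousLinearMap.norm_compLp_le _ _).trans ?_
    rw [mul_comm]
    refine mul_le_mul_of_nonneg_left ?_ (norm_nonneg _)
    exact ContinuousLinearMap.opNorm_le_bound _ (norm_nonneg _) fun L => by
      rw [mul_comm]; exact L.le_opNorm f

theorem coeFn_kernelOp (G : Lp (H →L[ℂ] ℂ) 2 μ) (f : H) :
    kernelOp G f =ᵐ[μ] fun x => G x f :=
  (ContinuousLinearMap.apply ℂ ℂ f).coeFn_compLp' G

theorem norm_kernelOp_le (G : Lp (H →L[ℂ] ℂ) 2 μ) : ‖kernelOp G‖ ≤ ‖G‖ :=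
  LinearMap.mkContinuous_norm_le _ (norm_nonneg _) _

theorem kernelOp_add (G G' : Lp (H →L[ℂ] ℂ) 2 μ) :
    kernelOp (G + G') = kernelOp G + kernelOp G' := by
  ext1 f
  exact map_add ((ContinuousLinearMap.apply ℂ ℂ f).compLpₗ 2 μ) G G'

theorem kernelOp_sub (G G' : Lp (H →L[ℂ] ℂ) 2 μ) :
    kernelOp (G - G') = kernelOp G - kernelOp G' := by
  ext1 f
  exact map_sub ((ContinuousLinearMap.apply ℂ ℂ f).compLpₗ 2 μ) G G'

theorem continuous_kernelOp :
    Continuous (kernelOp : Lp (H →L[ℂ] ℂ) 2 μ → (H →L[ℂ] Lp ℂ 2 μ)) := by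
  have : LipschitzWith 1 (kernelOp : Lp (H →L[ℂ] ℂ) 2 μ → (H →L[ℂ] Lp ℂ 2 μ)) :=
    LipschitzWith.of_dist_le_mul fun G G' => by
      rw [dist_eq_norm, dist_eq_norm, ← kernelOp_sub, NNReal.coe_one, one_mul]
      exact norm_kernelOp_le _
  exact this.continuous

/-- Operators with a square integrable kernel are compact. -/
theorem isCompactOperator_kernelOp (G : Lp (H →L[ℂ] ℂ) 2 μ) : IsCompactOperator (kernelOp G) := by
  refine Lp.induction (by simp) (fun G : Lp (H →L[ℂ] ℂ) 2 μ => IsCompactOperator (kernelOp G))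
    ?_ ?_ ?_ G
  · intro c s hs hμ
    -- A kernel that is a constant functional `c` on a set gives the operator `f ↦ c(f) 1_s`, of
    -- rank at most one. Sums and limits of such kernels exhaust the square integrable ones.
    have h : kernelOp (Lp.simpleFunc.indicatorConst 2 hs hμ.ne c : Lp (H →L[ℂ] ℂ) 2 μ) =
        (ContinuousLinearMap.toSpanSingleton ℂ (indicatorConstLp 2 hs hμ.ne (1 : ℂ))) ∘L c := by
      ext1 f
      rw [ContinuousLinearMap.comp_apply, ContinuousLinearMap.toSpanSingleton_apply,
        Lp.simpleFunc.coe_indicatorConst]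
      refine Lp.ext ?_
      filter_upwards [coeFn_kernelOp (indicatorConstLp 2 hs hμ.ne c) f,
        indicatorConstLp_coeFn (p := 2) (hs := hs) (hμs := hμ.ne) (c := c),
        indicatorConstLp_coeFn (p := 2) (hs := hs) (hμs := hμ.ne) (c := (1 : ℂ)),
        Lp.coeFn_smul (c f) (indicatorConstLp 2 hs hμ.ne (1 : ℂ))] with x h1 h2 h3 h4
      rw [h1, h2, h4, Pi.smul_apply, h3]
      by_cases hx : x ∈ s <;> simp [hx]
    rw [h]
    exact (isCompactOperator_of_locallyCompactSpace_rng
      (ContinuousLinearMap.toSpanSingleton ℂ (indicatorConstLp 2 hs hμ.ne (1 : ℂ)))).comp_clm c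
  · intro f g hf hg _ h1 h2
    rw [kernelOp_add]
    exact h1.add h2
  · exact isClosed_setOfPred_isCompactOperator.preimage continuous_kernelOp

theorem isCompactOperator_of_norm_sub_le {E F : Type*} [NormedAddCommGroup E] [NormedSpace ℂ E]
    [NormedAddCommGroup F] [NormedSpace ℂ F] [CompleteSpace F] (T : E →L[ℂ] F) (S : ℕ → E →L[ℂ] F)
    (hS : ∀ n, IsCompactOperator (S n)) (K : ℝ) (h : ∀ n, ‖S n - T‖ ≤ K * (1 / ((n : ℝ) + 1))) :
    IsCompactOperator T := by
  refine isCompactOperator_of_tendsto (F := S) (l := atTop) ?_ (Eventually.of_forall hS)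
  rw [tendsto_iff_norm_sub_tendsto_zero]
  refine squeeze_zero (fun n => norm_nonneg _) h ?_
  simpa using tendsto_one_div_add_atTop_nhds_zero_nat.const_mul K

end Kernel

/-! ### Plane waves with a frequency cutoff. -/

section Compact

open Filter Topology

variable {ν : ℕ}

/-- The function `ξ ↦ exp (-2πi x·ξ) θ(a ξ)`. -/
def planeWave (a : ℝ) (x ξ : X ν) : ℂ :=
  Complex.exp (((-(2 * Real.pi * inner ℝ ξ x) : ℝ) : ℂ) * Complex.I) *
    ((unitBump (X ν) (a • ξ) : ℝ) : ℂ)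

theorem continuous_planeWave (a : ℝ) (x : X ν) : Continuous (planeWave a x) := by
  have h : Continuous fun ξ : X ν => unitBump (X ν) (a • ξ) :=
    (unitBump (X ν)).continuous.comp (continuous_const_smul a)
  unfold planeWave
  fun_prop

theorem hasCompactSupport_bump_smul {a : ℝ} (ha : a ≠ 0) :
    HasCompactSupport fun ξ : X ν => ((unitBump (X ν) (a • ξ) : ℝ) : ℂ) :=
  ((unitBump (X ν)).hasCompactSupport.comp_smul ha).comp_left (g := fun r : ℝ => (r : ℂ))
    Complex.ofReal_zero

theorem memLp_planeWave {a : ℝ} (ha : a ≠ 0) (x : X ν) : MemLp (planeWave a x) 2 volume :=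
  (continuous_planeWave a x).memLp_of_hasCompactSupport (hasCompactSupport_bump_smul ha).mul_left

theorem norm_planeWave_sub_le (a : ℝ) (x y ξ : X ν) :
    ‖planeWave a x ξ - planeWave a y ξ‖ ≤
      ‖x - y‖ * ‖((2 * Real.pi * ‖ξ‖ * unitBump (X ν) (a • ξ) : ℝ) : ℂ)‖ := by
  have h1 : planeWave a x ξ - planeWave a y ξ =
      Complex.exp (((-(2 * Real.pi * inner ℝ ξ y) : ℝ) : ℂ) * Complex.I) *
      (Complex.exp (Complex.I * ((-(2 * Real.pi * inner ℝ ξ (x - y)) : ℝ) : ℂ)) - 1) *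
      ((unitBump (X ν) (a • ξ) : ℝ) : ℂ) := by
    rw [planeWave, planeWave, mul_sub, ← Complex.exp_add, inner_sub_right]
    push_cast
    ring_nf
  rw [h1, norm_mul, norm_mul, Complex.norm_exp_ofReal_mul_I, one_mul, Complex.norm_real,
    Complex.norm_real, norm_mul _ (unitBump (X ν) (a • ξ)), ← mul_assoc]
  refine mul_le_mul_of_nonneg_right ((Real.norm_exp_I_mul_ofReal_sub_one_le).trans ?_)
    (norm_nonneg _)
  rw [norm_neg, norm_mul, norm_mul (2 * Real.pi), mul_left_comm, norm_norm]
  refine mul_le_mul_of_nonneg_left ?_ (norm_nonneg _)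
  rw [mul_comm]
  exact norm_inner_le_norm ξ (x - y)

/-- The plane wave as an element of `L²`. -/
def planeWaveL2 {a : ℝ} (ha : a ≠ 0) (x : X ν) : L2 ν := (memLp_planeWave ha x).toLp _

theorem continuous_planeWaveL2 {a : ℝ} (ha : a ≠ 0) :
    Continuous (planeWaveL2 ha : X ν → L2 ν) := by
  have hc : Continuous fun ξ : X ν => ((2 * Real.pi * ‖ξ‖ * unitBump (X ν) (a • ξ) : ℝ) : ℂ) := by
    have h : Continuous fun ξ : X ν => unitBump (X ν) (a • ξ) :=
      (unitBump (X ν)).continuous.comp (continuous_const_smul a)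
    fun_prop
  have hm : MemLp (fun ξ : X ν => ((2 * Real.pi * ‖ξ‖ * unitBump (X ν) (a • ξ) : ℝ) : ℂ)) 2
      volume := by
    refine hc.memLp_of_hasCompactSupport ?_
    simp only [Complex.ofReal_mul (2 * Real.pi * ‖_‖)]
    exact (hasCompactSupport_bump_smul ha).mul_left
  refine (LipschitzWith.of_dist_le_mul (K := ‖hm.toLp _‖₊) fun x y => ?_).continuous
  rw [dist_eq_norm, dist_eq_norm, coe_nnnorm, mul_comm]
  refine Lp.norm_le_mul_norm_of_ae_le_mul ?_
  filter_upwards [Lp.coeFn_sub (planeWaveL2 ha x) (planeWaveL2 ha y),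
    (memLp_planeWave ha x).coeFn_toLp, (memLp_planeWave ha y).coeFn_toLp, hm.coeFn_toLp] with ξ
    h1 h2 h3 h4
  rw [h1, h4, Pi.sub_apply, planeWaveL2, planeWaveL2, h2, h3]
  exact norm_planeWave_sub_le a x y ξ

theorem inner_planeWaveL2 {a : ℝ} (ha : a ≠ 0) (x : X ν) (φ : 𝓢(X ν, ℂ)) :
    inner ℂ (planeWaveL2 ha x) (φ.toLp 2 volume : L2 ν) =
      (𝓕⁻ (cutoff a ha φ) : 𝓢(X ν, ℂ)) x := by
  rw [L2.inner_def, SchwartzMap.fourierInv_coe, Real.fourierInv_eq']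
  refine integral_congr_ae ?_
  filter_upwards [(memLp_planeWave ha x).coeFn_toLp, φ.coeFn_toLp 2 volume] with ξ h1 h2
  rw [planeWaveL2, h1, h2, cutoff_apply, RCLike.inner_apply, planeWave, map_mul,
    ← Complex.exp_conj, map_mul, Complex.conj_ofReal, Complex.conj_ofReal, Complex.conj_I,
    Complex.real_smul, smul_eq_mul]
  push_cast
  ring_nf

/-- The error multiplier satisfies `|θ(aξ) - 1| ≤ a|ξ|`, and `|ξ|` is absorbed by the gradient. -/
theorem norm_cutoff_fourier_sub_le {a : ℝ} (ha : a ≠ 0) (ha0 : 0 < a) (φ : 𝓢(X ν, ℂ)) :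
    ‖((𝓕⁻ (cutoff a ha (𝓕 φ : 𝓢(X ν, ℂ))) - φ : 𝓢(X ν, ℂ)).toLp 2 volume : L2 ν)‖ ≤
      a * ‖toH1 φ‖ := by
  refine le_of_sq_le_sq ?_ (by positivity)
  rw [← Lp.norm_fourier_eq, SchwartzMap.toLp_fourier_eq, sub_eq_add_neg,
    FourierTransform.fourier_add, FourierTransform.fourier_neg, ← sub_eq_add_neg,
    fourier_fourierInv_eq, norm_sq_toLp, mul_pow, H1.norm_sq]
  have hint : Integrable fun ξ => a ^ 2 * ∑ j : Fin ν,
      ‖(𝓕 (∂_{basisVec j} φ) : 𝓢(X ν, ℂ)) ξ‖ ^ 2 :=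
    (integrable_finsetSum _ fun j _ => integrable_norm_sq _).const_mul _
  have hle : ∫ ξ, ‖(cutoff a ha (𝓕 φ : 𝓢(X ν, ℂ)) - 𝓕 φ : 𝓢(X ν, ℂ)) ξ‖ ^ 2 ≤
      ∫ ξ, a ^ 2 * ∑ j : Fin ν, ‖(𝓕 (∂_{basisVec j} φ) : 𝓢(X ν, ℂ)) ξ‖ ^ 2 := by
    refine integral_mono (integrable_norm_sq _) hint fun ξ => ?_
    have h1 : ∀ j : Fin ν, ‖ξ j‖ ^ 2 * ‖(𝓕 φ : 𝓢(X ν, ℂ)) ξ‖ ^ 2 ≤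
        ‖(𝓕 (∂_{basisVec j} φ) : 𝓢(X ν, ℂ)) ξ‖ ^ 2 := fun j => by
      rw [SchwartzMap.fourier_lineDerivOp_eq, smulLeftCLM_inner_basisVec, smul_apply, qOp_apply,
        norm_smul, norm_mul, norm_mul, norm_mul, Complex.norm_I, Complex.norm_real,
        Complex.norm_real, Complex.norm_ofNat, mul_one, mul_pow, mul_pow (‖ξ j‖)]
      refine le_mul_of_one_le_left (by positivity) ?_
      rw [Real.norm_of_nonneg Real.pi_pos.le]
      nlinarith [Real.pi_gt_three]
    have h2 : ‖ξ‖ ^ 2 * ‖(𝓕 φ : 𝓢(X ν, ℂ)) ξ‖ ^ 2 ≤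
        ∑ j : Fin ν, ‖(𝓕 (∂_{basisVec j} φ) : 𝓢(X ν, ℂ)) ξ‖ ^ 2 := by
      rw [EuclideanSpace.norm_sq_eq, Finset.sum_mul]
      exact Finset.sum_le_sum fun j _ => h1 j
    have h3 : ‖(cutoff a ha (𝓕 φ : 𝓢(X ν, ℂ)) - 𝓕 φ : 𝓢(X ν, ℂ)) ξ‖ ≤
        a * ‖ξ‖ * ‖(𝓕 φ : 𝓢(X ν, ℂ)) ξ‖ := by
      have h4 : (cutoff a ha (𝓕 φ : 𝓢(X ν, ℂ)) - 𝓕 φ : 𝓢(X ν, ℂ)) ξ =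
          (unitBump (X ν) (a • ξ) - 1) • (𝓕 φ : 𝓢(X ν, ℂ)) ξ := by
        rw [sub_apply, cutoff_apply, sub_smul, one_smul]
      rw [h4, norm_smul]
      refine mul_le_mul_of_nonneg_right ?_ (norm_nonneg _)
      have h5 : ‖a • ξ‖ = a * ‖ξ‖ := by rw [norm_smul, Real.norm_of_nonneg ha0.le]
      rcases le_or_gt ‖a • ξ‖ 1 with h | h
      · rw [(unitBump (X ν)).one_of_mem_closedBall (by simpa [unitBump] using h), sub_self,
          norm_zero]
        positivity
      · rw [← h5]
        refine le_trans ?_ h.le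
        rw [Real.norm_eq_abs, abs_le]
        have h6 := (unitBump (X ν)).nonneg (x := a • ξ)
        have h7 := (unitBump (X ν)).le_one (x := a • ξ)
        constructor <;> linarith
    calc _ ≤ (a * ‖ξ‖ * ‖(𝓕 φ : 𝓢(X ν, ℂ)) ξ‖) ^ 2 := pow_le_pow_left₀ (norm_nonneg _) h3 2
      _ = a ^ 2 * (‖ξ‖ ^ 2 * ‖(𝓕 φ : 𝓢(X ν, ℂ)) ξ‖ ^ 2) := by ring
      _ ≤ _ := mul_le_mul_of_nonneg_left h2 (sq_nonneg a)
  refine hle.trans ?_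
  rw [integral_const_mul, integral_finsetSum _ fun j _ => integrable_norm_sq _]
  refine mul_le_mul_of_nonneg_left ?_ (sq_nonneg a)
  have h8 : ∀ j : Fin ν, ∫ ξ, ‖(𝓕 (∂_{basisVec j} φ) : 𝓢(X ν, ℂ)) ξ‖ ^ 2 =
      ‖(toH1 φ).grad j‖ ^ 2 := fun j => by
    rw [← norm_sq_toLp, toH1_grad, ← SchwartzMap.toLp_fourier_eq, Lp.norm_fourier_eq]
  rw [Finset.sum_congr rfl fun j _ => h8 j]
  exact le_add_of_nonneg_left (sq_nonneg _)

theorem memLp_smul_of_hasCompactSupport {E : Type*} [NormedAddCommGroup E] [NormedSpace ℂ E]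
    (m : X ν → ℂ) (f : X ν → E) (hmc : Continuous m) (hms : HasCompactSupport m)
    (hf : Continuous f) : MemLp (fun x => m x • f x) 2 volume :=
  (hmc.smul hf).memLp_of_hasCompactSupport hms.smul_right

theorem memLp_smul_planeWaveL2 {m : X ν → ℂ} (hmc : Continuous m) (hms : HasCompactSupport m)
    {a : ℝ} (ha : a ≠ 0) :
    MemLp (fun x => m x • innerSL ℂ (planeWaveL2 ha x)) 2 (volume : Measure (X ν)) :=
  memLp_smul_of_hasCompactSupport m (fun x => innerSL ℂ (planeWaveL2 ha x)) hmc hms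
    ((innerSL ℂ).continuous.comp (continuous_planeWaveL2 ha))

end Compact

/-! ### Rellich compactness of the multiplication operators. -/

section Compact

open Filter Topology

variable {ν : ℕ}

/-- The integral kernel of `smoothingOp`. -/
def planeWaveKernel {m : X ν → ℂ} (hmc : Continuous m) (hms : HasCompactSupport m)
    {a : ℝ} (ha : a ≠ 0) : Lp (L2 ν →L[ℂ] ℂ) 2 (volume : Measure (X ν)) :=
  MemLp.toLp (fun x => m x • innerSL ℂ (planeWaveL2 ha x)) (memLp_smul_planeWaveL2 hmc hms ha)

/-- The operator `f ↦ m (θ(a ·) f)^∨`, where `f` lives in momentum space. -/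
def smoothingOp {m : X ν → ℂ} (hmc : Continuous m) (hms : HasCompactSupport m)
    {a : ℝ} (ha : a ≠ 0) : L2 ν →L[ℂ] L2 ν :=
  kernelOp (planeWaveKernel hmc hms ha)

theorem isCompactOperator_smoothingOp {m : X ν → ℂ} (hmc : Continuous m)
    (hms : HasCompactSupport m) {a : ℝ} (ha : a ≠ 0) :
    IsCompactOperator (smoothingOp hmc hms ha) := isCompactOperator_kernelOp _

theorem smoothingOp_toLp {m : X ν → ℂ} (hmc : Continuous m) (hms : HasCompactSupport m)
    (hm : MemLp m ⊤ volume) {a : ℝ} (ha : a ≠ 0) (φ : 𝓢(X ν, ℂ)) :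
    smoothingOp hmc hms ha (φ.toLp 2 volume) =
      mulL2 m hm ((𝓕⁻ (cutoff a ha φ) : 𝓢(X ν, ℂ)).toLp 2 volume) := by
  refine Lp.ext ?_
  filter_upwards [coeFn_kernelOp (planeWaveKernel hmc hms ha)
    (φ.toLp 2 volume : L2 ν), (memLp_smul_planeWaveL2 hmc hms ha).coeFn_toLp,
    coeFn_mulL2 m hm ((𝓕⁻ (cutoff a ha φ) : 𝓢(X ν, ℂ)).toLp 2 volume),
    (𝓕⁻ (cutoff a ha φ) : 𝓢(X ν, ℂ)).coeFn_toLp 2 volume] with x h1 h2 h3 h4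
  rw [smoothingOp, h1, planeWaveKernel, h2, h3, h4, smul_apply, innerSL_apply_apply, inner_planeWaveL2, smul_eq_mul]

theorem norm_smoothingOp_sub_le {m : X ν → ℂ} (hmc : Continuous m) (hms : HasCompactSupport m)
    (hm : MemLp m ⊤ volume) {C : ℝ} (hC : ∀ x, ‖m x‖ ≤ C) {a : ℝ} (ha : a ≠ 0) (ha0 : 0 < a)
    (f : H1 ν) : ‖smoothingOp hmc hms ha (𝓕 f.toL2) - mulL2 m hm f.toL2‖ ≤ C * a * ‖f‖ := by
  have hC0 : 0 ≤ C := (norm_nonneg _).trans (hC 0)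
  have hcont : Continuous fun f : H1 ν => f.toL2 := (H1.toL2CLM ν).continuous
  have hcont' : Continuous fun f : H1 ν => (𝓕 f.toL2 : L2 ν) :=
    (Lp.fourierTransformₗᵢ (X ν) ℂ).continuous.comp hcont
  refine dense_toH1_momentumCore.induction (P := fun f : H1 ν =>
    ‖smoothingOp hmc hms ha (𝓕 f.toL2) - mulL2 m hm f.toL2‖ ≤ C * a * ‖f‖) ?_ ?_ f
  · rintro _ ⟨φ, _, rfl⟩
    rw [toH1_toL2, SchwartzMap.toLp_fourier_eq, smoothingOp_toLp hmc hms hm, ← map_sub]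
    have h1 : ((𝓕⁻ (cutoff a ha (𝓕 φ : 𝓢(X ν, ℂ))) : 𝓢(X ν, ℂ)).toLp 2 volume : L2 ν) -
        φ.toLp 2 volume = (𝓕⁻ (cutoff a ha (𝓕 φ : 𝓢(X ν, ℂ))) - φ : 𝓢(X ν, ℂ)).toLp 2 volume :=
      (map_sub (SchwartzMap.toLpCLM ℂ ℂ 2 (volume : Measure (X ν))) _ _).symm
    rw [h1, mul_assoc]
    exact (norm_mulL2_le _ _ hC _).trans
      (mul_le_mul_of_nonneg_left (norm_cutoff_fourier_sub_le _ ha0 φ) hC0)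
  · exact isClosed_le (((smoothingOp hmc hms ha).continuous.comp hcont').sub
      ((mulL2 m hm).continuous.comp hcont)).norm (continuous_const.mul continuous_norm)

/-- The Fourier transform from `H¹` to `L²`. -/
def H1.fourierCLM (ν : ℕ) : H1 ν →L[ℂ] L2 ν :=
  ((Lp.fourierTransformₗᵢ (X ν) ℂ).toContinuousLinearEquiv : L2 ν →L[ℂ] L2 ν) ∘L H1.toL2CLM ν

/-- Multiplication by a continuous function of compact support is compact from `H¹` to `L²`. -/
theorem isCompactOperator_mulL2 {m : X ν → ℂ} (hmc : Continuous m) (hms : HasCompactSupport m)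
    (hm : MemLp m ⊤ volume) : IsCompactOperator (mulL2 m hm ∘L H1.toL2CLM ν) := by
  obtain ⟨C, hC⟩ := hms.exists_bound_of_continuous hmc
  have hC0 : 0 ≤ C := (norm_nonneg _).trans (hC 0)
  have ha0 : ∀ n : ℕ, (0 : ℝ) < 1 / ((n : ℝ) + 1) := fun n => by positivity
  have hc : ∀ n : ℕ, IsCompactOperator (smoothingOp hmc hms (ha0 n).ne' ∘L H1.fourierCLM ν) :=
    fun n => IsCompactOperator.comp_clm (isCompactOperator_smoothingOp hmc hms (ha0 n).ne')
      (H1.fourierCLM ν)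
  -- After cutting off frequencies above order `n + 1`, multiplication by `m` has a square
  -- integrable kernel; the part removed is at most `C/(n+1)` in norm from `H¹` to `L²`.
  refine isCompactOperator_of_norm_sub_le (mulL2 m hm ∘L H1.toL2CLM ν)
    (fun n => smoothingOp hmc hms (ha0 n).ne' ∘L H1.fourierCLM ν) hc C fun n => ?_
  refine ContinuousLinearMap.opNorm_le_bound _ (mul_nonneg hC0 (ha0 n).le) fun f => ?_
  exact norm_smoothingOp_sub_le hmc hms hm hC (ha0 n).ne' (ha0 n) f

variable {χ : ℝ → ℝ}

theorem hasCompactSupport_potentialTerm (hν : 3 ≤ ν) (hs : ∀ t : ℝ, 1 < |t| → χ t = 0)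
    {n : ℕ} (hn : 2 ≤ n) : HasCompactSupport fun x : X ν => ((potentialTerm ν χ n x : ℝ) : ℂ) := by
  refine HasCompactSupport.intro (isCompact_closedBall (0 : X ν) (n + 1)) fun x hx => ?_
  by_contra h
  have h1 := abs_norm_sub_le_of_potentialTerm_ne_zero hν hs hn (x := x) (by
    intro h0; exact h (by rw [h0, Complex.ofReal_zero]))
  have h2 := (abs_le.1 h1).2
  exact hx (by rw [mem_closedBall_zero_iff]; linarith)

theorem isCompactOperator_termOp (hν : 3 ≤ ν) (hχ : ContDiff ℝ 1 χ)
    (hs : ∀ t : ℝ, 1 < |t| → χ t = 0) {n : ℕ} (hn : 2 ≤ n) :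
    IsCompactOperator (termOp ν hχ hs n) :=
  (isCompactOperator_mulL2 (Complex.continuous_ofReal.comp (continuous_potentialTerm hχ n))
    (hasCompactSupport_potentialTerm hν hs hn) _).clm_comp (L2.toHneg1 ν)

theorem isCompactOperator_potentialOp (hν : 3 ≤ ν) (hχ : ContDiff ℝ 1 χ)
    (hs : ∀ t : ℝ, 1 < |t| → χ t = 0) : IsCompactOperator (potentialOp ν hχ hs) := by
  refine isCompactOperator_of_tendsto (summable_termOp hν hχ hs).hasSum
    (Eventually.of_forall fun s => ?_)
  exact Submodule.sum_mem (compactOperator (RingHom.id ℂ) (H1 ν) (Hneg1 ν))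
    fun n _ => isCompactOperator_termOp hν hχ hs n.2

end Compact

/-! ### Dilated Schwartz functions: norms and Laplacians. -/

section Dilation

open Filter Topology

variable {ν : ℕ}

/-- The dilated function `x ↦ φ(c x)`. -/
def dilate (c : ℝ) (hc : c ≠ 0) (φ : 𝓢(X ν, ℂ)) : 𝓢(X ν, ℂ) :=
  compCLMOfContinuousLinearEquiv ℂ
    (ContinuousLinearEquiv.smulLeft (R₁ := ℝ) (M₁ := X ν) (Units.mk0 c hc)) φ

theorem dilate_apply (c : ℝ) (hc : c ≠ 0) (φ : 𝓢(X ν, ℂ)) (x : X ν) :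
    dilate c hc φ x = φ (c • x) := rfl

theorem lineDerivOp_dilate (c : ℝ) (hc : c ≠ 0) (φ : 𝓢(X ν, ℂ)) (v : X ν) :
    ∂_{v} (dilate c hc φ) = (c : ℂ) • dilate c hc (∂_{v} φ) := by
  ext x
  rw [dilate, SchwartzMap.lineDerivOp_compCLMOfContinuousLinearEquiv, smul_apply,
    compCLMOfContinuousLinearEquiv_apply, Function.comp_apply, dilate_apply,
    SchwartzMap.lineDerivOp_apply_eq_fderiv, SchwartzMap.lineDerivOp_apply_eq_fderiv]
  change fderiv ℝ φ (c • x) (c • v) = _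
  rw [map_smul, Complex.coe_smul]

theorem laplacian_dilate (c : ℝ) (hc : c ≠ 0) (φ : 𝓢(X ν, ℂ)) :
    Δ (dilate c hc φ) = ((c ^ 2 : ℝ) : ℂ) • dilate c hc (Δ φ) := by
  rw [SchwartzMap.laplacian_eq_sum (EuclideanSpace.basisFun (Fin ν) ℝ),
    SchwartzMap.laplacian_eq_sum (EuclideanSpace.basisFun (Fin ν) ℝ)]
  ext x
  simp only [lineDerivOp_dilate, lineDerivOp_smul, sum_apply, smul_apply, dilate_apply,
    Finset.mul_sum, smul_eq_mul]
  refine Finset.sum_congr rfl fun i _ => ?_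
  push_cast
  ring

theorem integral_norm_sq_dilate (c : ℝ) (hc : 0 < c) (φ : 𝓢(X ν, ℂ)) :
    ∫ x, ‖dilate c hc.ne' φ x‖ ^ 2 = (c ^ ν)⁻¹ * ∫ x, ‖φ x‖ ^ 2 := by
  simp only [dilate_apply]
  rw [Measure.integral_comp_smul volume (fun x : X ν => ‖φ x‖ ^ 2) c, finrank_euclideanSpace_fin,
    abs_of_pos (by positivity), smul_eq_mul]

theorem norm_toLp_dilate (c : ℝ) (hc : 0 < c) (φ : 𝓢(X ν, ℂ)) :
    ‖((dilate c hc.ne' φ).toLp 2 volume : L2 ν)‖ =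
      Real.sqrt (c ^ ν)⁻¹ * ‖(φ.toLp 2 volume : L2 ν)‖ := by
  rw [← sq_eq_sq₀ (norm_nonneg _) (by positivity), norm_sq_toLp, integral_norm_sq_dilate c hc,
    mul_pow, norm_sq_toLp, Real.sq_sqrt (by positivity)]

theorem laplacian_toLp (φ : 𝓢(X ν, ℂ)) :
    Δ ((φ.toLp 2 volume : L2 ν) : 𝓢'(X ν, ℂ)) =
      (((Δ φ : 𝓢(X ν, ℂ)).toLp 2 volume : L2 ν) : 𝓢'(X ν, ℂ)) := by
  have h1 := Lp.toTemperedDistribution_toLp_eq (μ := (volume : Measure (X ν))) (p := 2) φ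
  have h2 := Lp.toTemperedDistribution_toLp_eq (μ := (volume : Measure (X ν))) (p := 2) (Δ φ)
  have h3 := TemperedDistribution.laplacian_toTemperedDistributionCLM_eq φ
  exact (congrArg (fun w : 𝓢'(X ν, ℂ) => Δ w) h1).trans (h3.trans h2.symm)

end Dilation

/-! ### Failure of boundedness relative to the Laplacian. -/

section Unbounded

open Filter Topology

variable {ν : ℕ} {χ : ℝ → ℝ}

theorem potential_eq_potentialTerm (hν : 3 ≤ ν) (hs : ∀ t : ℝ, 1 < |t| → χ t = 0)
    {n : ℕ} (hn : 2 ≤ n) {x : X ν} (hx : |‖x‖ - n| ≤ 1 / 8) :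
    potential ν χ x = potentialTerm ν χ n x := by
  rw [potential, tsum_eq_single (⟨n, hn⟩ : Set.Ici (2 : ℕ))]
  intro m hm
  by_contra h
  have h1 := abs_le.1 (abs_norm_sub_le_of_potentialTerm_ne_zero hν hs m.2 h)
  have h2 := abs_le.1 hx
  refine hm (Subtype.ext ?_)
  have h3 : ((m : ℕ) : ℝ) < n + 1 := by linarith
  have h4 : (n : ℝ) < (m : ℕ) + 1 := by linarith
  have h5 : (m : ℕ) < n + 1 := by exact_mod_cast h3
  have h6 : n < (m : ℕ) + 1 := by exact_mod_cast h4
  change (m : ℕ) = n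
  omega

/-- The relation `P² n = N²` between height and inverse width of the shells decides both negative
results. -/
theorem sq_rpow_eq {n : ℕ} (hn : 2 ≤ n) :
    ((n : ℝ) ^ ((3 * (ν : ℝ) - 1) / 2)) ^ 2 * n = ((n : ℝ) ^ (3 * (ν : ℝ) / 2)) ^ 2 := by
  have hn0 : (0 : ℝ) < n := by positivity
  rw [← Real.rpow_mul_natCast hn0.le, ← Real.rpow_mul_natCast hn0.le]
  conv_lhs => rw [← Real.rpow_one (n : ℝ), ← Real.rpow_mul hn0.le, ← Real.rpow_add hn0]
  congr 1
  push_cast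
  ring

theorem pow_four_le_rpow (hν : 3 ≤ ν) {n : ℕ} (hn : 2 ≤ n) :
    (n : ℝ) ^ 4 ≤ (n : ℝ) ^ (3 * (ν : ℝ) / 2) := by
  have h2 : (2 : ℝ) ≤ n := by exact_mod_cast hn
  have h3 : (3 : ℝ) ≤ ν := by exact_mod_cast hν
  calc (n : ℝ) ^ 4 = (n : ℝ) ^ (4 : ℝ) := by norm_cast
    _ ≤ _ := Real.rpow_le_rpow_of_exponent_le (by linarith) (by linarith)

theorem measureReal_ball {r : ℝ} (hr : 0 < r) : volume.real (Metric.ball (0 : X ν) r) =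
    r ^ ν * volume.real (Metric.ball (0 : X ν) 1) := by
  rw [measureReal_def, Measure.addHaar_ball_of_pos volume (0 : X ν) hr, ENNReal.toReal_mul,
    ENNReal.toReal_ofReal (by positivity), finrank_euclideanSpace_fin, measureReal_def]

theorem le_measureReal_annulus (hν : 1 ≤ ν) {r s : ℝ} (hr : 0 < r) (hs : 0 ≤ s) :
    s * r ^ (ν - 1) * volume.real (Metric.ball (0 : X ν) 1) ≤
      volume.real (Metric.ball (0 : X ν) (r + s) \ Metric.ball 0 r) := by
  rw [measureReal_sdiff (Metric.ball_subset_ball (by linarith)) measurableSet_ball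
    (measure_ball_lt_top.ne),
    measureReal_ball (by linarith : 0 < r + s), measureReal_ball hr, ← sub_mul]
  refine mul_le_mul_of_nonneg_right ?_ measureReal_nonneg
  obtain ⟨k, rfl⟩ : ∃ k, ν = k + 1 := ⟨ν - 1, by omega⟩
  have h1 : r ^ (k + 1) + s * r ^ k ≤ (r + s) ^ (k + 1) := by
    rw [pow_succ (r + s), pow_succ r]
    have : r ^ k ≤ (r + s) ^ k := pow_le_pow_left₀ hr.le (by linarith) k
    nlinarith
  simp only [Nat.add_sub_cancel]
  linarith

theorem exists_half_le {g : ℝ → ℝ} (hg : Continuous g) (h1 : g 0 = 1) :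
    ∃ ε : ℝ, 0 < ε ∧ ε ≤ 1 ∧ ∀ t, |t| ≤ ε → 1 / 2 ≤ g t := by
  have := hg.continuousAt.eventually (lt_mem_nhds (show 1 / 2 < g 0 by rw [h1]; norm_num))
  obtain ⟨δ, hδ, h⟩ := Metric.eventually_nhds_iff.1 this
  refine ⟨min (δ / 2) 1, by positivity, min_le_right _ _, fun t ht => (h ?_).le⟩
  rw [Real.dist_eq, sub_zero]
  have := ht.trans (min_le_left _ _)
  linarith

/-- A smooth cutoff, equal to `1` on the unit ball and supported in the ball of radius `2`. -/
theorem exists_schwartz_bump (ν : ℕ) : ∃ φ : 𝓢(X ν, ℂ), HasCompactSupport φ ∧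
    (∀ x, ‖x‖ ≤ 1 → φ x = 1) ∧ ∀ x, 2 ≤ ‖x‖ → φ x = 0 := by
  let b : ContDiffBump (0 : X ν) := ⟨1, 2, one_pos, one_lt_two⟩
  have hbump : HasCompactSupport fun x : X ν => ((b x : ℝ) : ℂ) :=
    b.hasCompactSupport.comp_left (g := fun r : ℝ => (r : ℂ)) Complex.ofReal_zero
  refine ⟨hbump.toSchwartzMap (Complex.ofRealCLM.contDiff.comp b.contDiff), hbump,
    fun x hx => ?_, fun x hx => ?_⟩
  · change ((b x : ℝ) : ℂ) = 1
    rw [b.one_of_mem_closedBall (by simpa [b] using hx), Complex.ofReal_one]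
  · change ((b x : ℝ) : ℂ) = 0
    rw [b.zero_of_le_dist (by simpa [b] using hx), Complex.ofReal_zero]

/-- The test functions `φ(x/2n)` equal 1 on the ball of radius `2n`, and the squared norms of the
function and of its Laplacian are at most of order `n^ν`. On an annulus of width `ε/N` next to the
sphere of radius `n` the potential exceeds `P/2`, so the squared norm of the product is at least of
order `P² N⁻¹ n^{ν-1} = N n^{ν-2}`. Boundedness would force `N` to be at most of order `n²`, against
`N ≥ n⁴`. -/
theorem not_isLaplacianBounded (hν : 3 ≤ ν) (hχ : ContDiff ℝ 1 χ)
    (hs : ∀ t : ℝ, 1 < |t| → χ t = 0) (h1 : deriv χ 0 = 1) :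
    ¬ IsLaplacianBounded (potential ν χ) := by
  rintro ⟨a, b, hab⟩
  obtain ⟨ε, hε0, hε1, hε⟩ := exists_half_le (hχ.continuous_deriv le_rfl) h1
  obtain ⟨φ, hφc, hφ1, hφ0⟩ := exists_schwartz_bump ν
  set K : ℝ := |a| * ‖((Δ φ : 𝓢(X ν, ℂ)).toLp 2 volume : L2 ν)‖ +
    |b| * ‖(φ.toLp 2 volume : L2 ν)‖ with hK
  have hK0 : 0 ≤ K := by positivity
  set κ : ℝ := volume.real (Metric.ball (0 : X ν) 1) with hκ
  have hκ0 : 0 < κ := by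
    rw [hκ, measureReal_def]
    exact ENNReal.toReal_pos (Metric.measure_ball_pos _ _ one_pos).ne' measure_ball_lt_top.ne
  have key : ∀ n : ℕ, 2 ≤ n → 1 / 4 * ε * κ * n ≤ K ^ 2 * 2 ^ ν := fun n hn => by
    have hn2 : (2 : ℝ) ≤ n := by exact_mod_cast hn
    have hn0 : (0 : ℝ) < n := by linarith
    set N : ℝ := (n : ℝ) ^ (3 * (ν : ℝ) / 2) with hN
    set P : ℝ := (n : ℝ) ^ ((3 * (ν : ℝ) - 1) / 2) with hP
    have hN8 : 8 ≤ N := eight_le_rpow hν hn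
    have hN0 : 0 < N := by linarith
    have hP0 : 0 < P := by positivity
    set c : ℝ := (2 * n : ℝ)⁻¹ with hc
    have hc0 : 0 < c := by positivity
    have hc1 : c ≤ 1 := inv_le_one_of_one_le₀ (by linarith)
    set f : 𝓢(X ν, ℂ) := dilate c hc0.ne' φ with hf
    obtain ⟨h, hh, hle⟩ := hab (f.toLp 2 volume) ((Δ f : 𝓢(X ν, ℂ)).toLp 2 volume)
      (laplacian_toLp f)
    have hub : ‖h‖ ≤ Real.sqrt (c ^ ν)⁻¹ * K := by
      have e1 : ((Δ f : 𝓢(X ν, ℂ)).toLp 2 volume : L2 ν) =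
          ((c ^ 2 : ℝ) : ℂ) • (dilate c hc0.ne' (Δ φ)).toLp 2 volume := by
        rw [hf, laplacian_dilate]
        exact map_smul (SchwartzMap.toLpCLM ℂ ℂ 2 (volume : Measure (X ν))) _ _
      have e2 : ‖((Δ f : 𝓢(X ν, ℂ)).toLp 2 volume : L2 ν)‖ ≤
          Real.sqrt (c ^ ν)⁻¹ * ‖((Δ φ : 𝓢(X ν, ℂ)).toLp 2 volume : L2 ν)‖ := by
        rw [e1, norm_smul, norm_toLp_dilate c hc0, Complex.norm_real, Real.norm_of_nonneg (by positivity)]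
        exact mul_le_of_le_one_left (by positivity) (pow_le_one₀ hc0.le hc1)
      have e3 : ‖(f.toLp 2 volume : L2 ν)‖ = Real.sqrt (c ^ ν)⁻¹ * ‖(φ.toLp 2 volume : L2 ν)‖ :=
        norm_toLp_dilate c hc0 φ
      calc ‖h‖ ≤ _ := hle
        _ ≤ |a| * (Real.sqrt (c ^ ν)⁻¹ * ‖((Δ φ : 𝓢(X ν, ℂ)).toLp 2 volume : L2 ν)‖) +
            |b| * (Real.sqrt (c ^ ν)⁻¹ * ‖(φ.toLp 2 volume : L2 ν)‖) := by
            rw [← e3]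
            gcongr
            · exact le_abs_self a
            · exact le_abs_self b
        _ = _ := by rw [hK]; ring
    have hub2 : ‖h‖ ^ 2 ≤ 2 ^ ν * n ^ ν * K ^ 2 := by
      calc ‖h‖ ^ 2 ≤ (Real.sqrt (c ^ ν)⁻¹ * K) ^ 2 := pow_le_pow_left₀ (norm_nonneg _) hub 2
        _ = _ := by rw [mul_pow, Real.sq_sqrt (by positivity), hc, inv_pow, inv_inv, mul_pow]
    set A : Set (X ν) := Metric.ball (0 : X ν) (n + ε / N) \ Metric.ball 0 n with hA
    have hεN : ε / N ≤ 1 / 8 := by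
      rw [div_le_div_iff₀ hN0 (by norm_num)]; linarith
    have hAx : ∀ x ∈ A, (P / 2) ≤ ‖(potential ν χ x : ℂ) * f x‖ := fun x hx => by
      have h2 : ‖x‖ < n + ε / N := by simpa using hx.1
      have h3 : (n : ℝ) ≤ ‖x‖ := by simpa using hx.2
      have h4 : |‖x‖ - n| ≤ ε / N := abs_le.2 ⟨by linarith [div_pos hε0 hN0], by linarith⟩
      have h5 : f x = 1 := (dilate_apply c hc0.ne' φ x).trans (hφ1 _ (by
        rw [norm_smul, Real.norm_of_nonneg hc0.le, hc, inv_mul_le_iff₀ (by positivity)]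
        linarith))
      rw [h5, mul_one, potential_eq_potentialTerm hν hs hn (h4.trans hεN), Complex.norm_real,
        potentialTerm, Real.norm_eq_abs]
      have h6 : 1 / 2 ≤ deriv χ (N * (‖x‖ - n)) := hε _ (by
        rw [abs_mul, abs_of_pos hN0, mul_comm, ← le_div_iff₀ hN0]; exact h4)
      calc P / 2 = P * (1 / 2) := by ring
        _ ≤ P * deriv χ (N * (‖x‖ - n)) := mul_le_mul_of_nonneg_left h6 hP0.le
        _ ≤ _ := le_abs_self _
    have hlb : (P / 2) ^ 2 * volume.real A ≤ ‖h‖ ^ 2 := by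
      have e1 : ‖h‖ ^ 2 = ∫ x, ‖h x‖ ^ 2 := by
        rw [← inner_self_eq_norm_sq (𝕜 := ℂ), L2.inner_def, ← integral_re]
        · exact integral_congr_ae (Eventually.of_forall fun x => inner_self_eq_norm_sq _)
        · exact L2.integrable_inner _ _
      have hmA : MeasurableSet A := measurableSet_ball.diff measurableSet_ball
      have hAfin : volume A ≠ ⊤ :=
        ((measure_mono Set.sdiff_subset).trans_lt measure_ball_lt_top).ne
      have hi : Integrable fun x => ‖h x‖ ^ 2 :=
        (memLp_two_iff_integrable_sq_norm (Lp.aestronglyMeasurable h)).1 (Lp.memLp h)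
      rw [e1]
      calc (P / 2) ^ 2 * volume.real A = ∫ x in A, (P / 2) ^ 2 := by
            rw [setIntegral_const, smul_eq_mul, mul_comm]
        _ ≤ ∫ x in A, ‖h x‖ ^ 2 := by
            refine setIntegral_mono_ae_restrict (integrableOn_const hAfin) hi.integrableOn ?_
            filter_upwards [ae_restrict_mem hmA, ae_restrict_of_ae hh,
              ae_restrict_of_ae (f.coeFn_toLp 2 volume)] with x hx h2 h3
            rw [h2, h3]
            exact pow_le_pow_left₀ (by positivity) (hAx x hx) 2
        _ ≤ ∫ x, ‖h x‖ ^ 2 := setIntegral_le_integral hi (Eventually.of_forall fun x => by positivity)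
    have hvol := le_measureReal_annulus (ν := ν) (by omega) hn0 (div_nonneg hε0.le hN0.le)
    have hPN : P ^ 2 * n = N ^ 2 := sq_rpow_eq hn
    have hN4 : (n : ℝ) ^ 4 ≤ N := pow_four_le_rpow hν hn
    have h7 : (P / 2) ^ 2 * (ε / N * (n : ℝ) ^ (ν - 1) * κ) ≤ 2 ^ ν * n ^ ν * K ^ 2 :=
      (mul_le_mul_of_nonneg_left hvol (by positivity)).trans (hlb.trans hub2)
    have h8 : (P / 2) ^ 2 * (ε / N * (n : ℝ) ^ (ν - 1) * κ) * n =
        1 / 4 * ε * κ * N * (n : ℝ) ^ (ν - 1) := by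
      field_simp
      linear_combination 4 * hPN
    have h9 : (n : ℝ) ^ ν = (n : ℝ) ^ (ν - 1) * n := by
      rw [← pow_succ]; congr 1; omega
    have hpos : (0 : ℝ) < (n : ℝ) ^ (ν - 1) := by positivity
    have h10 : 1 / 4 * ε * κ * N ≤ 2 ^ ν * K ^ 2 * n ^ 2 := by
      refine le_of_mul_le_mul_right ?_ hpos
      rw [← h8]
      calc _ ≤ 2 ^ ν * n ^ ν * K ^ 2 * n := mul_le_mul_of_nonneg_right h7 hn0.le
        _ = _ := by rw [h9]; ring
    refine le_of_mul_le_mul_right ?_ (by positivity : (0 : ℝ) < (n : ℝ) ^ 2)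
    calc 1 / 4 * ε * κ * n * n ^ 2 = 1 / 4 * ε * κ * (n : ℝ) ^ 3 := by ring
      _ ≤ 1 / 4 * ε * κ * N := by
          refine mul_le_mul_of_nonneg_left (le_trans ?_ hN4) (by positivity)
          exact pow_le_pow_right₀ (by linarith) (by norm_num)
      _ ≤ _ := h10.trans_eq (by ring)
  obtain ⟨n, hn⟩ := exists_nat_gt (K ^ 2 * 2 ^ ν / (1 / 4 * ε * κ))
  have h2 := key (n + 2) (by omega)
  rw [div_lt_iff₀ (by positivity)] at hn
  push_cast at h2
  nlinarith [mul_pos hε0 hκ0]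

end Unbounded

/-! ### Evolution of multiplication operators under dilations. -/

section DilationGroup

open Filter Topology

variable {ν : ℕ}

/-- For each vector the difference quotients at zero are bounded by the mean value inequality; the
uniform boundedness principle makes the bound uniform over vectors. -/
theorem exists_norm_sub_le_of_contDiff {E F : Type*} [NormedAddCommGroup E] [NormedSpace ℂ E]
    [CompleteSpace E] [NormedAddCommGroup F] [NormedSpace ℂ F] [NormedSpace ℝ F]
    (g : ℝ → E →L[ℂ] F) (h : ∀ f, ContDiff ℝ 1 fun τ => g τ f) :
    ∃ C, ∀ τ ∈ Set.Ioc (0 : ℝ) 1, ‖g τ - g 0‖ ≤ C * τ := by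
  obtain ⟨C, hC⟩ := banach_steinhaus
    (g := fun τ : Set.Ioc (0 : ℝ) 1 => (((τ : ℝ)⁻¹ : ℝ) : ℂ) • (g τ - g 0)) fun f => by
      obtain ⟨C, hC⟩ := (isCompact_Icc (a := (0 : ℝ)) (b := 1)).exists_bound_of_continuousOn
        ((h f).continuous_deriv le_rfl).continuousOn
      refine ⟨C, fun τ => ?_⟩
      have h1 := (convex_Icc (0 : ℝ) 1).norm_image_sub_le_of_norm_deriv_le
        (fun x _ => ((h f).differentiable one_ne_zero) x) hC (by simp : (0 : ℝ) ∈ Set.Icc 0 1)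
        (Set.Ioc_subset_Icc_self τ.2)
      have hτ : 0 < (τ : ℝ) := τ.2.1
      rw [_root_.smul_apply, _root_.sub_apply, norm_smul,
        Complex.norm_real, norm_inv, Real.norm_of_nonneg hτ.le, inv_mul_le_iff₀ hτ, mul_comm]
      rwa [sub_zero, Real.norm_of_nonneg hτ.le] at h1
  refine ⟨C, fun τ hτ => ?_⟩
  have h1 := hC ⟨τ, hτ⟩
  rwa [norm_smul, Complex.norm_real, norm_inv, Real.norm_of_nonneg hτ.1.le,
    inv_mul_le_iff₀ hτ.1, mul_comm] at h1

theorem fourier_dilate (c : ℝ) (hc : 0 < c) (φ : 𝓢(X ν, ℂ)) (w : X ν) :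
    𝓕 (dilate c hc.ne' φ) w = ((c ^ ν : ℝ) : ℂ)⁻¹ * 𝓕 φ (c⁻¹ • w) := by
  rw [SchwartzMap.fourier_coe, SchwartzMap.fourier_coe, Real.fourier_eq', Real.fourier_eq']
  have h := Measure.integral_comp_smul volume (fun y : X ν =>
    Complex.exp (((-2 * Real.pi * inner ℝ y (c⁻¹ • w) : ℝ) : ℂ) * Complex.I) • φ y) c
  rw [finrank_euclideanSpace_fin, abs_of_pos (by positivity), Complex.real_smul,
    Complex.ofReal_inv] at h
  rw [← h]
  refine integral_congr_ae (Eventually.of_forall fun y => ?_)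
  simp only [dilate_apply, inner_smul_left, inner_smul_right, RCLike.conj_to_real]
  rw [inv_mul_cancel_left₀ hc.ne']

theorem dilationFlow_sobolevGroup_toH1 (t : ℝ) (φ : 𝓢(X ν, ℂ)) :
    dilationFlow.sobolevGroup t (toH1 φ) =
      toH1 (((Real.sqrt (Real.exp t ^ ν) : ℝ) : ℂ) • dilate (Real.exp t) (Real.exp_pos t).ne' φ) := by
  apply H1.toL2_injective
  apply LineFlow.fourier_injective
  rw [LineFlow.sobolevGroup_toL2, LineFlow.fourier_unitary, toH1_toL2, toH1_toL2,
    SchwartzMap.toLp_fourier_eq, SchwartzMap.toLp_fourier_eq]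
  refine Lp.ext ?_
  filter_upwards [dilationFlow.coeFn_transportL2 t ((𝓕 φ).toLp 2 volume : L2 ν),
    dilationFlow.transport_congr t ((𝓕 φ).coeFn_toLp 2 volume),
    (𝓕 (((Real.sqrt (Real.exp t ^ ν) : ℝ) : ℂ) •
      dilate (Real.exp t) (Real.exp_pos t).ne' φ)).coeFn_toLp 2 volume] with x h1 h2 h3
  rw [h1, h2, h3, FourierTransform.fourier_smul, smul_apply, fourier_dilate _ (Real.exp_pos t),
    LineFlow.transport]
  have e1 : dilationFlow.det t x = (Real.exp t ^ ν)⁻¹ := by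
    simp [LineFlow.det, dilationFlow, Real.exp_neg]
  have e2 : dilationFlow.flow t x = (Real.exp t)⁻¹ • x := by
    ext j; simp [dilationFlow, Real.exp_neg]
  have e3 : Real.sqrt (Real.exp t ^ ν)⁻¹ = Real.sqrt (Real.exp t ^ ν) * (Real.exp t ^ ν)⁻¹ := by
    have h0 : 0 < Real.exp t ^ ν := by positivity
    rw [Real.sqrt_inv, eq_mul_inv_iff_mul_eq₀ h0.ne', inv_mul_eq_iff_eq_mul₀ (by positivity),
      Real.mul_self_sqrt h0.le]
  rw [e1, e2, e3, smul_eq_mul]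
  push_cast
  ring

theorem evolve_apply (S : ℝ → H1 ν →L[ℂ] H1 ν) (T : H1 ν →L[ℂ] Hneg1 ν) (τ : ℝ) (f g : H1 ν) :
    evolve S T τ f g = T (S (-τ) f) (S (-τ) g) := rfl

theorem hasCompactSupport_dilate (c : ℝ) (hc : c ≠ 0) {φ : 𝓢(X ν, ℂ)} (hφ : HasCompactSupport φ) :
    HasCompactSupport (dilate c hc φ) :=
  hφ.comp_homeomorph (Homeomorph.smulOfNeZero c hc)

/-- The evolution of a multiplication operator under dilations. -/
theorem IsMultiplicationBy.evolve_dilationFlow {V : X ν → ℝ} {T : H1 ν →L[ℂ] Hneg1 ν}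
    (hT : IsMultiplicationBy V T) (τ : ℝ) {ψ : 𝓢(X ν, ℂ)} (hψ : HasCompactSupport ψ) :
    evolve (fun t => dilationFlow.sobolevGroup t) T τ (toH1 ψ) (toH1 ψ) =
      ((∫ x, V (Real.exp τ • x) * ‖ψ x‖ ^ 2 : ℝ) : ℂ) := by
  have hc := hasCompactSupport_dilate (Real.exp (-τ)) (Real.exp_pos _).ne' hψ
  have hc' : HasCompactSupport (((Real.sqrt (Real.exp (-τ) ^ ν) : ℝ) : ℂ) •
      dilate (Real.exp (-τ)) (Real.exp_pos (-τ)).ne' ψ : 𝓢(X ν, ℂ)) :=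
    hc.smul_left (f := fun _ => ((Real.sqrt (Real.exp (-τ) ^ ν) : ℝ) : ℂ))
  rw [evolve_apply, dilationFlow_sobolevGroup_toH1, hT _ _ hc' hc', ← integral_complex_ofReal]
  have h := Measure.integral_comp_smul volume (fun y : X ν =>
    (((V (Real.exp τ • y) * ‖ψ y‖ ^ 2 : ℝ) : ℂ))) (Real.exp (-τ))
  rw [finrank_euclideanSpace_fin, abs_of_pos (by positivity), eq_inv_smul_iff₀ (by positivity)] at h
  refine Eq.trans ?_ h
  rw [Complex.real_smul, ← integral_const_mul]
  refine integral_congr_ae (Eventually.of_forall fun x => ?_)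
  have e1 : Real.exp τ • Real.exp (-τ) • x = x := by
    rw [smul_smul, ← Real.exp_add, add_neg_cancel, Real.exp_zero, one_smul]
  have e2 : ((Real.sqrt (Real.exp (-τ) ^ ν) : ℝ) : ℂ) * ((Real.sqrt (Real.exp (-τ) ^ ν) : ℝ) : ℂ) =
      ((Real.exp (-τ) ^ ν : ℝ) : ℂ) := by
    rw [← Complex.ofReal_mul, Real.mul_self_sqrt (by positivity)]
  have e3 := RCLike.mul_conj (ψ (Real.exp (-τ) • x))
  simp only [smul_apply, dilate_apply, smul_eq_mul, map_mul, Complex.conj_ofReal, e1] at e3 ⊢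
  rw [Complex.ofReal_mul, Complex.ofReal_pow ‖_‖]
  linear_combination (((Real.sqrt (Real.exp (-τ) ^ ν) : ℝ) : ℂ) *
    ((Real.sqrt (Real.exp (-τ) ^ ν) : ℝ) : ℂ) * (V x : ℂ)) * e3 +
    (V x : ℂ) * (‖ψ (Real.exp (-τ) • x)‖ : ℂ) ^ 2 * e2

end DilationGroup

/-! ### Failure of first-order regularity under dilations. -/

section Regularity

open Filter Topology

variable {ν : ℕ} {χ : ℝ → ℝ}

theorem lineDerivOp_compSubConstCLM (a : X ν) (φ : 𝓢(X ν, ℂ)) (v : X ν) :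
    ∂_{v} (φ.compSubConstCLM ℂ a) = (∂_{v} φ).compSubConstCLM ℂ a := by
  ext x
  rw [compSubConstCLM_apply, SchwartzMap.lineDerivOp_apply_eq_fderiv,
    SchwartzMap.lineDerivOp_apply_eq_fderiv, ← fderiv_comp_sub]
  rfl

theorem norm_toLp_compSubConstCLM (a : X ν) (φ : 𝓢(X ν, ℂ)) :
    ‖((φ.compSubConstCLM ℂ a).toLp 2 volume : L2 ν)‖ = ‖(φ.toLp 2 volume : L2 ν)‖ := by
  rw [← sq_eq_sq₀ (norm_nonneg _) (norm_nonneg _), norm_sq_toLp, norm_sq_toLp]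
  exact integral_sub_right_eq_self (fun x : X ν => ‖φ x‖ ^ 2) a

theorem toLp_smul (c : ℂ) (φ : 𝓢(X ν, ℂ)) :
    ((c • φ).toLp 2 volume : L2 ν) = c • (φ.toLp 2 volume : L2 ν) :=
  map_smul (SchwartzMap.toLpCLM ℂ ℂ 2 (volume : Measure (X ν))) _ _

/-- At scale `ρ` the gradient costs `ρ⁻¹`, which for `ρ ≤ 1` is the worst loss. -/
theorem norm_sq_toH1_dilate_le {ρ : ℝ} (hρ : 0 < ρ) (hρ1 : ρ ≤ 1) (a : X ν) (φ : 𝓢(X ν, ℂ)) :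
    ‖toH1 ((dilate ρ⁻¹ (inv_pos.2 hρ).ne' φ).compSubConstCLM ℂ a)‖ ^ 2 * ρ ^ 2 ≤
      ρ ^ ν * ‖toH1 φ‖ ^ 2 := by
  rw [H1.norm_sq, H1.norm_sq]
  simp only [toH1_toL2, toH1_grad, lineDerivOp_compSubConstCLM, norm_toLp_compSubConstCLM,
    lineDerivOp_dilate, toLp_smul, norm_smul, norm_toLp_dilate ρ⁻¹ (inv_pos.2 hρ), inv_pow, inv_inv,
    mul_pow, Real.sq_sqrt (pow_nonneg hρ.le ν), Complex.norm_real, Real.norm_eq_abs, sq_abs,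
    ← Finset.mul_sum]
  have h1 : (ρ ^ 2)⁻¹ * ρ ^ 2 = 1 := inv_mul_cancel₀ (by positivity)
  have h2 : ρ ^ 2 ≤ 1 := pow_le_one₀ hρ.le hρ1
  have h3 : 0 ≤ ρ ^ ν * ‖(φ.toLp 2 volume : L2 ν)‖ ^ 2 := by positivity
  calc _ = ρ ^ ν * ‖(φ.toLp 2 volume : L2 ν)‖ ^ 2 * ρ ^ 2 + ((ρ ^ 2)⁻¹ * ρ ^ 2) * (ρ ^ ν *
        ∑ j : Fin ν, ‖((∂_{basisVec j} φ : 𝓢(X ν, ℂ)).toLp 2 volume : L2 ν)‖ ^ 2) := by ring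
    _ ≤ _ := by
      rw [h1, one_mul, mul_add]
      exact add_le_add (mul_le_of_le_one_right h3 h2) le_rfl

theorem le_deriv_sub_deriv (hχ : ContDiff ℝ 3 χ) {ε : ℝ}
    (hε : ∀ t, |t| ≤ ε → 1 / 2 ≤ deriv (deriv χ) t) {s t : ℝ} (hs : -ε ≤ s) (hst : s ≤ t)
    (ht : t ≤ ε) : 1 / 2 * (t - s) ≤ deriv χ t - deriv χ s := by
  have hd : Differentiable ℝ (deriv χ) :=
    (hχ.iterate_deriv' 2 1).differentiable (by norm_num)
  refine (convex_Icc s t).mul_sub_le_image_sub_of_le_deriv hd.continuous.continuousOn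
    hd.differentiableOn (fun x hx => hε x ?_) s (Set.left_mem_Icc.2 hst) t
    (Set.right_mem_Icc.2 hst) hst
  rw [interior_Icc] at hx
  exact abs_le.2 ⟨by linarith [hx.1], by linarith [hx.2]⟩

/-- A point within `ε/(2N)` of the sphere has norm at most `2n`, so a dilation this small moves it
radially by at most another `ε/(2N)`. It stays where only the `n`-th term acts and where the
argument of `χ'` is in `[-ε, ε]`. -/
theorem potential_exp_smul (hν : 3 ≤ ν) (hs : ∀ t : ℝ, 1 < |t| → χ t = 0) {ε : ℝ} (hε1 : ε ≤ 1)
    {n : ℕ} (hn : 2 ≤ n) {σ : ℝ} (hσ0 : 0 ≤ σ)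
    (hσ : (Real.exp σ - 1) * (2 * n * (n : ℝ) ^ (3 * (ν : ℝ) / 2)) ≤ ε / 2) {x : X ν}
    (hx : (n : ℝ) ^ (3 * (ν : ℝ) / 2) * |‖x‖ - n| ≤ ε / 2) :
    potential ν χ (Real.exp σ • x) = (n : ℝ) ^ ((3 * (ν : ℝ) - 1) / 2) *
        deriv χ ((n : ℝ) ^ (3 * (ν : ℝ) / 2) * (Real.exp σ * ‖x‖ - n)) ∧
      -ε ≤ (n : ℝ) ^ (3 * (ν : ℝ) / 2) * (Real.exp σ * ‖x‖ - n) ∧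
      (n : ℝ) ^ (3 * (ν : ℝ) / 2) * (Real.exp σ * ‖x‖ - n) ≤ ε := by
  have hn2 : (2 : ℝ) ≤ n := by exact_mod_cast hn
  have hN8 := eight_le_rpow hν hn
  generalize hN : (n : ℝ) ^ (3 * (ν : ℝ) / 2) = N at *
  have hN0 : 0 < N := by linarith
  have h3 : |N * (‖x‖ - n)| ≤ ε / 2 := by rwa [abs_mul, abs_of_pos hN0]
  have h3' := abs_le.1 h3
  have h4 : ‖Real.exp σ • x‖ = Real.exp σ * ‖x‖ := by
    rw [norm_smul, Real.norm_of_nonneg (Real.exp_pos σ).le]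
  have h5 : ‖x‖ ≤ 2 * n := by
    have : N * (‖x‖ - n) ≤ N * n := by nlinarith
    linarith [le_of_mul_le_mul_left this hN0]
  have h6 : 0 ≤ Real.exp σ - 1 := by linarith [Real.one_le_exp hσ0]
  have h8 : (Real.exp σ - 1) * ‖x‖ * N ≤ ε / 2 := by
    calc _ ≤ (Real.exp σ - 1) * (2 * n) * N := by gcongr
      _ = (Real.exp σ - 1) * (2 * n * N) := by ring
      _ ≤ _ := hσ
  have h9 : 0 ≤ (Real.exp σ - 1) * ‖x‖ * N := by positivity
  have h10 : -ε ≤ N * (Real.exp σ * ‖x‖ - n) := by linarith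
  have h11 : N * (Real.exp σ * ‖x‖ - n) ≤ ε := by linarith
  refine ⟨?_, h10, h11⟩
  have h12 : |Real.exp σ * ‖x‖ - n| ≤ 1 / 8 := by
    refine le_of_mul_le_mul_left ?_ hN0
    rw [← abs_of_pos hN0, ← abs_mul, abs_of_pos hN0]
    exact (abs_le.2 ⟨h10, h11⟩).trans (by linarith)
  rw [potential_eq_potentialTerm hν hs hn (by rwa [h4]), potentialTerm, h4, hN]

/-- On `[-ε, ε]` the function `χ'` increases with slope at least 1/2, and the dilation pushes its
argument forward by at least `N τ n/2`, as `|x| ≥ n/2`. -/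
theorem le_potential_sub (hν : 3 ≤ ν) (hχ : ContDiff ℝ 3 χ) (hs : ∀ t : ℝ, 1 < |t| → χ t = 0)
    {ε : ℝ} (hε1 : ε ≤ 1) (hε : ∀ t, |t| ≤ ε → 1 / 2 ≤ deriv (deriv χ) t)
    {n : ℕ} (hn : 2 ≤ n) {τ : ℝ} (hτ0 : 0 ≤ τ)
    (hτ : (Real.exp τ - 1) * (2 * n * (n : ℝ) ^ (3 * (ν : ℝ) / 2)) ≤ ε / 2) {x : X ν}
    (hx : (n : ℝ) ^ (3 * (ν : ℝ) / 2) * |‖x‖ - n| ≤ ε / 2) :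
    (n : ℝ) ^ ((3 * (ν : ℝ) - 1) / 2) * (n : ℝ) ^ (3 * (ν : ℝ) / 2) * n * τ / 4 ≤
      potential ν χ (Real.exp τ • x) - potential ν χ x := by
  obtain ⟨e1, e2, e3⟩ := potential_exp_smul hν hs hε1 hn hτ0 hτ hx
  have hε0 : 0 ≤ ε / 2 := (by positivity : (0 : ℝ) ≤ _).trans hx
  obtain ⟨e4, e5, e6⟩ := potential_exp_smul hν hs hε1 hn le_rfl (by simpa using hε0) hx
  rw [Real.exp_zero, one_smul, one_mul] at e4
  rw [Real.exp_zero, one_mul] at e5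
  have hn2 : (2 : ℝ) ≤ n := by exact_mod_cast hn
  have hN8 := eight_le_rpow hν hn
  have hP0 : 0 < (n : ℝ) ^ ((3 * (ν : ℝ) - 1) / 2) := by positivity
  rw [e1, e4]
  generalize (n : ℝ) ^ (3 * (ν : ℝ) / 2) = N at *
  generalize (n : ℝ) ^ ((3 * (ν : ℝ) - 1) / 2) = P at *
  have hN0 : 0 < N := by linarith
  have h4 : (n : ℝ) / 2 ≤ ‖x‖ := by
    have h3 : |‖x‖ - n| ≤ 1 := by
      refine le_of_mul_le_mul_left (hx.trans ?_) hN0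
      linarith
    linarith [(abs_le.1 h3).1]
  have hexp : τ ≤ Real.exp τ - 1 := by linarith [Real.add_one_le_exp τ]
  have h5 : τ * (n / 2) ≤ (Real.exp τ - 1) * ‖x‖ :=
    mul_le_mul hexp h4 (by positivity) (hτ0.trans hexp)
  have h6 : N * (τ * (n / 2)) ≤ N * (Real.exp τ * ‖x‖ - n) - N * (‖x‖ - n) := by
    rw [← mul_sub]
    refine mul_le_mul_of_nonneg_left ?_ hN0.le
    linarith
  have h0 : 0 ≤ N * (τ * (n / 2)) := by positivity
  have h7 := le_deriv_sub_deriv hχ hε e5 (by linarith) e3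
  calc P * N * n * τ / 4 = P * (1 / 2 * (N * (τ * (n / 2)))) := by ring
    _ ≤ P * (deriv χ (N * (Real.exp τ * ‖x‖ - n)) - deriv χ (N * (‖x‖ - n))) := by
      refine mul_le_mul_of_nonneg_left (le_trans ?_ h7) hP0.le
      exact mul_le_mul_of_nonneg_left h6 (by norm_num)
    _ = _ := mul_sub _ _ _

theorem exists_exp_sub_one_mul_le (M : ℝ) {δ : ℝ} (hδ : 0 < δ) :
    ∃ τ : ℝ, 0 < τ ∧ τ ≤ 1 ∧ (Real.exp τ - 1) * M ≤ δ := by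
  have h : Continuous fun τ : ℝ => (Real.exp τ - 1) * M := by fun_prop
  have h3 := h.continuousAt.eventually
    (gt_mem_nhds (show (Real.exp 0 - 1) * M < δ by simpa using hδ))
  obtain ⟨r, hr, h⟩ := Metric.eventually_nhds_iff.1 h3
  refine ⟨min (r / 2) 1, by positivity, min_le_right _ _, (h ?_).le⟩
  rw [Real.dist_eq, sub_zero, abs_of_pos (by positivity)]
  linarith [min_le_left (r / 2) 1]

/-- A bump of radius of order `ρ ~ 1/N` at distance `n` from the origin feels an increase of the
potential of at least `P N n τ/4`, so the form of `T_τ - T` is at least of order `P N n τ ρ^ν`. The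
squared `H¹` norm of the bump is at most of order `ρ^{ν-2}`. A bound `‖T_τ - T‖ ≤ C τ` then bounds
`P N n ρ²`, which is of order `P n/N = √n`. -/
theorem not_isClassC1 (hν : 3 ≤ ν) (hχ : ContDiff ℝ 3 χ)
    (hs : ∀ t : ℝ, 1 < |t| → χ t = 0) (h2 : deriv (deriv χ) 0 = 1) {T : H1 ν →L[ℂ] Hneg1 ν}
    (hT : IsMultiplicationBy (potential ν χ) T) :
    ¬ IsClassC1 (fun k => k) T := by
  rintro ⟨S, hS, hST⟩
  obtain rfl := hS.unique (dilationFlow.isSobolevGroup (by fun_prop) fun k j => rfl)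
  obtain ⟨C, hC⟩ := exists_norm_sub_le_of_contDiff (fun τ => evolve _ T τ) hST
  have hc2 : Continuous (deriv (deriv χ)) := (hχ.iterate_deriv' 1 2).continuous
  obtain ⟨ε, hε0, hε1, hε⟩ := exists_half_le hc2 h2
  obtain ⟨φ, hφc, hφ1, hφ0⟩ := exists_schwartz_bump ν
  set A : ℝ := ‖(φ.toLp 2 volume : L2 ν)‖ ^ 2 with hA
  set B : ℝ := ‖toH1 φ‖ ^ 2 with hB
  have hA0 : 0 < A := by
    rw [hA, norm_sq_toLp]
    refine (integral_pos_iff_support_of_nonneg (fun x => by positivity)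
      (integrable_norm_sq φ)).2 ?_
    refine (Metric.measure_ball_pos volume (0 : X ν) one_pos).trans_le (measure_mono fun x hx => ?_)
    rw [Function.mem_support, hφ1 x (mem_ball_zero_iff.1 hx).le]
    simp
  have key : ∀ n : ℕ, 2 ≤ n → (ε ^ 2 * A) ^ 2 * n ≤ (64 * C * B) ^ 2 := fun n hn => by
    have hn2 : (2 : ℝ) ≤ n := by exact_mod_cast hn
    have hn0 : (0 : ℝ) < n := by linarith
    set N : ℝ := (n : ℝ) ^ (3 * (ν : ℝ) / 2) with hN
    set P : ℝ := (n : ℝ) ^ ((3 * (ν : ℝ) - 1) / 2) with hP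
    have hN8 : 8 ≤ N := eight_le_rpow hν hn
    have hN0 : 0 < N := by linarith
    have hP0 : 0 < P := by positivity
    have hPN : P ^ 2 * n = N ^ 2 := sq_rpow_eq hn
    -- The bump `ψ` lives within `2ρ` of its centre, and `2ρN = ε/2` is exactly the margin required
    -- by `le_potential_sub`.
    set ρ : ℝ := ε / (4 * N) with hρ
    have hρ0 : 0 < ρ := by positivity
    have hρN : N * (2 * ρ) = ε / 2 := by rw [hρ]; field_simp; norm_num
    have hρ1 : ρ ≤ 1 / 32 := by
      rw [hρ, div_le_div_iff₀ (by positivity) (by norm_num)]; linarith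
    set a : X ν := (n : ℝ) • basisVec ⟨0, by omega⟩ with ha
    have hna : ‖a‖ = n := by
      rw [ha, norm_smul, basisVec, PiLp.norm_single]
      simp
    set ψ : 𝓢(X ν, ℂ) := (dilate ρ⁻¹ (inv_pos.2 hρ0).ne' φ).compSubConstCLM ℂ a with hψ
    have hψx : ∀ x, ψ x ≠ 0 → |‖x‖ - n| ≤ 2 * ρ := fun x hx => by
      by_contra! h
      refine hx (hφ0 (ρ⁻¹ • (x - a)) ?_)
      rw [norm_smul, Real.norm_of_nonneg (inv_pos.2 hρ0).le, le_inv_mul_iff₀ hρ0, mul_comm]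
      rw [← hna] at h
      exact h.le.trans (abs_norm_sub_norm_le x a)
    have hψc : HasCompactSupport ψ := by
      refine HasCompactSupport.of_support_subset_isCompact
        (isCompact_closedBall (0 : X ν) (n + 2 * ρ)) fun x hx => ?_
      rw [mem_closedBall_zero_iff]
      linarith [(abs_le.1 (hψx x hx)).2]
    have hψA : ∫ x, ‖ψ x‖ ^ 2 = ρ ^ ν * A := by
      rw [← norm_sq_toLp, hψ, norm_toLp_compSubConstCLM, norm_toLp_dilate ρ⁻¹ (inv_pos.2 hρ0),
        mul_pow, Real.sq_sqrt (by positivity), inv_pow, inv_inv]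
    have hψB : ‖toH1 ψ‖ ^ 2 * ρ ^ 2 ≤ ρ ^ ν * B :=
      norm_sq_toH1_dilate_le hρ0 (by linarith) a φ
    obtain ⟨τ, hτ0, hτ1, hτ⟩ := exists_exp_sub_one_mul_le (2 * n * N) (half_pos hε0)
    have hlow : ∀ x, P * N * n * τ / 4 * ‖ψ x‖ ^ 2 ≤
        potential ν χ (Real.exp τ • x) * ‖ψ x‖ ^ 2 - potential ν χ (Real.exp 0 • x) * ‖ψ x‖ ^ 2 := by
      intro x
      by_cases hx : ψ x = 0
      · simp [hx]
      rw [← sub_mul]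
      refine mul_le_mul_of_nonneg_right ?_ (by positivity)
      have h3 := le_potential_sub hν hχ hs hε1 hε hn hτ0.le hτ
        ((mul_le_mul_of_nonneg_left (hψx x hx) hN0.le).trans hρN.le)
      rwa [Real.exp_zero, one_smul]
    have hint : ∀ σ : ℝ, 0 ≤ σ → σ ≤ τ →
        Integrable fun x => potential ν χ (Real.exp σ • x) * ‖ψ x‖ ^ 2 := by
      intro σ hσ0 hσ
      have h3 : (fun x => potential ν χ (Real.exp σ • x) * ‖ψ x‖ ^ 2) =
          fun x => P * deriv χ (N * (Real.exp σ * ‖x‖ - n)) * ‖ψ x‖ ^ 2 := by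
        funext x
        by_cases hx : ψ x = 0
        · simp [hx]
        · rw [(potential_exp_smul hν hs hε1 hn hσ0 ((mul_le_mul_of_nonneg_right
            (sub_le_sub_right (Real.exp_le_exp.2 hσ) 1) (by positivity)).trans hτ)
            ((mul_le_mul_of_nonneg_left (hψx x hx) hN0.le).trans hρN.le)).1]
      rw [h3]
      refine Continuous.integrable_of_hasCompactSupport ?_ ?_
      · have h4 : Continuous (deriv χ) := hχ.continuous_deriv (by norm_num)
        have h5 : Continuous ψ := ψ.continuous
        fun_prop
      · exact (hψc.comp_left (g := fun z : ℂ => ‖z‖ ^ 2) (by simp)).mul_left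
    have hmain : P * N * n * τ / 4 * (ρ ^ ν * A) ≤ C * τ * ‖toH1 ψ‖ ^ 2 := by
      have h3 := hC τ ⟨hτ0, hτ1⟩
      have h4 := hT.evolve_dilationFlow τ hψc
      have h5 := hT.evolve_dilationFlow 0 hψc
      have h6 : ‖evolve (fun t => dilationFlow.sobolevGroup t) T τ (toH1 ψ) (toH1 ψ) -
          evolve (fun t => dilationFlow.sobolevGroup t) T 0 (toH1 ψ) (toH1 ψ)‖ ≤
          C * τ * ‖toH1 ψ‖ ^ 2 := by
        refine (ContinuousLinearMap.le_opNorm₂ (evolve (fun t => dilationFlow.sobolevGroup t) T τ -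
          evolve (fun t => dilationFlow.sobolevGroup t) T 0) (toH1 ψ) (toH1 ψ)).trans ?_
        rw [mul_assoc, ← sq]
        exact mul_le_mul_of_nonneg_right h3 (by positivity)
      refine le_trans ?_ h6
      rw [h4, h5, ← Complex.ofReal_sub, Complex.norm_real, ← hψA, ← integral_const_mul,
        ← integral_sub (hint τ hτ0.le le_rfl) (hint 0 le_rfl hτ0.le)]
      refine le_trans ?_ (le_abs_self _)
      exact integral_mono ((integrable_norm_sq ψ).const_mul _)
        ((hint τ hτ0.le le_rfl).sub (hint 0 le_rfl hτ0.le)) hlow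
    have hCB : P * n * (ε ^ 2 * A) ≤ 64 * C * B * N := by
      have hC0 : 0 ≤ C := by
        have := (norm_nonneg _).trans (hC 1 (by simp))
        linarith
      have hρν : 0 < ρ ^ ν := by positivity
      have h3 : P * N * n * A * ρ ^ 2 ≤ 4 * C * B := by
        refine le_of_mul_le_mul_right ?_ (mul_pos hτ0 hρν)
        calc P * N * n * A * ρ ^ 2 * (τ * ρ ^ ν) =
              4 * ρ ^ 2 * (P * N * n * τ / 4 * (ρ ^ ν * A)) := by ring
          _ ≤ 4 * ρ ^ 2 * (C * τ * ‖toH1 ψ‖ ^ 2) := mul_le_mul_of_nonneg_left hmain (by positivity)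
          _ = 4 * C * τ * (‖toH1 ψ‖ ^ 2 * ρ ^ 2) := by ring
          _ ≤ 4 * C * τ * (ρ ^ ν * B) := mul_le_mul_of_nonneg_left hψB (by positivity)
          _ = _ := by ring
      have h4 : P * n * (ε ^ 2 * A) = P * N * n * A * ρ ^ 2 * (16 * N) := by
        rw [hρ]; field_simp; norm_num
      rw [h4]
      calc _ ≤ 4 * C * B * (16 * N) := mul_le_mul_of_nonneg_right h3 (by positivity)
        _ = _ := by ring
    have h3 := pow_le_pow_left₀ (by positivity) hCB 2
    refine le_of_mul_le_mul_right ?_ (by positivity : 0 < N ^ 2)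
    calc (ε ^ 2 * A) ^ 2 * n * N ^ 2 = (P * n * (ε ^ 2 * A)) ^ 2 := by rw [← hPN]; ring
      _ ≤ _ := h3.trans_eq (by ring)
  obtain ⟨n, hn⟩ := exists_nat_gt ((64 * C * B) ^ 2 / (ε ^ 2 * A) ^ 2)
  have h3 := key (n + 2) (by omega)
  have h4 : 0 < (ε ^ 2 * A) ^ 2 := by positivity
  rw [div_lt_iff₀ h4] at hn
  push_cast at h3
  nlinarith

end Regularity

/-! ### Operators built from positions and bounded functions of momentum. -/

section Symbols

open Filter Topology

variable {ν : ℕ}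

theorem schwartz_fourier_injective {φ ψ : 𝓢(X ν, ℂ)} (h : (𝓕 φ : 𝓢(X ν, ℂ)) = 𝓕 ψ) :
    φ = ψ := by
  have h1 := congrArg (fun f : 𝓢(X ν, ℂ) => (𝓕⁻ f : 𝓢(X ν, ℂ))) h
  simpa only [fourierInv_fourier_eq] using h1

/-- A smooth real function all of whose derivatives, including the function itself, are bounded. -/
structure IsSymbol (m : X ν → ℝ) : Prop where
  contDiff : ContDiff ℝ ∞ m
  bounded : ∀ n : ℕ, ∃ C : ℝ, ∀ x, ‖iteratedFDeriv ℝ n m x‖ ≤ C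

namespace IsSymbol

variable {m m' : X ν → ℝ}

theorem mul (hm : IsSymbol m) (hm' : IsSymbol m') : IsSymbol fun x => m x * m' x := by
  refine ⟨hm.contDiff.mul hm'.contDiff, fun n => ?_⟩
  choose C hC using hm.bounded
  choose C' hC' using hm'.bounded
  refine ⟨∑ i ∈ Finset.range (n + 1), (n.choose i : ℝ) * C i * C' (n - i), fun x => ?_⟩
  refine (norm_iteratedFDeriv_mul_le hm.contDiff hm'.contDiff x (by exact_mod_cast le_top)).trans ?_
  refine Finset.sum_le_sum fun i _ => ?_
  have h0 : 0 ≤ C i := (norm_nonneg _).trans (hC i x)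
  exact mul_le_mul (mul_le_mul_of_nonneg_left (hC i x) (by positivity)) (hC' _ x)
    (norm_nonneg _) (by positivity)

theorem fderiv_apply (hm : IsSymbol m) (v : X ν) : IsSymbol fun x => fderiv ℝ m x v := by
  have hd : ContDiff ℝ ∞ (fderiv ℝ m) := hm.contDiff.fderiv_right (by simp)
  refine ⟨hd.clm_apply contDiff_const, fun n => ?_⟩
  obtain ⟨C, hC⟩ := hm.bounded (n + 1)
  refine ⟨‖ContinuousLinearMap.apply ℝ ℝ v‖ * C, fun x => ?_⟩
  refine ((ContinuousLinearMap.apply ℝ ℝ v).norm_iteratedFDeriv_comp_left hd.contDiffAt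
    (by exact_mod_cast le_top)).trans ?_
  rw [norm_iteratedFDeriv_fderiv]
  exact mul_le_mul_of_nonneg_left (hC x) (norm_nonneg _)

theorem exists_abs_le (hm : IsSymbol m) : ∃ C, 0 ≤ C ∧ ∀ x, |m x| ≤ C := by
  obtain ⟨C, hC⟩ := hm.bounded 0
  refine ⟨C, (norm_nonneg _).trans (hC 0), fun x => ?_⟩
  simpa using hC x

theorem hasTemperateGrowth (hm : IsSymbol m) :
    (fun ξ : X ν => ((m ((2 * Real.pi) • ξ) : ℝ) : ℂ)).HasTemperateGrowth := by
  have h1 : m.HasTemperateGrowth := ⟨hm.contDiff, fun n => by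
    obtain ⟨C, hC⟩ := hm.bounded n
    exact ⟨0, C, by simpa using hC⟩⟩
  exact Function.Complex.hasTemperateGrowth_ofReal.comp (h1.comp
    ((2 * Real.pi) • ContinuousLinearMap.id ℝ (X ν)).hasTemperateGrowth)

theorem pFun_pFun (hm : IsSymbol m) (hm' : IsSymbol m') (φ : 𝓢(X ν, ℂ)) :
    pFun m (pFun m' φ) = pFun (fun x => m x * m' x) φ := by
  rw [pFun, pFun, pFun, SchwartzMap.fourierMultiplierCLM_fourierMultiplierCLM_apply
    hm.hasTemperateGrowth hm'.hasTemperateGrowth]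
  congr 2
  funext ξ
  simp

theorem fourier_pFun_apply (hm : IsSymbol m) (φ : 𝓢(X ν, ℂ)) (ξ : X ν) :
    𝓕 (pFun m φ) ξ = (m ((2 * Real.pi) • ξ) : ℂ) * 𝓕 φ ξ := by
  rw [fourier_pFun, SchwartzMap.smulLeftCLM_apply_apply hm.hasTemperateGrowth, smul_eq_mul]

theorem lineDerivOp_pFun (hm : IsSymbol m) (φ : 𝓢(X ν, ℂ)) (v : X ν) :
    ∂_{v} (pFun m φ) = pFun m (∂_{v} φ) := by
  have h : (fun ξ : X ν => inner ℝ ξ v).HasTemperateGrowth := by fun_prop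
  apply schwartz_fourier_injective
  ext ξ
  rw [hm.fourier_pFun_apply, SchwartzMap.fourier_lineDerivOp_eq, SchwartzMap.fourier_lineDerivOp_eq,
    smul_apply, smul_apply, SchwartzMap.smulLeftCLM_apply_apply h,
    SchwartzMap.smulLeftCLM_apply_apply h, hm.fourier_pFun_apply]
  simp only [smul_eq_mul, Complex.real_smul]
  ring

theorem norm_toLp_pFun_le (hm : IsSymbol m) {C : ℝ} (hC : ∀ x, |m x| ≤ C) (φ : 𝓢(X ν, ℂ)) :
    ‖((pFun m φ).toLp 2 volume : L2 ν)‖ ≤ C * ‖(φ.toLp 2 volume : L2 ν)‖ := by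
  rw [← Lp.norm_fourier_eq, ← Lp.norm_fourier_eq (φ.toLp 2 volume : L2 ν),
    SchwartzMap.toLp_fourier_eq, SchwartzMap.toLp_fourier_eq]
  refine Lp.norm_le_mul_norm_of_ae_le_mul ?_
  filter_upwards [(𝓕 (pFun m φ)).coeFn_toLp 2 volume, (𝓕 φ).coeFn_toLp 2 volume] with ξ h1 h2
  rw [h1, h2, hm.fourier_pFun_apply, norm_mul, Complex.norm_real]
  exact mul_le_mul_of_nonneg_right (hC _) (norm_nonneg _)

theorem norm_sq_toH1_pFun_le (hm : IsSymbol m) {C : ℝ} (hC : ∀ x, |m x| ≤ C) (φ : 𝓢(X ν, ℂ)) :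
    ‖toH1 (pFun m φ)‖ ^ 2 ≤ C ^ 2 * ‖toH1 φ‖ ^ 2 := by
  rw [H1.norm_sq, H1.norm_sq, mul_add, Finset.mul_sum]
  simp only [toH1_toL2, toH1_grad, hm.lineDerivOp_pFun, ← mul_pow]
  exact add_le_add (pow_le_pow_left₀ (norm_nonneg _) (hm.norm_toLp_pFun_le hC _) 2)
    (Finset.sum_le_sum fun j _ => pow_le_pow_left₀ (norm_nonneg _) (hm.norm_toLp_pFun_le hC _) 2)

/-- The commutation relation of a function of momentum and a coordinate of the position. -/
theorem pFun_qOp (hm : IsSymbol m) (j : Fin ν) (φ : 𝓢(X ν, ℂ)) :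
    pFun m (qOp j φ) = qOp j (pFun m φ) +
      (-Complex.I) • pFun (fun x => fderiv ℝ m x (basisVec j)) φ := by
  apply schwartz_fourier_injective
  rw [FourierTransform.fourier_add, FourierTransform.fourier_smul]
  ext ξ
  have h0 : ((𝓕 (pFun m φ) : 𝓢(X ν, ℂ)) : X ν → ℂ) = fun ξ => (m ((2 * Real.pi) • ξ) : ℂ) * 𝓕 φ ξ :=
    funext fun ξ => hm.fourier_pFun_apply φ ξ
  have h1 : HasFDerivAt (fun ξ : X ν => m ((2 * Real.pi) • ξ))
      ((fderiv ℝ m ((2 * Real.pi) • ξ)).comp ((2 * Real.pi) • ContinuousLinearMap.id ℝ (X ν))) ξ :=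
    ((hm.contDiff.differentiable (by simp)) _).hasFDerivAt.comp ξ
      ((2 * Real.pi) • ContinuousLinearMap.id ℝ (X ν)).hasFDerivAt
  have h2 := (h1.hasLineDerivAt (basisVec j))
  have h3 : HasLineDerivAt ℝ (fun ξ : X ν => ((m ((2 * Real.pi) • ξ) : ℝ) : ℂ))
      (((2 * Real.pi) * fderiv ℝ m ((2 * Real.pi) • ξ) (basisVec j) : ℝ) : ℂ) ξ (basisVec j) := by
    refine (HasDerivAt.ofReal_comp h2).congr_deriv ?_
    simp
  have h4 := HasDerivAt.mul h3 (hasLineDerivAt_schwartz (𝓕 φ) j ξ)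
  have h5 : ∂_{basisVec j} (𝓕 (pFun m φ)) ξ = _ :=
    HasDerivAt.unique ((hasLineDerivAt_schwartz (𝓕 (pFun m φ)) j ξ)) (by rw [h0]; exact h4)
  rw [hm.fourier_pFun_apply, add_apply, smul_apply, (hm.fderiv_apply _).fourier_pFun_apply,
    fourier_qOp, fourier_qOp, smul_apply, smul_apply, h5]
  have hpi : (Real.pi : ℂ) ≠ 0 := by exact_mod_cast Real.pi_ne_zero
  simp only [zero_smul, add_zero, smul_eq_mul]
  push_cast
  field_simp
  ring

end IsSymbol

/-- The operators on the Schwartz space which are sums of products of at most `d` positions with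
functions of momentum. -/
inductive HasOrder : ℕ → (𝓢(X ν, ℂ) → 𝓢(X ν, ℂ)) → Prop
  | momentum {m : X ν → ℝ} (hm : IsSymbol m) : HasOrder 0 fun φ => pFun m φ
  | add {d : ℕ} {L L' : 𝓢(X ν, ℂ) → 𝓢(X ν, ℂ)} (h : HasOrder d L) (h' : HasOrder d L') :
      HasOrder d fun φ => L φ + L' φ
  | smul {d : ℕ} {L : 𝓢(X ν, ℂ) → 𝓢(X ν, ℂ)} (c : ℂ) (h : HasOrder d L) :
      HasOrder d fun φ => c • L φ
  | position {d : ℕ} {L : 𝓢(X ν, ℂ) → 𝓢(X ν, ℂ)} (j : Fin ν) (h : HasOrder d L) :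
      HasOrder (d + 1) fun φ => qOp j (L φ)
  | succ {d : ℕ} {L : 𝓢(X ν, ℂ) → 𝓢(X ν, ℂ)} (h : HasOrder d L) : HasOrder (d + 1) L

/-- Moving a function of momentum to the right past a position leaves a commutator with one position
fewer, whose symbol is a derivative and hence again bounded with all derivatives. Positions can
therefore always be kept on the left. -/
theorem HasOrder.pFun_comp {d : ℕ} {L : 𝓢(X ν, ℂ) → 𝓢(X ν, ℂ)} (h : HasOrder d L) :
    ∀ {m : X ν → ℝ}, IsSymbol m → HasOrder d fun φ => pFun m (L φ) := by
  induction h with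
  | momentum hm' =>
    intro m hm
    simp only [hm.pFun_pFun hm']
    exact .momentum (hm.mul hm')
  | add _ _ ih ih' =>
    intro m hm
    simp only [map_add]
    exact (ih hm).add (ih' hm)
  | smul c _ ih =>
    intro m hm
    simp only [map_smul]
    exact (ih hm).smul c
  | position j _ ih =>
    intro m hm
    simp only [hm.pFun_qOp]
    exact ((ih hm).position j).add ((ih (hm.fderiv_apply _)).succ.smul _)
  | succ _ ih =>
    intro m hm
    exact (ih hm).succ

theorem HasOrder.sum {d : ℕ} {ι : Type*} (s : Finset ι) {L : ι → 𝓢(X ν, ℂ) → 𝓢(X ν, ℂ)}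
    (h : ∀ i, HasOrder d (L i)) (h0 : HasOrder (ν := ν) d fun _ => 0) :
    HasOrder d fun φ => ∑ i ∈ s, L i φ := by
  classical
  induction s using Finset.induction_on with
  | empty => simpa using h0
  | insert i s hi ih =>
    simp only [Finset.sum_insert hi]
    exact (h i).add ih

theorem HasOrder.conjOp_comp {d : ℕ} {L : 𝓢(X ν, ℂ) → 𝓢(X ν, ℂ)} (h : HasOrder d L)
    {u : X ν → X ν} (hu : ∀ j, IsSymbol fun k => u k j) :
    HasOrder (d + 1) fun φ => conjOp u (L φ) := by
  refine HasOrder.smul _ (HasOrder.sum _ (fun j => ?_) ?_)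
  · exact ((h.position j).pFun_comp (hu j)).add ((h.pFun_comp (hu j)).position j)
  · have := h.succ.smul 0
    simpa using this

theorem energyDensity_add_le (F G : 𝓢(X ν, ℂ)) (x : X ν) :
    energyDensity (F + G) x ≤ 2 * energyDensity F x + 2 * energyDensity G x := by
  have h : ∀ a b : ℂ, ‖a + b‖ ^ 2 ≤ 2 * ‖a‖ ^ 2 + 2 * ‖b‖ ^ 2 := fun a b => by
    have := pow_le_pow_left₀ (norm_nonneg _) (norm_add_le a b) 2
    nlinarith [sq_nonneg (‖a‖ - ‖b‖)]
  simp only [energyDensity, lineDerivOp_add, add_apply]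
  calc _ ≤ (2 * ‖F x‖ ^ 2 + 2 * ‖G x‖ ^ 2) + ∑ j : Fin ν,
        (2 * ‖(∂_{basisVec j} F : 𝓢(X ν, ℂ)) x‖ ^ 2 +
          2 * ‖(∂_{basisVec j} G : 𝓢(X ν, ℂ)) x‖ ^ 2) :=
        add_le_add (h _ _) (Finset.sum_le_sum fun j _ => h _ _)
    _ = _ := by rw [Finset.sum_add_distrib, ← Finset.mul_sum, ← Finset.mul_sum]; ring

theorem shellEnergy_add_le (a : ℝ) (F G : 𝓢(X ν, ℂ)) :
    shellEnergy a (F + G) ≤ 2 * shellEnergy a F + 2 * shellEnergy a G := by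
  have h1 := (integrable_energyDensity F).integrableOn (s := shell ν a)
  have h2 := (integrable_energyDensity G).integrableOn (s := shell ν a)
  rw [shellEnergy, shellEnergy, shellEnergy, ← integral_const_mul, ← integral_const_mul,
    ← integral_add (h1.const_mul 2) (h2.const_mul 2)]
  exact integral_mono (integrable_energyDensity (F + G)).integrableOn
    ((h1.const_mul 2).add (h2.const_mul 2)) (energyDensity_add_le F G)

theorem shellEnergy_smul (a : ℝ) (c : ℂ) (F : 𝓢(X ν, ℂ)) :
    shellEnergy a (c • F) = ‖c‖ ^ 2 * shellEnergy a F := by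
  rw [shellEnergy, shellEnergy, ← integral_const_mul]
  refine integral_congr_ae (Eventually.of_forall fun x => ?_)
  simp only [energyDensity, lineDerivOp_smul, smul_apply, norm_smul, mul_pow, mul_add,
    Finset.mul_sum]

theorem lineDerivOp_qOp (i j : Fin ν) (F : 𝓢(X ν, ℂ)) (x : X ν) :
    ∂_{basisVec i} (qOp j F) x = (x j : ℂ) * ∂_{basisVec i} F x +
      (if i = j then F x else 0) := by
  have h0 : (qOp j F : X ν → ℂ) = fun x => (x j : ℂ) * F x := funext (qOp_apply j F)
  have h1 : HasLineDerivAt ℝ (fun x : X ν => ((x j : ℝ) : ℂ)) (((basisVec i : X ν) j : ℝ) : ℂ) x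
      (basisVec i) :=
    HasDerivAt.ofReal_comp
      ((EuclideanSpace.proj (𝕜 := ℝ) j : X ν →L[ℝ] ℝ).hasFDerivAt.hasLineDerivAt (basisVec i))
  have h4 := HasDerivAt.mul h1 (hasLineDerivAt_schwartz F i x)
  refine (HasDerivAt.unique (hasLineDerivAt_schwartz (qOp j F) i x) (by rw [h0]; exact h4)).trans ?_
  simp [basisVec, add_comm, eq_comm]
  split_ifs <;> simp

theorem energyDensity_qOp_le (j : Fin ν) (F : 𝓢(X ν, ℂ)) (x : X ν) :
    energyDensity (qOp j F) x ≤ (2 * ‖x‖ ^ 2 + 2) * energyDensity F x := by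
  have hx : ‖(x j : ℂ)‖ ≤ ‖x‖ := by
    rw [Complex.norm_real]; exact PiLp.norm_apply_le x j
  have hx2 : ‖(x j : ℂ)‖ ^ 2 ≤ ‖x‖ ^ 2 := pow_le_pow_left₀ (norm_nonneg _) hx 2
  have h1 : ∀ i : Fin ν, ‖(∂_{basisVec i} (qOp j F) : 𝓢(X ν, ℂ)) x‖ ^ 2 ≤
      2 * ‖x‖ ^ 2 * ‖(∂_{basisVec i} F : 𝓢(X ν, ℂ)) x‖ ^ 2 +
        2 * (if i = j then ‖F x‖ ^ 2 else 0) := fun i => by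
    rw [lineDerivOp_qOp]
    have h := pow_le_pow_left₀ (norm_nonneg _)
      (norm_add_le ((x j : ℂ) * (∂_{basisVec i} F : 𝓢(X ν, ℂ)) x) (if i = j then F x else 0)) 2
    have h2 : ‖(if i = j then F x else 0 : ℂ)‖ ^ 2 = if i = j then ‖F x‖ ^ 2 else 0 := by
      split_ifs <;> simp
    have h3 : ‖(x j : ℂ) * (∂_{basisVec i} F : 𝓢(X ν, ℂ)) x‖ ^ 2 ≤
        ‖x‖ ^ 2 * ‖(∂_{basisVec i} F : 𝓢(X ν, ℂ)) x‖ ^ 2 := by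
      rw [norm_mul, mul_pow]
      exact mul_le_mul_of_nonneg_right hx2 (by positivity)
    rw [← h2]
    nlinarith [sq_nonneg (‖(x j : ℂ) * (∂_{basisVec i} F : 𝓢(X ν, ℂ)) x‖ -
      ‖(if i = j then F x else 0 : ℂ)‖)]
  have h2 : ‖qOp j F x‖ ^ 2 ≤ ‖x‖ ^ 2 * ‖F x‖ ^ 2 := by
    rw [qOp_apply, norm_mul, mul_pow]
    exact mul_le_mul_of_nonneg_right hx2 (by positivity)
  have h3 := Finset.sum_le_sum fun i (_ : i ∈ Finset.univ) => h1 i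
  rw [Finset.sum_add_distrib, ← Finset.mul_sum, ← Finset.mul_sum, Finset.sum_ite_eq',
    if_pos (Finset.mem_univ _)] at h3
  have h4 : 0 ≤ ∑ i : Fin ν, ‖(∂_{basisVec i} F : 𝓢(X ν, ℂ)) x‖ ^ 2 :=
    Finset.sum_nonneg fun i _ => by positivity
  rw [energyDensity, energyDensity]
  nlinarith [mul_nonneg (sq_nonneg ‖x‖) (sq_nonneg ‖F x‖)]

/-- On the shell `|x| ≤ 2a`, so the pointwise factor `2|x|² + 2` is at most `10 a²`. -/
theorem shellEnergy_qOp_le {a : ℝ} (ha : 1 ≤ a) (j : Fin ν) (F : 𝓢(X ν, ℂ)) :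
    shellEnergy a (qOp j F) ≤ 10 * a ^ 2 * shellEnergy a F := by
  rw [shellEnergy, shellEnergy, ← integral_const_mul]
  refine setIntegral_mono_on (integrable_energyDensity _).integrableOn
    ((integrable_energyDensity F).integrableOn.const_mul _) (measurableSet_shell a) fun x hx => ?_
  refine (energyDensity_qOp_le j F x).trans
    (mul_le_mul_of_nonneg_right ?_ (energyDensity_nonneg F x))
  have h1 : ‖x‖ ≤ 2 * a := by linarith [(abs_le.1 (show |‖x‖ - a| ≤ 1 from hx)).2]
  have h2 := pow_le_pow_left₀ (norm_nonneg x) h1 2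
  nlinarith

/-- Positions are local and cost a factor of order `a` in norm on the shell. Functions of momentum
are not local but are bounded on `H¹`, so the global norm appears on the right; this is why the
positions have to stand on the left. -/
theorem HasOrder.exists_shellEnergy_le {d : ℕ} {L : 𝓢(X ν, ℂ) → 𝓢(X ν, ℂ)} (h : HasOrder d L) :
    ∃ C : ℝ, 0 ≤ C ∧ ∀ a : ℝ, 1 ≤ a → ∀ φ : 𝓢(X ν, ℂ),
      shellEnergy a (L φ) ≤ C * (a ^ 2) ^ d * ‖toH1 φ‖ ^ 2 := by
  induction h with
  | momentum hm =>
    obtain ⟨C, hC0, hC⟩ := hm.exists_abs_le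
    refine ⟨C ^ 2, by positivity, fun a _ φ => ?_⟩
    rw [pow_zero, mul_one]
    exact (shellEnergy_le _ _).trans (hm.norm_sq_toH1_pFun_le hC φ)
  | add _ _ ih ih' =>
    obtain ⟨C, hC0, hC⟩ := ih
    obtain ⟨C', hC0', hC'⟩ := ih'
    refine ⟨2 * C + 2 * C', by positivity, fun a ha φ => ?_⟩
    refine (shellEnergy_add_le _ _ _).trans ?_
    linarith [hC a ha φ, hC' a ha φ]
  | smul c _ ih =>
    obtain ⟨C, hC0, hC⟩ := ih
    refine ⟨‖c‖ ^ 2 * C, by positivity, fun a ha φ => ?_⟩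
    rw [shellEnergy_smul, mul_assoc, mul_assoc]
    refine mul_le_mul_of_nonneg_left ?_ (by positivity)
    rw [← mul_assoc]
    exact hC a ha φ
  | position j _ ih =>
    obtain ⟨C, hC0, hC⟩ := ih
    refine ⟨10 * C, by positivity, fun a ha φ => ?_⟩
    refine (shellEnergy_qOp_le ha _ _).trans ?_
    refine (mul_le_mul_of_nonneg_left (hC a ha φ) (by positivity)).trans_eq ?_
    ring
  | succ _ ih =>
    obtain ⟨C, hC0, hC⟩ := ih
    refine ⟨C, hC0, fun a ha φ => (hC a ha φ).trans ?_⟩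
    refine mul_le_mul_of_nonneg_right ?_ (by positivity)
    exact mul_le_mul_of_nonneg_left (pow_le_pow_right₀ (one_le_pow₀ ha) (Nat.le_succ _)) hC0

theorem isSymbol_tanhField (j : Fin ν) : IsSymbol fun k => tanhField ν k j := by
  obtain ⟨h1, h2, -⟩ := tanhField_mem ν
  refine ⟨(EuclideanSpace.proj (𝕜 := ℝ) j : X ν →L[ℝ] ℝ).contDiff.comp h1, fun n => ?_⟩
  obtain ⟨C, hC⟩ := h2 n
  refine ⟨‖(EuclideanSpace.proj (𝕜 := ℝ) j : X ν →L[ℝ] ℝ)‖ * C, fun x => ?_⟩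
  refine ((EuclideanSpace.proj (𝕜 := ℝ) j : X ν →L[ℝ] ℝ).norm_iteratedFDeriv_comp_left
    h1.contDiffAt (by exact_mod_cast le_top)).trans ?_
  exact mul_le_mul_of_nonneg_left (hC x) (norm_nonneg _)

end Symbols

/-! ### Second differences of forms along a unitary group. -/

section SecondDifference

open Filter Topology

theorem norm_second_difference_le {F F' F'' : ℝ → ℂ} (h : ∀ t, HasDerivAt F (F' t) t)
    (h' : ∀ t, HasDerivAt F' (F'' t) t) {K : ℝ} (hK : ∀ t, |t| ≤ 1 → ‖F'' t‖ ≤ K) {τ : ℝ}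
    (h0 : 0 ≤ τ) (h1 : τ ≤ 1) : ‖F τ + F (-τ) - 2 * F 0‖ ≤ 2 * K * τ ^ 2 := by
  have hK0 : 0 ≤ K := (norm_nonneg _).trans (hK 0 (by simp))
  have e1 : ∀ t ∈ Set.Icc 0 τ, ‖F' t - F' (-t)‖ ≤ 2 * K * τ := fun t ht => by
    have := (convex_Icc (-1 : ℝ) 1).norm_image_sub_le_of_norm_hasDerivWithin_le
      (fun x _ => (h' x).hasDerivWithinAt) (fun x hx => hK x (abs_le.2 hx))
      (x := -t) (y := t) ⟨by linarith [ht.2], by linarith [ht.1]⟩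
      ⟨by linarith [ht.1], by linarith [ht.2]⟩
    rw [sub_neg_eq_add, Real.norm_of_nonneg (by linarith [ht.1])] at this
    nlinarith [ht.2]
  have e2 : ∀ t, HasDerivAt (fun t => F t + F (-t)) (F' t - F' (-t)) t := fun t => by
    have := (h t).add ((h (-t)).scomp t (hasDerivAt_neg t))
    refine this.congr_deriv ?_
    simp [sub_eq_add_neg]
  have e3 := (convex_Icc (0 : ℝ) τ).norm_image_sub_le_of_norm_hasDerivWithin_le
    (fun x _ => (e2 x).hasDerivWithinAt) e1 (x := 0) (y := τ) ⟨le_rfl, h0⟩ ⟨h0, le_rfl⟩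
  rw [sub_zero, Real.norm_of_nonneg h0] at e3
  calc _ = ‖F τ + F (-τ) - (F 0 + F (-0))‖ := by rw [neg_zero]; congr 1; ring
    _ ≤ _ := e3.trans_eq (by ring)

variable {H : Type*} [NormedAddCommGroup H] [InnerProductSpace ℂ H]

theorem IsOneParamGroup.hasDerivAt_form {U : ℝ → (H ≃ₗᵢ[ℂ] H)} (hU : IsOneParamGroup U)
    (M : H →L[ℂ] H) {f f' g g' : H} (hf : (f, f') ∈ genGraph U) (hg : (g, g') ∈ genGraph U)
    (t : ℝ) : HasDerivAt (fun t => (inner ℂ (U t g) (M (U t f)) : ℂ))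
      (Complex.I * (inner ℂ (U t g) (M (U t f')) - inner ℂ (U t g') (M (U t f)))) t := by
  have h1 := (M.restrictScalars ℝ).hasFDerivAt.comp_hasDerivAt t (hU.hasDerivAt_orbit hf t)
  have h2 := (hU.hasDerivAt_orbit hg t).inner ℂ h1
  refine h2.congr_deriv ?_
  have e1 : (M.restrictScalars ℝ) (Complex.I • U t f') = Complex.I • M (U t f') := M.map_smul _ _
  rw [e1, inner_smul_left, inner_smul_right, Complex.conj_I]
  change _ + -Complex.I * inner ℂ (U t g') (M (U t f)) = _
  ring

/-- The second difference of a bounded form along a unitary group. -/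
theorem IsOneParamGroup.norm_second_difference_form_le {U : ℝ → (H ≃ₗᵢ[ℂ] H)}
    (hU : IsOneParamGroup U) (M : H →L[ℂ] H) {f f' f'' g g' g'' : H}
    (hf : (f, f') ∈ genGraph U) (hf' : (f', f'') ∈ genGraph U)
    (hg : (g, g') ∈ genGraph U) (hg' : (g', g'') ∈ genGraph U) {K : ℝ}
    (hK2 : ∀ t, |t| ≤ 1 → ‖(inner ℂ (U t g) (M (U t f'')) : ℂ)‖ ≤ K)
    (hK1 : ∀ t, |t| ≤ 1 → ‖(inner ℂ (U t g') (M (U t f')) : ℂ)‖ ≤ K)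
    (hK0 : ∀ t, |t| ≤ 1 → ‖(inner ℂ (U t g'') (M (U t f)) : ℂ)‖ ≤ K) {τ : ℝ}
    (h0 : 0 ≤ τ) (h1 : τ ≤ 1) :
    ‖(inner ℂ (U τ g) (M (U τ f)) : ℂ) + inner ℂ (U (-τ) g) (M (U (-τ) f)) -
      2 * inner ℂ g (M f)‖ ≤ 8 * K * τ ^ 2 := by
  -- The second derivative is a double commutator. It combines the three kinds of pairing with
  -- weights 1, 2 and 1, whence `4 * K`.
  have h := norm_second_difference_le (hU.hasDerivAt_form M hf hg)
    (fun t => ((hU.hasDerivAt_form M hf' hg t).sub (hU.hasDerivAt_form M hf hg' t)).const_mul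
      Complex.I) (K := 4 * K) (fun t ht => ?_) h0 h1
  · simp only [hU.apply_zero] at h
    exact h.trans_eq (by ring)
  · rw [← mul_sub, norm_mul, norm_mul, Complex.norm_I, one_mul, one_mul]
    have e1 := hK2 t ht
    have e2 := hK1 t ht
    have e3 := hK0 t ht
    calc _ ≤ (‖(inner ℂ (U t g) (M (U t f'')) : ℂ)‖ + ‖(inner ℂ (U t g') (M (U t f')) : ℂ)‖) +
          (‖(inner ℂ (U t g') (M (U t f')) : ℂ)‖ + ‖(inner ℂ (U t g'') (M (U t f)) : ℂ)‖) :=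
          (norm_sub_le _ _).trans (add_le_add (norm_sub_le _ _) (norm_sub_le _ _))
      _ ≤ _ := by linarith

end SecondDifference

/-! ### Orbits of core vectors under the group. -/

section Orbits

open Filter Topology

variable {ν : ℕ} {v : ℝ → ℝ} (b : LineFlow v)

theorem LineFlow.mem_genGraph (hv : v.HasTemperateGrowth) {u : X ν → X ν}
    (hu : ∀ k j, u k j = v (k j)) {φ : 𝓢(X ν, ℂ)} (hφ : φ ∈ momentumCore ν) :
    ((φ.toLp 2 volume : L2 ν), ((conjOp u φ).toLp 2 volume : L2 ν)) ∈
      genGraph fun t => (b.unitary t : L2 ν ≃ₗᵢ[ℂ] L2 ν) :=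
  b.hasDerivAt_unitary hv hu hφ

/-- The group commutes with its generator, and the generator is single-valued. Powers of `A_u` can
thus be applied after the evolution, where the order estimates are available. -/
theorem LineFlow.evolveS_conjOp (hv : v.HasTemperateGrowth) {u : X ν → X ν}
    (hu : ∀ k j, u k j = v (k j)) {φ : 𝓢(X ν, ℂ)} (hφ : φ ∈ momentumCore ν) (t : ℝ) :
    b.evolveS t (conjOp u φ) (conjOp_mem_momentumCore hv hu hφ) =
      conjOp u (b.evolveS t φ hφ) := by
  have hG := b.isOneParamGroup_unitary (ν := ν) hv
  have h2 := hG.orbit_mem (b.mem_genGraph hv hu hφ) t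
  rw [b.unitary_toLp t φ hφ, b.unitary_toLp t _ (conjOp_mem_momentumCore hv hu hφ)] at h2
  exact SchwartzMap.injective_toLp (F := ℂ) 2 volume
    (IsOneParamGroup.snd_unique h2 (b.mem_genGraph hv hu (b.evolveS_mem t φ hφ)))

theorem LineFlow.unitary_toLp_conjOp (hv : v.HasTemperateGrowth) {u : X ν → X ν}
    (hu : ∀ k j, u k j = v (k j)) {φ : 𝓢(X ν, ℂ)} (hφ : φ ∈ momentumCore ν) (t : ℝ) :
    b.unitary t ((conjOp u φ).toLp 2 volume : L2 ν) =
      ((conjOp u (b.evolveS t φ hφ)).toLp 2 volume : L2 ν) := by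
  rw [b.unitary_toLp t _ (conjOp_mem_momentumCore hv hu hφ), b.evolveS_conjOp hv hu hφ]

theorem LineFlow.unitary_toLp_conjOp_conjOp (hv : v.HasTemperateGrowth) {u : X ν → X ν}
    (hu : ∀ k j, u k j = v (k j)) {φ : 𝓢(X ν, ℂ)} (hφ : φ ∈ momentumCore ν) (t : ℝ) :
    b.unitary t ((conjOp u (conjOp u φ)).toLp 2 volume : L2 ν) =
      ((conjOp u (conjOp u (b.evolveS t φ hφ))).toLp 2 volume : L2 ν) := by
  rw [b.unitary_toLp_conjOp hv hu (conjOp_mem_momentumCore hv hu hφ), b.evolveS_conjOp hv hu hφ]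

theorem LineFlow.norm_toH1_evolveS_le {t : ℝ} (ht : |t| ≤ 1) {φ : 𝓢(X ν, ℂ)}
    (hφ : φ ∈ momentumCore ν) : ‖toH1 (b.evolveS t φ hφ)‖ ≤ Real.exp 1 * ‖toH1 φ‖ := by
  rw [← b.sobolevGroup_toH1 t hφ]
  refine ((b.sobolevGroup t : H1 ν →L[ℂ] H1 ν).le_opNorm _).trans ?_
  exact mul_le_mul_of_nonneg_right ((b.norm_sobolevGroup_le t).trans (Real.exp_le_exp.2 ht))
    (norm_nonneg _)

/-- `τ ↦ T_τ + T_{-τ} - 2 T`. -/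
def secondDifference (S : ℝ → H1 ν →L[ℂ] H1 ν) (T : H1 ν →L[ℂ] Hneg1 ν) (τ : ℝ) :
    H1 ν →L[ℂ] Hneg1 ν := evolve S T τ + evolve S T (-τ) - (2 : ℂ) • T

theorem secondDifference_apply (S : ℝ → H1 ν →L[ℂ] H1 ν) (T : H1 ν →L[ℂ] Hneg1 ν) (τ : ℝ)
    (f g : H1 ν) : secondDifference S T τ f g =
      T (S (-τ) f) (S (-τ) g) + T (S τ f) (S τ g) - 2 * T f g := by
  have h : secondDifference S T τ f g =
      T (S (-τ) f) (S (-τ) g) + T (S (- -τ) f) (S (- -τ) g) - 2 * T f g := rfl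
  rw [h, neg_neg]

theorem LineFlow.norm_secondDifference_le (T : H1 ν →L[ℂ] Hneg1 ν) {τ : ℝ} (hτ : |τ| ≤ 1) :
    ‖secondDifference (fun t => b.sobolevGroup t) T τ‖ ≤ (2 * Real.exp 1 ^ 2 + 2) * ‖T‖ := by
  have hS : ∀ t : ℝ, |t| ≤ 1 → ∀ f g : H1 ν,
      ‖T (b.sobolevGroup t f) (b.sobolevGroup t g)‖ ≤ Real.exp 1 ^ 2 * ‖T‖ * ‖f‖ * ‖g‖ := by
    intro t ht f g
    have h1 : ∀ f : H1 ν, ‖b.sobolevGroup t f‖ ≤ Real.exp 1 * ‖f‖ := fun f =>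
      ((b.sobolevGroup t : H1 ν →L[ℂ] H1 ν).le_opNorm f).trans (mul_le_mul_of_nonneg_right
        ((b.norm_sobolevGroup_le t).trans (Real.exp_le_exp.2 ht)) (norm_nonneg _))
    calc _ ≤ ‖T‖ * ‖b.sobolevGroup t f‖ * ‖b.sobolevGroup t g‖ := T.le_opNorm₂ _ _
      _ ≤ ‖T‖ * (Real.exp 1 * ‖f‖) * (Real.exp 1 * ‖g‖) :=
        mul_le_mul (mul_le_mul_of_nonneg_left (h1 f) (norm_nonneg T)) (h1 g) (norm_nonneg _)
          (by positivity)
      _ = _ := by ring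
  refine norm_le_of_forall_momentumCore _ (by positivity) fun φ _ ψ _ => ?_
  rw [secondDifference_apply]
  refine (norm_sub_le _ _).trans ((add_le_add_left (norm_add_le _ _) _).trans ?_)
  have h1 := hS τ hτ (toH1 φ) (toH1 ψ)
  have h2 := hS (-τ) (by rwa [abs_neg]) (toH1 φ) (toH1 ψ)
  have h3 := T.le_opNorm₂ (toH1 φ) (toH1 ψ)
  rw [norm_mul, Complex.norm_ofNat]
  linarith

end Orbits

/-! ### The potential is of class `C^{1,1}` for the bounded vector field. -/

section Regularity

open Filter Topology

variable {ν : ℕ} {χ : ℝ → ℝ}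

/-- Two positions in total cost `n²` on the `n`-th shell, against the decay `n^{-11/4}` of the form.
-/
theorem exists_norm_termOp_toH1_le (hν : 3 ≤ ν) (hχ : ContDiff ℝ 1 χ)
    (hs : ∀ t : ℝ, 1 < |t| → χ t = 0) {L L' : 𝓢(X ν, ℂ) → 𝓢(X ν, ℂ)} {d d' : ℕ}
    (hL : HasOrder d L) (hL' : HasOrder d' L') (hd : d + d' = 2) :
    ∃ C : ℝ, 0 ≤ C ∧ ∀ n : ℕ, 2 ≤ n → ∀ φ ψ : 𝓢(X ν, ℂ),
      ‖termOp ν hχ hs n (toH1 (L φ)) (toH1 (L' ψ))‖ ≤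
        C * (n : ℝ) ^ (-(3 / 4) : ℝ) * (‖toH1 φ‖ * ‖toH1 ψ‖) := by
  obtain ⟨C, hC0, hC⟩ := exists_potentialTerm_estimate hν hχ hs
  obtain ⟨A, hA0, hA⟩ := hL.exists_shellEnergy_le
  obtain ⟨B, hB0, hB⟩ := hL'.exists_shellEnergy_le
  refine ⟨C * Real.sqrt (A * B), by positivity, fun n hn φ ψ => ?_⟩
  have hn2 : (2 : ℝ) ≤ n := by exact_mod_cast hn
  have hn0 : (0 : ℝ) < n := by linarith
  rw [termOp, mulOp_toH1]
  refine le_of_sq_le_sq ((hC n hn (L φ) (L' ψ)).trans ?_) (by positivity)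
  have e1 : ((n : ℝ) ^ (-(11 / 4) : ℝ)) ^ 2 * ((n : ℝ) ^ 2) ^ 2 = ((n : ℝ) ^ (-(3 / 4) : ℝ)) ^ 2 := by
    rw [← mul_pow]
    congr 1
    rw [← Real.rpow_natCast (n : ℝ) 2, ← Real.rpow_add hn0]
    norm_num
  calc _ ≤ (C * (n : ℝ) ^ (-(11 / 4) : ℝ)) ^ 2 * (A * ((n : ℝ) ^ 2) ^ d * ‖toH1 φ‖ ^ 2) *
        (B * ((n : ℝ) ^ 2) ^ d' * ‖toH1 ψ‖ ^ 2) :=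
        mul_le_mul (mul_le_mul_of_nonneg_left (hA n (by linarith) φ) (by positivity))
          (hB n (by linarith) ψ) (shellEnergy_nonneg _ _) (by positivity)
    _ = C ^ 2 * (A * B) * (((n : ℝ) ^ (-(11 / 4) : ℝ)) ^ 2 * ((n : ℝ) ^ 2) ^ (d + d')) *
        (‖toH1 φ‖ * ‖toH1 ψ‖) ^ 2 := by rw [pow_add]; ring
    _ = _ := by
      rw [hd, e1]
      linear_combination (-(C ^ 2 * ((n : ℝ) ^ (-(3 / 4) : ℝ)) ^ 2 *
        (‖toH1 φ‖ * ‖toH1 ψ‖) ^ 2)) * Real.sq_sqrt (mul_nonneg hA0 hB0)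

theorem hasOrder_id : HasOrder (ν := ν) 0 fun φ => φ := by
  have h1 : IsSymbol fun _ : X ν => (1 : ℝ) := by
    refine ⟨contDiff_const, fun n => ⟨1, fun x => ?_⟩⟩
    rcases Nat.eq_zero_or_pos n with rfl | hn
    · simp
    · rw [iteratedFDeriv_const_of_ne hn.ne']; simp
  have h2 := HasOrder.momentum h1
  simpa [pFun, SchwartzMap.fourierMultiplierCLM_const] using h2

/-- A single term is a bounded function, so its form can be differentiated twice in `L²` along
orbits of the core. The generator falls twice on one side or once on each; these are the three
constants `A`, `B`, `D`. The evolution itself costs at most `exp 1` in each `H¹` norm. -/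
theorem exists_norm_secondDifference_termOp_le (hν : 3 ≤ ν) (hχ : ContDiff ℝ 1 χ)
    (hs : ∀ t : ℝ, 1 < |t| → χ t = 0) :
    ∃ C : ℝ, 0 ≤ C ∧ ∀ n : ℕ, 2 ≤ n → ∀ τ : ℝ, 0 ≤ τ → τ ≤ 1 →
      ‖secondDifference (fun t => tanhFlow.sobolevGroup t) (termOp ν hχ hs n) τ‖ ≤
        C * (n : ℝ) ^ (-(3 / 4) : ℝ) * τ ^ 2 := by
  have h0 := hasOrder_id (ν := ν)
  have h1 := h0.conjOp_comp (isSymbol_tanhField (ν := ν))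
  have h2 := h1.conjOp_comp (isSymbol_tanhField (ν := ν))
  have hv := hasTemperateGrowth_tanh
  have hu : ∀ (k : X ν) (j : Fin ν), tanhField ν k j = Real.tanh (k j) := fun _ _ => rfl
  obtain ⟨A, hA0, hA⟩ := exists_norm_termOp_toH1_le hν hχ hs h2 h0 rfl
  obtain ⟨B, hB0, hB⟩ := exists_norm_termOp_toH1_le hν hχ hs h1 h1 rfl
  obtain ⟨D, hD0, hD⟩ := exists_norm_termOp_toH1_le hν hχ hs h0 h2 rfl
  refine ⟨8 * ((A + B + D) * Real.exp 1 ^ 2), by positivity, fun n hn τ hτ0 hτ1 => ?_⟩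
  refine norm_le_of_forall_momentumCore _ (by positivity) fun φ hφ ψ hψ => ?_
  have hE : ∀ t, |t| ≤ 1 → ‖toH1 (tanhFlow.evolveS t φ hφ)‖ * ‖toH1 (tanhFlow.evolveS t ψ hψ)‖ ≤
      Real.exp 1 ^ 2 * (‖toH1 φ‖ * ‖toH1 ψ‖) := fun t ht => by
    refine (mul_le_mul (tanhFlow.norm_toH1_evolveS_le ht hφ) (tanhFlow.norm_toH1_evolveS_le ht hψ)
      (norm_nonneg _) (by positivity)).trans_eq ?_
    ring
  have hbound : ∀ Q : ℝ, 0 ≤ Q → Q ≤ A + B + D → ∀ t, |t| ≤ 1 → ∀ z : ℝ,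
      z ≤ Q * (n : ℝ) ^ (-(3 / 4) : ℝ) *
        (‖toH1 (tanhFlow.evolveS t φ hφ)‖ * ‖toH1 (tanhFlow.evolveS t ψ hψ)‖) →
      z ≤ (A + B + D) * Real.exp 1 ^ 2 * (n : ℝ) ^ (-(3 / 4) : ℝ) * (‖toH1 φ‖ * ‖toH1 ψ‖) := by
    intro Q hQ0 hQ t ht z hz
    refine hz.trans ((mul_le_mul_of_nonneg_left (hE t ht) (by positivity)).trans ?_)
    calc _ = Q * (Real.exp 1 ^ 2 * (n : ℝ) ^ (-(3 / 4) : ℝ) * (‖toH1 φ‖ * ‖toH1 ψ‖)) := by ring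
      _ ≤ (A + B + D) * (Real.exp 1 ^ 2 * (n : ℝ) ^ (-(3 / 4) : ℝ) * (‖toH1 φ‖ * ‖toH1 ψ‖)) :=
        mul_le_mul_of_nonneg_right hQ (by positivity)
      _ = _ := by ring
  have h := (tanhFlow.isOneParamGroup_unitary (ν := ν) hv).norm_second_difference_form_le
    (mulL2 _ (memLp_potentialTerm (ν := ν) hχ hs n))
    (tanhFlow.mem_genGraph hv hu hφ)
    (tanhFlow.mem_genGraph hv hu (conjOp_mem_momentumCore hv hu hφ))
    (tanhFlow.mem_genGraph hv hu hψ)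
    (tanhFlow.mem_genGraph hv hu (conjOp_mem_momentumCore hv hu hψ))
    (K := (A + B + D) * Real.exp 1 ^ 2 * (n : ℝ) ^ (-(3 / 4) : ℝ) * (‖toH1 φ‖ * ‖toH1 ψ‖))
    (fun t ht => ?_) (fun t ht => ?_) (fun t ht => ?_) hτ0 hτ1
  · rw [secondDifference_apply, add_comm (termOp ν hχ hs n _ _)]
    exact h.trans_eq (by ring)
  · rw [tanhFlow.unitary_toLp_conjOp_conjOp hv hu hφ, tanhFlow.unitary_toLp t ψ hψ]
    exact hbound A hA0 (by linarith) t ht _ (hA n hn _ _)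
  · rw [tanhFlow.unitary_toLp_conjOp hv hu hφ, tanhFlow.unitary_toLp_conjOp hv hu hψ]
    exact hbound B hB0 (by linarith) t ht _ (hB n hn _ _)
  · rw [tanhFlow.unitary_toLp_conjOp_conjOp hv hu hψ, tanhFlow.unitary_toLp t φ hφ]
    exact hbound D hD0 (by linarith) t ht _ (hD n hn _ _)

theorem hasSum_termOp_apply (hν : 3 ≤ ν) (hχ : ContDiff ℝ 1 χ) (hs : ∀ t : ℝ, 1 < |t| → χ t = 0)
    (f g : H1 ν) : HasSum (fun n : Set.Ici (2 : ℕ) => termOp ν hχ hs n f g)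
      (potentialOp ν hχ hs f g) := by
  have h1 := (summable_termOp hν hχ hs).hasSum.mapL (ContinuousLinearMap.apply ℂ (Hneg1 ν) f)
  exact h1.mapL (ContinuousLinearMap.apply' ℂ (starRingEnd ℂ) g)

/-- The bound of order `τ²` is not summable over the shells and the summable bound has no power of
`τ`; a geometric mean of the two is summable and still beats `τ`. -/
theorem exists_norm_secondDifference_potentialOp_le (hν : 3 ≤ ν) (hχ : ContDiff ℝ 1 χ)
    (hs : ∀ t : ℝ, 1 < |t| → χ t = 0) :
    ∃ C : ℝ, 0 ≤ C ∧ ∀ τ : ℝ, 0 < τ → τ ≤ 1 →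
      ‖secondDifference (fun t => tanhFlow.sobolevGroup t) (potentialOp ν hχ hs) τ‖ ≤
        C * τ ^ (3 / 2 : ℝ) := by
  obtain ⟨A, hA0, hA⟩ := exists_norm_secondDifference_termOp_le hν hχ hs
  obtain ⟨B, hB0, hB⟩ := exists_norm_termOp_le hν hχ hs
  set C : ℝ := A + (2 * Real.exp 1 ^ 2 + 2) * B with hC
  have hC0 : 0 ≤ C := by positivity
  have hterm : ∀ n : ℕ, 2 ≤ n → ∀ τ : ℝ, 0 < τ → τ ≤ 1 →
      ‖secondDifference (fun t => tanhFlow.sobolevGroup t) (termOp ν hχ hs n) τ‖ ≤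
        C * τ ^ (3 / 2 : ℝ) * (n : ℝ) ^ (-(5 / 4) : ℝ) := by
    intro n hn τ hτ0 hτ1
    have hn0 : (0 : ℝ) < n := by positivity
    have h1 : ‖secondDifference (fun t => tanhFlow.sobolevGroup t) (termOp ν hχ hs n) τ‖ ≤
        C * (n : ℝ) ^ (-(3 / 4) : ℝ) * τ ^ 2 := by
      refine (hA n hn τ hτ0.le hτ1).trans ?_
      have : A ≤ C := le_add_of_nonneg_right (by positivity)
      gcongr
    have h2 : ‖secondDifference (fun t => tanhFlow.sobolevGroup t) (termOp ν hχ hs n) τ‖ ≤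
        C * (n : ℝ) ^ (-(11 / 4) : ℝ) := by
      refine (tanhFlow.norm_secondDifference_le _ (by rwa [abs_of_pos hτ0])).trans ?_
      refine (mul_le_mul_of_nonneg_left (hB n hn) (by positivity)).trans ?_
      rw [← mul_assoc]
      exact mul_le_mul_of_nonneg_right (le_add_of_nonneg_left hA0) (by positivity)
    generalize ‖secondDifference (fun t => tanhFlow.sobolevGroup t) (termOp ν hχ hs n) τ‖ = z at *
    rcases lt_or_ge z 0 with hz | hz
    · exact hz.le.trans (by positivity)
    -- Interpolation with weights 3/4 and 1/4, in fourth powers: the exponents of `n` add up to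
    -- `-3·3/4 - 11/4 = -5`, and `τ⁶` is the fourth power of `τ^{3/2}`.
    refine le_of_pow_le_pow_left₀ (n := 4) (by norm_num) (by positivity) ?_
    have e1 : ((n : ℝ) ^ (-(3 / 4) : ℝ)) ^ 3 * (n : ℝ) ^ (-(11 / 4) : ℝ) =
        ((n : ℝ) ^ (-(5 / 4) : ℝ)) ^ 4 := by
      rw [← Real.rpow_mul_natCast hn0.le, ← Real.rpow_mul_natCast hn0.le, ← Real.rpow_add hn0]
      norm_num
    have e2 : (τ ^ 2) ^ 3 = (τ ^ (3 / 2 : ℝ)) ^ 4 := by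
      rw [← pow_mul, ← Real.rpow_natCast, ← Real.rpow_mul_natCast hτ0.le]
      norm_num
    calc z ^ 4 = z ^ 3 * z := by ring
      _ ≤ (C * (n : ℝ) ^ (-(3 / 4) : ℝ) * τ ^ 2) ^ 3 * (C * (n : ℝ) ^ (-(11 / 4) : ℝ)) :=
        mul_le_mul (pow_le_pow_left₀ hz h1 3) h2 hz (by positivity)
      _ = C ^ 4 * (τ ^ 2) ^ 3 * (((n : ℝ) ^ (-(3 / 4) : ℝ)) ^ 3 * (n : ℝ) ^ (-(11 / 4) : ℝ)) := by
        ring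
      _ = _ := by rw [e1, e2]; ring
  have hsum := summable_rpow_Ici (p := (-(5 / 4) : ℝ)) (by norm_num) 1
  simp only [one_mul] at hsum
  refine ⟨C * ∑' n : Set.Ici (2 : ℕ), ((n : ℕ) : ℝ) ^ (-(5 / 4) : ℝ),
    mul_nonneg hC0 (tsum_nonneg fun n => by positivity), fun τ hτ0 hτ1 => ?_⟩
  have hS0 : 0 ≤ ∑' n : Set.Ici (2 : ℕ), ((n : ℕ) : ℝ) ^ (-(5 / 4) : ℝ) :=
    tsum_nonneg fun n => by positivity
  refine norm_le_of_forall_momentumCore _ (by positivity) fun φ _ ψ _ => ?_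
  rw [secondDifference_apply]
  have h1 := ((hasSum_termOp_apply hν hχ hs (tanhFlow.sobolevGroup (-τ) (toH1 φ))
    (tanhFlow.sobolevGroup (-τ) (toH1 ψ))).add (hasSum_termOp_apply hν hχ hs
    (tanhFlow.sobolevGroup τ (toH1 φ)) (tanhFlow.sobolevGroup τ (toH1 ψ)))).sub
    ((hasSum_termOp_apply hν hχ hs (toH1 φ) (toH1 ψ)).mul_left 2)
  refine (h1.norm_le_of_bounded (hsum.hasSum.mul_left
    (C * τ ^ (3 / 2 : ℝ) * (‖toH1 φ‖ * ‖toH1 ψ‖))) fun n => ?_).trans_eq (by ring)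
  have h2 := secondDifference_apply (fun t => tanhFlow.sobolevGroup t) (termOp ν hχ hs n) τ
    (toH1 φ) (toH1 ψ)
  refine (congrArg norm h2.symm).le.trans ?_
  refine (ContinuousLinearMap.le_opNorm₂ _ _ _).trans ?_
  rw [mul_assoc]
  refine (mul_le_mul_of_nonneg_right (hterm n n.2 τ hτ0 hτ1) (by positivity)).trans_eq ?_
  ring

theorem isClassC11_potentialOp (hν : 3 ≤ ν) (hχ : ContDiff ℝ 1 χ)
    (hs : ∀ t : ℝ, 1 < |t| → χ t = 0) :
    IsClassC11 (tanhField ν) (potentialOp ν hχ hs) := by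
  refine ⟨_, tanhFlow.isSobolevGroup hasTemperateGrowth_tanh fun _ _ => rfl, ?_⟩
  obtain ⟨C, hC0, hC⟩ := exists_norm_secondDifference_potentialOp_le hν hχ hs
  -- Dividing `τ^{3/2}` by `τ²` leaves an integrable singularity at zero.
  have hint : IntegrableOn (fun τ : ℝ => C * τ ^ (-(1 / 2) : ℝ)) (Set.Ioc 0 1) :=
    ((intervalIntegrable_iff_integrableOn_Ioc_of_le zero_le_one).1
      (intervalIntegral.intervalIntegrable_rpow' (by norm_num))).const_mul C
  refine lt_of_le_of_lt ?_ hint.lintegral_lt_top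
  refine setLIntegral_mono' measurableSet_Ioc fun τ hτ => ENNReal.ofReal_le_ofReal ?_
  have h1 : ‖secondDifference (fun t => tanhFlow.sobolevGroup t) (potentialOp ν hχ hs) τ‖ ≤
      C * τ ^ (3 / 2 : ℝ) := hC τ hτ.1 hτ.2
  have h2 : (0 : ℝ) < τ := hτ.1
  rw [div_le_iff₀ (by positivity)]
  refine le_trans h1 (le_of_eq ?_)
  rw [mul_assoc, ← Real.rpow_natCast τ 2, ← Real.rpow_add h2]
  norm_num

end Regularity

end LAP

end

/-! ### The theorem. -/

theorem lemmal (ν : ℕ) (hν : 3 ≤ ν) (χ : ℝ → ℝ) (hχ : ContDiff ℝ 3 χ)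
    (hχ_supp : ∀ t : ℝ, 1 < |t| → χ t = 0)
    (hχ_one : deriv χ 0 = 1) (hχ_two : deriv (deriv χ) 0 = 1) :
    (∀ x : LAP.X ν, {n : Set.Ici (2 : ℕ) | LAP.potentialTerm ν χ n x ≠ 0}.Finite) ∧
    ∃ T : LAP.H1 ν →L[ℂ] LAP.Hneg1 ν,
      LAP.IsMultiplicationBy (LAP.potential ν χ) T ∧
      IsCompactOperator T ∧
      (∃ u ∈ LAP.VectorFieldClass ν, LAP.IsClassC11 u T) ∧
      ¬ LAP.IsLaplacianBounded (LAP.potential ν χ) ∧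
      ((∃ S, LAP.IsSobolevGroup (fun k : LAP.X ν => k) S) ∧
        ¬ LAP.IsClassC1 (fun k : LAP.X ν => k) T) := by
  have hχ1 : ContDiff ℝ 1 χ := hχ.of_le (by norm_num)
  have hmul := LAP.isMultiplicationBy_potentialOp hν hχ1 hχ_supp
  exact ⟨LAP.finite_potentialTerm_ne_zero hν hχ_supp, LAP.potentialOp ν hχ1 hχ_supp, hmul,
    LAP.isCompactOperator_potentialOp hν hχ1 hχ_supp,
    ⟨LAP.tanhField ν, LAP.tanhField_mem ν, LAP.isClassC11_potentialOp hν hχ1 hχ_supp⟩,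
    LAP.not_isLaplacianBounded hν hχ1 hχ_supp hχ_one,
    ⟨_, LAP.dilationFlow.isSobolevGroup (by fun_prop) fun _ _ => rfl⟩,
    LAP.not_isClassC1 hν hχ hχ_supp hχ_two hmul⟩
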